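/- All algebras are unital over $\mathbb C$; a Hopf $*$-algebra is a Hopf algebra with an involutive conjugate-linear anti-multiplicative map $*$ such that $\Delta(x^*)=\Delta(x)^{*\otimes *}$. Sweedler's notation $\Delta(x)=x_{(1)}\otimes x_{(2)}$ is used for coproducts, and $\delta(x)=x^{(1)}\otimes x^{(2)}$ for right coactions. **Setting.** Let $H$ be a Hopf $*$-algebra, $T$ a compact (Hausdorff) abelian group with dual group $\hat T$, $\mathbb C[T]=\mathbb C\hat T$ the group Hopf $*$-algebra of $\hat T$, and $\pi\colon H\to\mathbb C[T]$ a map of Hopf $*$-algebras. Put $H_{a,b}=\{x\in H:\ \pi(x_{(1)})\otimes x_{(2)}=a\otimes x,\ x_{(1)}\otimes\pi(x_{(2)})=x\otimes b\}$ for $a,b\in\hat T$, so that $H=\bigoplus_{a,b}H_{a,b}$, and $\mathrm{ad}_\pi(x)=x_{(2)}\otimes\pi(S(x_{(1)})x_{(3)})\in H\otimes\mathbb C[T]$. Let $T_0\subset T$ be a closed subgroup, $q\colon\mathbb C[T]\to\mathbb C[T_0]$ the restriction map and $i\colon\mathbb C[T/T_0]\to\mathbb C[T]$ the embedding. Assume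 that $T_0$ is $H$-cocentral, that is, $(\iota\otimes q)\mathrm{ad}_\pi(x)=x\otimes1$ for all $x\in H$. Then $\mathrm{ad}_\pi$ takes values in $H\otimes\mathbb C[T/T_0]$. Let $\beta\colon\hat T\times\hat T\to\mathbb T$ be a bicharacter, extended to a linear map $\mathbb C[T]\otimes\mathbb C[T]\to\mathbb C$. **Transmutation.** $H_\beta$ is the coalgebra $H$ with unit $1$, coaction $\mathrm{ad}_\pi$ of $\mathbb C[T/T_0]$, product $x\cdot_\beta y=x_{(2)}y_{(3)}\,\beta(\pi(x_{(3)}),S(\pi(y_{(1)})))\,\beta(\pi(x_{(1)}),\pi(y_{(2)}))$, antipode $S_\beta(x)=S(x_{(2)})\,\beta(\pi(S^2(x_{(3)})S(x_{(1)})),\pi(x_{(4)}))$ and involution $x^{*_\beta}=\beta(a^{-1}b,a^{-1})x^*$ for $x\in H_{a,b}$. It is a Hopf $*$-algebra in the category of right $\mathbb C[T/T_0]$-comodules with the braiding $m\otimes n\mapsto(i^*\beta)(m^{(2)},n^{(2)})\,n^{(1)}\otimes m^{(1)}$, where $i^*\beta=\beta\circ(i\otimes i)$. **Bosonization.** Let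 $R$ be a unitary coquasitriangular structure on a Hopf $*$-algebra $K$, and $A$ a Hopf $*$-algebra in the category of right $K$-comodules with the braiding defined as above by $R$. Its bosonization $K\#A$ is the Hopf $*$-algebra with underlying space $K\otimes A$, product $(h\# a)(h'\# a')=R(a^{(2)},h'_{(2)})\,hh'_{(1)}\# a^{(1)}a'$, unit $1\#1$, involution $(h\# a)^*=(1\# a^*)(h^*\#1)$, counit $\varepsilon\otimes\varepsilon$, coproduct $\Delta(h\# a)=(h_{(1)}\# a_{(1)}{}^{(1)})\otimes(h_{(2)}a_{(1)}{}^{(2)}\# a_{(2)})$ and antipode $S(h\# a)=(1\# S_A(a^{(1)}))(S_K(ha^{(2)})\#1)$. We consider $\mathbb C[T/T_0]\# H_\beta$ (with $R=i^*\beta$) and $\mathbb C[T/T_0]\ltimes H$, the bosonization of $H$ itself with the coaction $\mathrm{ad}_\pi$ and $R=\varepsilon\otimes\varepsilon$. **Twisting.** A unitary Hopf 2-cocycle on a Hopf $*$-algebra $B$ is a convolution invertible $J\colon B\otimes B\to\mathbb C$ with $J(x_{(1)},y_{(1)})J(x_{(2)}y_{(2)},z)=J(y_{(1)},z_{(1)})J(x,y_{(2)}z_{(2)})$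 and $J^{-1}(x,y)=\overline{J(S(x)^*,S(y)^*)}$. The twist ${}_JB_{J^{-1}}$ has the same coalgebra structure and unit, and $x\star_Jy=J(x_{(1)},y_{(1)})\,x_{(2)}y_{(2)}\,J^{-1}(x_{(3)},y_{(3)})$, $S^J(x)=u(x_{(1)})S(x_{(2)})u^{-1}(x_{(3)})$, $x^{*_J}=u^{-1}(S(x_{(1)})^*)\,x_{(2)}^*\,u(S(x_{(3)})^*)$, where $u(x)=J(x_{(1)},S(x_{(2)}))$ and $u^{-1}$ is its convolution inverse. Finally, let $(\mathbb C[T]\otimes H)^{\Delta(T_0)}$ be the space of $z\in\mathbb C[T]\otimes H$ with $z_{(1)}\otimes\rho(z_{(2)})=z\otimes1$, where $\rho(a\otimes x)=q(a)\,q(\pi(x))\in\mathbb C[T_0]$, and let $$J_1((a,b),(c,d))=\overline{\beta(b,c)},\qquad J_2((a,b),(c,d))=\overline{\beta(b,cd^{-1})}$$ for $(a,b),(c,d)\in\hat T\times\hat T$. Extend $J_1$ and $J_2$ bilinearly to $\mathbb C[T]\otimes\mathbb C[T]$, and pull $J_1$ back to $(\mathbb C[T]\otimes H)^{\Delta(T_0)}$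 by $\iota\otimes\pi$, and $J_2$ to $\mathbb C[T/T_0]\ltimes H$ by $i\otimes\pi$. **Theorem.** For every $H$-cocentral closed subgroup $T_0\subset T$, the following holds. (i) $(\mathbb C[T]\otimes H)^{\Delta(T_0)}$ is a Hopf $*$-subalgebra of $\mathbb C[T]\otimes H$, the map $\mathrm{ad}_\pi$ takes values in $H\otimes\mathbb C[T/T_0]$, $H_\beta$ is a braided Hopf $*$-algebra over $(\mathbb C[T/T_0],i^*\beta)$, and $\mathbb C[T/T_0]\ltimes H$ and $\mathbb C[T/T_0]\# H_\beta$ are Hopf $*$-algebras. The functionals defined by $J_1$ and $J_2$ are unitary Hopf 2-cocycles, and the corresponding twists are Hopf $*$-algebras. (ii) We have Hopf $*$-algebra isomorphisms $${}_{J_1}\big((\mathbb C[T]\otimes H)^{\Delta(T_0)}\big)_{J_1^{-1}}\cong\mathbb C[T/T_0]\# H_\beta,\quad a\otimes x\mapsto a\pi(x_{(1)})\# x_{(2)},$$ $${}_{J_2}\big(\mathbb C[T/T_0]\ltimes H\big)_{J_2^{-1}}\cong\mathbb C[T/T_0]\# H_\beta,\quad a\otimes x\mapsto a\# x.$$ 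-/

import Mathlib

open scoped TensorProduct

noncomputable section

namespace CocycleTwist

/-! ### Linear algebra -/

section Linear

variable {U V W C : Type*} [AddCommGroup U] [Module ℂ U] [AddCommGroup V] [Module ℂ V]
  [AddCommGroup W] [Module ℂ W] [AddCommGroup C] [Module ℂ C]

/-- Conjugate-linear maps. -/
abbrev AntiLin (V W : Type*) [AddCommGroup V] [Module ℂ V] [AddCommGroup W] [Module ℂ W] :=
  V →ₛₗ[starRingEnd ℂ] W

/-- `x ↦ f(x₍₁₎) g(x₍₂₎)` for a scalar valued `f` and a vector valued `g`, where
`Δ(x) = x₍₁₎ ⊗ x₍₂₎`; both maps are linear, or both are conjugate-linear. -/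
def convL {σ : ℂ →+* ℂ} (Δ : C →ₗ[ℂ] C ⊗[ℂ] C) (f : C →ₛₗ[σ] ℂ) (g : C →ₛₗ[σ] W) : C →ₛₗ[σ] W :=
  ((TensorProduct.lid ℂ W).toLinearMap.comp (TensorProduct.map f g)).comp Δ

/-- `x ↦ g(x₍₁₎) f(x₍₂₎)` for a vector valued `g` and a scalar valued `f`. -/
def convR {σ : ℂ →+* ℂ} (Δ : C →ₗ[ℂ] C ⊗[ℂ] C) (g : C →ₛₗ[σ] W) (f : C →ₛₗ[σ] ℂ) : C →ₛₗ[σ] W :=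
  ((TensorProduct.rid ℂ W).toLinearMap.comp (TensorProduct.map g f)).comp Δ

/-- `g` is a two-sided inverse of the functional `f` for the convolution product. -/
def IsConvInv (Δ : C →ₗ[ℂ] C ⊗[ℂ] C) (ε f g : C →ₗ[ℂ] ℂ) : Prop :=
  convL Δ f g = ε ∧ convL Δ g f = ε

open scoped Classical in
/-- The convolution inverse of `f` (and `0` if `f` is not convolution invertible). -/
def convInv (Δ : C →ₗ[ℂ] C ⊗[ℂ] C) (ε f : C →ₗ[ℂ] ℂ) : C →ₗ[ℂ] ℂ :=
  if h : ∃ g, IsConvInv Δ ε f g then h.choose else 0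

open scoped Classical in
/-- The map `g : U → W` such that `j ∘ g = f`, where `j : W → V` is meant to be injective
(and `0` if there is no such map). -/
def corestrict {σ : ℂ →+* ℂ} (j : W →ₗ[ℂ] V) (f : U →ₛₗ[σ] V) : U →ₛₗ[σ] W :=
  if h : ∃ g : U →ₛₗ[σ] W, j.comp g = f then h.choose else 0

end Linear

/-! ### Hopf `*`-algebras -/

/-- A collection of operations on a vector space, of the type that a Hopf `*`-algebra has. The
axioms are listed in `HopfStarOps.IsHopfStar`. -/
structure HopfStarOps (V : Type*) [AddCommGroup V] [Module ℂ V] where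
  mul : V →ₗ[ℂ] V →ₗ[ℂ] V
  one : V
  comul : V →ₗ[ℂ] V ⊗[ℂ] V
  counit : V →ₗ[ℂ] ℂ
  antipode : V →ₗ[ℂ] V
  star : AntiLin V V

namespace HopfStarOps

variable {V W : Type*} [AddCommGroup V] [Module ℂ V] [AddCommGroup W] [Module ℂ W]

/-- The product as a map `V ⊗ V → V`. -/
def mulT (O : HopfStarOps V) : V ⊗[ℂ] V →ₗ[ℂ] V := TensorProduct.lift O.mul

/-- The coproduct of the tensor product coalgebra `V ⊗ V`. -/
def comul₂ (O : HopfStarOps V) : V ⊗[ℂ] V →ₗ[ℂ] (V ⊗[ℂ] V) ⊗[ℂ] (V ⊗[ℂ] V) :=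
  (TensorProduct.tensorTensorTensorComm ℂ V V V V).toLinearMap ∘ₗ
    TensorProduct.map O.comul O.comul

/-- The counit of the tensor product coalgebra `V ⊗ V`. -/
def counit₂ (O : HopfStarOps V) : V ⊗[ℂ] V →ₗ[ℂ] ℂ :=
  (TensorProduct.lid ℂ ℂ).toLinearMap ∘ₗ TensorProduct.map O.counit O.counit

/-- The axioms of a Hopf `*`-algebra. -/
structure IsHopfStar (O : HopfStarOps V) : Prop where
  mul_assoc : ∀ x y z, O.mul (O.mul x y) z = O.mul x (O.mul y z)
  one_mul : ∀ x, O.mul O.one x = x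
  mul_one : ∀ x, O.mul x O.one = x
  coassoc : ∀ x, TensorProduct.assoc ℂ V V V (TensorProduct.map O.comul .id (O.comul x)) =
    TensorProduct.map .id O.comul (O.comul x)
  counit_comul : ∀ x, TensorProduct.map O.counit .id (O.comul x) = (1 : ℂ) ⊗ₜ x
  comul_counit : ∀ x, TensorProduct.map .id O.counit (O.comul x) = x ⊗ₜ (1 : ℂ)
  comul_mul : ∀ x y, O.comul (O.mul x y) = TensorProduct.map₂ O.mul O.mul (O.comul x) (O.comul y)
  comul_one : O.comul O.one = O.one ⊗ₜ O.one
  counit_mul : ∀ x y, O.counit (O.mul x y) = O.counit x * O.counit y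
  counit_one : O.counit O.one = 1
  antipode_left : ∀ x, O.mulT (TensorProduct.map O.antipode .id (O.comul x)) = O.counit x • O.one
  antipode_right : ∀ x, O.mulT (TensorProduct.map .id O.antipode (O.comul x)) = O.counit x • O.one
  star_star : ∀ x, O.star (O.star x) = x
  star_mul : ∀ x y, O.star (O.mul x y) = O.mul (O.star y) (O.star x)
  comul_star : ∀ x, O.comul (O.star x) = TensorProduct.map O.star O.star (O.comul x)
  counit_star : ∀ x, O.counit (O.star x) = starRingEnd ℂ (O.counit x)

/-- A linear map that preserves all operations of Hopf `*`-algebras. -/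
structure IsHopfStarHom (O : HopfStarOps V) (O' : HopfStarOps W) (f : V →ₗ[ℂ] W) : Prop where
  map_mul : ∀ x y, f (O.mul x y) = O'.mul (f x) (f y)
  map_one : f O.one = O'.one
  map_comul : ∀ x, TensorProduct.map f f (O.comul x) = O'.comul (f x)
  map_counit : ∀ x, O'.counit (f x) = O.counit x
  map_antipode : ∀ x, f (O.antipode x) = O'.antipode (f x)
  map_star : ∀ x, f (O.star x) = O'.star (f x)

/-- The operations of a Hopf algebra (in Mathlib's sense) with a `*`-structure. -/
def ofHopf (A : Type*) [Ring A] [HopfAlgebra ℂ A] [StarRing A] [StarModule ℂ A] :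
    HopfStarOps A where
  mul := LinearMap.mul ℂ A
  one := 1
  comul := Coalgebra.comul
  counit := Coalgebra.counit
  antipode := HopfAlgebra.antipode ℂ
  star := (starLinearEquiv ℂ : A ≃ₗ⋆[ℂ] A).toLinearMap

open scoped Classical in
/-- The operations induced on a subspace that is closed under all operations of `O`, which for the
coproduct means that `Δ(W) ⊂ W ⊗ W`. They are determined by the condition that the inclusion
preserves all operations. -/
def restrict (O : HopfStarOps V) (W : Submodule ℂ V) : HopfStarOps W where
  mul := TensorProduct.curry
    (corestrict W.subtype (O.mulT ∘ₗ TensorProduct.map W.subtype W.subtype))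
  one := if h : O.one ∈ W then ⟨O.one, h⟩ else 0
  comul := corestrict (TensorProduct.map W.subtype W.subtype) (O.comul ∘ₗ W.subtype)
  counit := O.counit ∘ₗ W.subtype
  antipode := corestrict W.subtype (O.antipode ∘ₗ W.subtype)
  star := corestrict W.subtype (O.star.comp W.subtype)

/-! ### Cocycle twisting -/

/-- `J` is a unitary Hopf 2-cocycle: it is convolution invertible,
`J(x₍₁₎, y₍₁₎) J(x₍₂₎ y₍₂₎, z) = J(y₍₁₎, z₍₁₎) J(x, y₍₂₎ z₍₂₎)`, and
`J⁻¹(x, y)` is the complex conjugate of `J(S(x)^*, S(y)^*)`. -/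
structure IsUnitaryCocycle (O : HopfStarOps V) (J : V ⊗[ℂ] V →ₗ[ℂ] ℂ) : Prop where
  invertible : ∃ J' : V ⊗[ℂ] V →ₗ[ℂ] ℂ, IsConvInv O.comul₂ O.counit₂ J J'
  cocycle : ∀ x y z : V,
    convL O.comul₂ J (J ∘ₗ (TensorProduct.mk ℂ V V).flip z ∘ₗ O.mulT) (x ⊗ₜ y) =
      convL O.comul₂ J (J ∘ₗ TensorProduct.mk ℂ V V x ∘ₗ O.mulT) (y ⊗ₜ z)
  unitary : ∀ x y : V, convInv O.comul₂ O.counit₂ J (x ⊗ₜ y) =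
    starRingEnd ℂ (J (O.star (O.antipode x) ⊗ₜ O.star (O.antipode y)))

/-- The functional `u(x) = J(x₍₁₎, S(x₍₂₎))`. -/
def twistU (O : HopfStarOps V) (J : V ⊗[ℂ] V →ₗ[ℂ] ℂ) : V →ₗ[ℂ] ℂ :=
  J ∘ₗ TensorProduct.map .id O.antipode ∘ₗ O.comul

/-- The convolution inverse of `u`. -/
def twistUInv (O : HopfStarOps V) (J : V ⊗[ℂ] V →ₗ[ℂ] ℂ) : V →ₗ[ℂ] ℂ :=
  convInv O.comul O.counit (O.twistU J)

/-- The cocycle twist by `J`: the coalgebra is unchanged, while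
`x ⋆ y = J(x₍₁₎, y₍₁₎) x₍₂₎ y₍₂₎ J⁻¹(x₍₃₎, y₍₃₎)`,
`S^J(x) = u(x₍₁₎) S(x₍₂₎) u⁻¹(x₍₃₎)`, and the new involution maps `x` into
`u⁻¹(S(x₍₁₎)^*) x₍₂₎^* u(S(x₍₃₎)^*)`. -/
def twist (O : HopfStarOps V) (J : V ⊗[ℂ] V →ₗ[ℂ] ℂ) : HopfStarOps V where
  mul := TensorProduct.curry
    (convR O.comul₂ (convL O.comul₂ J O.mulT) (convInv O.comul₂ O.counit₂ J))
  one := O.one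
  comul := O.comul
  counit := O.counit
  antipode := convR O.comul (convL O.comul (O.twistU J) O.antipode) (O.twistUInv J)
  star := convR O.comul
    (convL O.comul ((O.twistUInv J).comp (O.star.comp O.antipode)) O.star)
    ((O.twistU J).comp (O.star.comp O.antipode))

end HopfStarOps

/-! ### Braided Hopf `*`-algebras and bosonization -/

section Braided

variable {K M N A B : Type*} [AddCommGroup K] [Module ℂ K] [AddCommGroup M] [Module ℂ M]
  [AddCommGroup N] [Module ℂ N] [AddCommGroup A] [Module ℂ A] [AddCommGroup B] [Module ℂ B]

/-- The braiding `m ⊗ n ↦ R(m⁽²⁾, n⁽²⁾) n⁽¹⁾ ⊗ m⁽¹⁾` of right `K`-comodules. -/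
def braiding (R : K ⊗[ℂ] K →ₗ[ℂ] ℂ) (δM : M →ₗ[ℂ] M ⊗[ℂ] K) (δN : N →ₗ[ℂ] N ⊗[ℂ] K) :
    M ⊗[ℂ] N →ₗ[ℂ] N ⊗[ℂ] M :=
  (TensorProduct.rid ℂ (N ⊗[ℂ] M)).toLinearMap ∘ₗ
    TensorProduct.map (TensorProduct.comm ℂ M N).toLinearMap R ∘ₗ
    (TensorProduct.tensorTensorTensorComm ℂ M K N K).toLinearMap ∘ₗ
    TensorProduct.map δM δN

/-- The product of the braided tensor product `A ⊗_R B`: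
`(a ⊗ b) (a' ⊗ b') = R(b⁽²⁾, a'⁽²⁾) a a'⁽¹⁾ ⊗ b⁽¹⁾ b'`. -/
def braidedMul (R : K ⊗[ℂ] K →ₗ[ℂ] ℂ) (mA : A →ₗ[ℂ] A →ₗ[ℂ] A) (δA : A →ₗ[ℂ] A ⊗[ℂ] K)
    (mB : B →ₗ[ℂ] B →ₗ[ℂ] B) (δB : B →ₗ[ℂ] B ⊗[ℂ] K) :
    A ⊗[ℂ] B →ₗ[ℂ] A ⊗[ℂ] B →ₗ[ℂ] A ⊗[ℂ] B :=
  TensorProduct.curry <|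
    TensorProduct.map (TensorProduct.lift mA) (TensorProduct.lift mB) ∘ₗ
    (TensorProduct.assoc ℂ A A (B ⊗[ℂ] B)).symm.toLinearMap ∘ₗ
    TensorProduct.map .id ((TensorProduct.assoc ℂ A B B).toLinearMap ∘ₗ
      TensorProduct.map (braiding R δB δA) .id ∘ₗ
      (TensorProduct.assoc ℂ B A B).symm.toLinearMap) ∘ₗ
    (TensorProduct.assoc ℂ A B (A ⊗[ℂ] B)).toLinearMap

/-- The involution of the braided tensor product `A ⊗_R B`:
`(a ⊗ b)^* = (1 ⊗ b^*) (a^* ⊗ 1)`, which is the braiding applied to `b^* ⊗ a^*`. -/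
def braidedStar (R : K ⊗[ℂ] K →ₗ[ℂ] ℂ) (sA : AntiLin A A) (δA : A →ₗ[ℂ] A ⊗[ℂ] K)
    (sB : AntiLin B B) (δB : B →ₗ[ℂ] B ⊗[ℂ] K) : AntiLin (A ⊗[ℂ] B) (A ⊗[ℂ] B) :=
  ((braiding R δB δA).comp (TensorProduct.map sB sA)).comp
    (TensorProduct.comm ℂ A B).toLinearMap

/-- Operations of a braided Hopf `*`-algebra over `K`, together with a coaction of `K`. The axioms
are listed in `BraidedOps.IsBraidedHopfStar`. -/
structure BraidedOps (K A : Type*) [AddCommGroup K] [Module ℂ K] [AddCommGroup A] [Module ℂ A]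
    extends HopfStarOps A where
  coact : A →ₗ[ℂ] A ⊗[ℂ] K

namespace BraidedOps

/-- The diagonal coaction on `A ⊗ A`: `a ⊗ b ↦ a⁽¹⁾ ⊗ b⁽¹⁾ ⊗ a⁽²⁾ b⁽²⁾`. -/
def coact₂ (k : HopfStarOps K) (A' : BraidedOps K A) :
    A ⊗[ℂ] A →ₗ[ℂ] (A ⊗[ℂ] A) ⊗[ℂ] K :=
  TensorProduct.map .id k.mulT ∘ₗ
    (TensorProduct.tensorTensorTensorComm ℂ A K A K).toLinearMap ∘ₗ
    TensorProduct.map A'.coact A'.coact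

/-- The axioms of a Hopf `*`-algebra in the category of right comodules over the Hopf `*`-algebra
`k`, with the braiding defined by `R`. -/
structure IsBraidedHopfStar (k : HopfStarOps K) (R : K ⊗[ℂ] K →ₗ[ℂ] ℂ) (O : BraidedOps K A) :
    Prop where
  coact_coassoc : ∀ x, TensorProduct.assoc ℂ A K K (TensorProduct.map O.coact .id (O.coact x)) =
    TensorProduct.map .id k.comul (O.coact x)
  coact_counit : ∀ x, TensorProduct.map .id k.counit (O.coact x) = x ⊗ₜ (1 : ℂ)
  mul_assoc : ∀ x y z, O.mul (O.mul x y) z = O.mul x (O.mul y z)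
  one_mul : ∀ x, O.mul O.one x = x
  mul_one : ∀ x, O.mul x O.one = x
  star_star : ∀ x, O.star (O.star x) = x
  star_mul : ∀ x y, O.star (O.mul x y) = O.mul (O.star y) (O.star x)
  coact_mul : ∀ x y, O.coact (O.mul x y) =
    TensorProduct.map₂ O.mul k.mul (O.coact x) (O.coact y)
  coact_one : O.coact O.one = O.one ⊗ₜ k.one
  coact_star : ∀ x, O.coact (O.star x) = TensorProduct.map O.star k.star (O.coact x)
  coassoc : ∀ x, TensorProduct.assoc ℂ A A A (TensorProduct.map O.comul .id (O.comul x)) =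
    TensorProduct.map .id O.comul (O.comul x)
  counit_comul : ∀ x, TensorProduct.map O.counit .id (O.comul x) = (1 : ℂ) ⊗ₜ x
  comul_counit : ∀ x, TensorProduct.map .id O.counit (O.comul x) = x ⊗ₜ (1 : ℂ)
  coact_comul : ∀ x, O.coact₂ k (O.comul x) = TensorProduct.map O.comul .id (O.coact x)
  coact_counit' : ∀ x, TensorProduct.map O.counit .id (O.coact x) = O.counit x ⊗ₜ k.one
  coact_antipode : ∀ x, O.coact (O.antipode x) = TensorProduct.map O.antipode .id (O.coact x)
  comul_mul : ∀ x y, O.comul (O.mul x y) =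
    braidedMul R O.mul O.coact O.mul O.coact (O.comul x) (O.comul y)
  comul_one : O.comul O.one = O.one ⊗ₜ O.one
  comul_star : ∀ x, O.comul (O.star x) =
    braidedStar R O.star O.coact O.star O.coact (O.comul x)
  counit_mul : ∀ x y, O.counit (O.mul x y) = O.counit x * O.counit y
  counit_one : O.counit O.one = 1
  counit_star : ∀ x, O.counit (O.star x) = starRingEnd ℂ (O.counit x)
  antipode_left : ∀ x, O.mulT (TensorProduct.map O.antipode .id (O.comul x)) = O.counit x • O.one
  antipode_right : ∀ x, O.mulT (TensorProduct.map .id O.antipode (O.comul x)) = O.counit x • O.one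

/-- The bosonization `K # A`: as a `*`-algebra it is `K ⊗_R A`, where `K` is viewed as a comodule
by means of its coproduct; the counit is `ε(h # a) = ε(h) ε(a)`, the coproduct is
`Δ(h # a) = (h₍₁₎ # a₍₁₎⁽¹⁾) ⊗ (h₍₂₎ a₍₁₎⁽²⁾ # a₍₂₎)` and the antipode is
`S(h # a) = (1 # S(a⁽¹⁾)) (S(h a⁽²⁾) # 1)`. -/
def bosonization (k : HopfStarOps K) (R : K ⊗[ℂ] K →ₗ[ℂ] ℂ) (O : BraidedOps K A) :
    HopfStarOps (K ⊗[ℂ] A) where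
  mul := braidedMul R k.mul k.comul O.mul O.coact
  one := k.one ⊗ₜ O.one
  comul :=
    TensorProduct.map .id (TensorProduct.map (k.mulT ∘ₗ (TensorProduct.comm ℂ K K).toLinearMap) .id
      ∘ₗ (TensorProduct.assoc ℂ K K A).symm.toLinearMap) ∘ₗ
    (TensorProduct.assoc ℂ (K ⊗[ℂ] A) K (K ⊗[ℂ] A)).toLinearMap ∘ₗ
    TensorProduct.map (TensorProduct.assoc ℂ K A K).symm.toLinearMap .id ∘ₗ
    (TensorProduct.tensorTensorTensorComm ℂ K K (A ⊗[ℂ] K) A).toLinearMap ∘ₗ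
    TensorProduct.map .id (TensorProduct.map O.coact .id) ∘ₗ
    TensorProduct.map k.comul O.comul
  counit := (TensorProduct.lid ℂ ℂ).toLinearMap ∘ₗ TensorProduct.map k.counit O.counit
  antipode :=
    TensorProduct.lift (braidedMul R k.mul k.comul O.mul O.coact) ∘ₗ
    TensorProduct.map (TensorProduct.mk ℂ K A k.one ∘ₗ O.antipode)
      ((TensorProduct.mk ℂ K A).flip O.one ∘ₗ k.antipode ∘ₗ k.mulT) ∘ₗ
    (TensorProduct.leftComm ℂ K A K).toLinearMap ∘ₗ
    TensorProduct.map .id O.coact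
  star := braidedStar R k.star k.comul O.star O.coact

end BraidedOps

end Braided

/-! ### Transmutation -/

section Transmutation

variable {H K : Type*} [Ring H] [HopfAlgebra ℂ H] [Ring K] [HopfAlgebra ℂ K]

variable (H) in
/-- The iterated coproduct `x ↦ x₍₁₎ ⊗ (x₍₂₎ ⊗ x₍₃₎)`. -/
def comul3 : H →ₗ[ℂ] H ⊗[ℂ] (H ⊗[ℂ] H) :=
  TensorProduct.map .id Coalgebra.comul ∘ₗ Coalgebra.comul

variable (H) in
/-- The iterated coproduct `x ↦ x₍₁₎ ⊗ (x₍₂₎ ⊗ (x₍₃₎ ⊗ x₍₄₎))`. -/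
def comul4 : H →ₗ[ℂ] H ⊗[ℂ] (H ⊗[ℂ] (H ⊗[ℂ] H)) :=
  TensorProduct.map .id (comul3 H) ∘ₗ Coalgebra.comul

variable (H) in
/-- The adjoint coaction `x ↦ x₍₂₎ ⊗ S(x₍₁₎) x₍₃₎`. -/
def ad : H →ₗ[ℂ] H ⊗[ℂ] H :=
  TensorProduct.map .id (LinearMap.mul' ℂ H ∘ₗ TensorProduct.map (HopfAlgebra.antipode ℂ) .id) ∘ₗ
    (TensorProduct.leftComm ℂ H H H).toLinearMap ∘ₗ comul3 H

/-- The restricted adjoint coaction `ad_π = (ι ⊗ π) ad`. -/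
def adMap (π : H →ₗ[ℂ] K) : H →ₗ[ℂ] H ⊗[ℂ] K :=
  TensorProduct.map .id π ∘ₗ ad H

/-- The product of the transmutation,
`x ·_R y = x₍₂₎ y₍₃₎ R(π(x₍₃₎), S(π(y₍₁₎))) R(π(x₍₁₎), π(y₍₂₎))`. It is the composition of the maps
`x ⊗ y ↦ x₍₁₎ ⊗ y₍₂₎ R(π(x₍₂₎), S(π(y₍₁₎)))` and `x ⊗ y ↦ R(π(x₍₁₎), π(y₍₁₎)) x₍₂₎ ⊗ y₍₂₎`
with the original product. -/
def transMul (R : K ⊗[ℂ] K →ₗ[ℂ] ℂ) (π : H →ₗ[ℂ] K) : H →ₗ[ℂ] H →ₗ[ℂ] H :=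
  TensorProduct.curry <|
    LinearMap.mul' ℂ H ∘ₗ
    ((TensorProduct.lid ℂ (H ⊗[ℂ] H)).toLinearMap ∘ₗ
      TensorProduct.map (R ∘ₗ TensorProduct.map π π) .id ∘ₗ
      (TensorProduct.tensorTensorTensorComm ℂ H H H H).toLinearMap ∘ₗ
      TensorProduct.map Coalgebra.comul Coalgebra.comul) ∘ₗ
    (TensorProduct.map .id
        ((TensorProduct.lid ℂ H).toLinearMap ∘ₗ
          TensorProduct.map (R ∘ₗ TensorProduct.map π (HopfAlgebra.antipode ℂ ∘ₗ π)) .id ∘ₗ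
          (TensorProduct.assoc ℂ H H H).symm.toLinearMap) ∘ₗ
      (TensorProduct.assoc ℂ H H (H ⊗[ℂ] H)).toLinearMap ∘ₗ
      TensorProduct.map Coalgebra.comul Coalgebra.comul)

/-- The antipode of the transmutation,
`S_R(x) = S(x₍₂₎) R(π(S²(x₍₃₎) S(x₍₁₎)), π(x₍₄₎))`. -/
def transAntipode (R : K ⊗[ℂ] K →ₗ[ℂ] ℂ) (π : H →ₗ[ℂ] K) : H →ₗ[ℂ] H :=
  (TensorProduct.rid ℂ H).toLinearMap ∘ₗ
    TensorProduct.map (HopfAlgebra.antipode ℂ)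
      (R ∘ₗ
        TensorProduct.map
          (π ∘ₗ LinearMap.mul' ℂ H ∘ₗ
            TensorProduct.map (HopfAlgebra.antipode ℂ ∘ₗ HopfAlgebra.antipode ℂ)
              (HopfAlgebra.antipode ℂ) ∘ₗ
            (TensorProduct.comm ℂ H H).toLinearMap) π ∘ₗ
        (TensorProduct.assoc ℂ H H H).symm.toLinearMap) ∘ₗ
    (TensorProduct.leftComm ℂ H H (H ⊗[ℂ] H)).toLinearMap ∘ₗ comul4 H

end Transmutation

/-! ### Group algebras -/

section GroupAlgebra

variable {G G' : Type*} [CommGroup G] [CommGroup G'] {V : Type*} [AddCommGroup V] [Module ℂ V]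

/-- The linear extension to `ℂ[G]` of a function on `G`. -/
def linExt (f : G → V) : MonoidAlgebra ℂ G →ₗ[ℂ] V :=
  Finsupp.linearCombination ℂ f ∘ₗ
    (MonoidAlgebra.coeffLinearEquiv ℂ : MonoidAlgebra ℂ G ≃ₗ[ℂ] (G →₀ ℂ)).toLinearMap

/-- The bilinear extension to `ℂ[G] ⊗ ℂ[G']` of a function on `G × G'`. -/
def linExt₂ (f : G → G' → V) : MonoidAlgebra ℂ G ⊗[ℂ] MonoidAlgebra ℂ G' →ₗ[ℂ] V :=
  TensorProduct.lift (linExt fun a => linExt fun b => f a b)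

/-- The extension of `J : (G × G) × (G × G) → ℂ` to a functional on
`(ℂ[G] ⊗ ℂ[G]) ⊗ (ℂ[G] ⊗ ℂ[G])`. -/
def linExt₄ (J : G × G → G × G → ℂ) :
    (MonoidAlgebra ℂ G ⊗[ℂ] MonoidAlgebra ℂ G) ⊗[ℂ]
      (MonoidAlgebra ℂ G ⊗[ℂ] MonoidAlgebra ℂ G) →ₗ[ℂ] ℂ :=
  TensorProduct.lift (linExt₂ fun a b => linExt₂ fun c d => J (a, b) (c, d))

/-- The involution of the group algebra as an additive map: `(r a)^* = conj r a⁻¹`. -/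
def groupAlgebraStar : MonoidAlgebra ℂ G →+ MonoidAlgebra ℂ G where
  toFun x := x.coeff.sum fun a r => MonoidAlgebra.single a⁻¹ (starRingEnd ℂ r)
  map_zero' := by simp
  map_add' x y := by
    rw [MonoidAlgebra.coeff_add, Finsupp.sum_add_index'] <;> simp

lemma groupAlgebraStar_single (a : G) (r : ℂ) :
    groupAlgebraStar (MonoidAlgebra.single a r) =
      MonoidAlgebra.single a⁻¹ (starRingEnd ℂ r) := by
  change (Finsupp.single a r).sum
    (fun a r => MonoidAlgebra.single a⁻¹ (starRingEnd ℂ r)) = _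
  rw [Finsupp.sum_single_index]
  simp

/-- The group algebra as a `*`-ring. -/
instance groupAlgebraStarRing : StarRing (MonoidAlgebra ℂ G) where
  star x := groupAlgebraStar x
  star_involutive x := by
    induction x using MonoidAlgebra.induction_linear with
    | zero => simp
    | add x y hx hy => simpa using congrArg₂ (· + ·) hx hy
    | single a r => simp [groupAlgebraStar_single]
  star_mul x y := by
    induction x using MonoidAlgebra.induction_linear with
    | zero => simp
    | add x x' hx hx' => rw [add_mul, map_add, map_add, mul_add, hx, hx']
    | single a r =>
      induction y using MonoidAlgebra.induction_linear with
      | zero => simp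
      | add y y' hy hy' => rw [mul_add, map_add, map_add, add_mul, hy, hy']
      | single b t =>
        simp [groupAlgebraStar_single, MonoidAlgebra.single_mul_single, mul_comm]
  star_add x y := map_add _ x y

lemma star_single (a : G) (r : ℂ) :
    star (MonoidAlgebra.single a r) = MonoidAlgebra.single a⁻¹ (starRingEnd ℂ r) :=
  groupAlgebraStar_single a r

instance : StarModule ℂ (MonoidAlgebra ℂ G) where
  star_smul t x := by
    induction x using MonoidAlgebra.induction_linear with
    | zero => simp
    | add x y hx hy => rw [smul_add, star_add, star_add, smul_add, hx, hy]
    | single a r => simp [star_single]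

end GroupAlgebra

/-! ### Transmutation over a compact abelian group -/

section CompactGroup

variable (T : Type*) [CommGroup T] [TopologicalSpace T]

/-- `ℂ[T]`, identified with the group algebra of the dual group of `T`. -/
abbrev Pol := MonoidAlgebra ℂ (PontryaginDual T)

variable {T} [IsTopologicalGroup T]

/-- The restriction map `q : ℂ[T] → ℂ[T₀]` for a subgroup `T₀ ⊂ T`. -/
def resMap (T₀ : Subgroup T) : Pol T →ₐc[ℂ] Pol T₀ :=
  MonoidAlgebra.mapDomainBialgHom ℂ
    (PontryaginDual.map (⟨T₀.subtype, continuous_subtype_val⟩ : T₀ →ₜ* T)).toMonoidHom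

/-- The embedding `i : ℂ[T/T₀] → ℂ[T]`. -/
def quotMap (T₀ : Subgroup T) : Pol (T ⧸ T₀) →ₐc[ℂ] Pol T :=
  MonoidAlgebra.mapDomainBialgHom ℂ
    (PontryaginDual.map
      (⟨QuotientGroup.mk' T₀, QuotientGroup.continuous_mk⟩ : T →ₜ* T ⧸ T₀)).toMonoidHom

variable {H : Type*} [Ring H] [HopfAlgebra ℂ H]

/-- `T₀` is `H`-cocentral with respect to `π : H → ℂ[T]`: the adjoint coaction `ad_{qπ}` of `ℂ[T₀]`
on `H` is trivial. -/
def IsCocentral (π : H →ₐc[ℂ] Pol T) (T₀ : Subgroup T) : Prop :=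
  ∀ x : H, adMap ((resMap T₀ : Pol T →ₗ[ℂ] Pol T₀) ∘ₗ (π : H →ₗ[ℂ] Pol T)) x = x ⊗ₜ 1

/-- The bilinear extension of a bicharacter `β` to a functional on `ℂ[T] ⊗ ℂ[T]`. -/
def bicharForm (β : PontryaginDual T →* PontryaginDual T →* Circle) :
    Pol T ⊗[ℂ] Pol T →ₗ[ℂ] ℂ :=
  linExt₂ fun a b => (β a b : ℂ)

/-- The linear map on `H` which is multiplication by `f a b` on the space `H_{a,b}` of the elements
`x` such that `π(x₍₁₎) ⊗ x₍₂₎ = a ⊗ x` and `x₍₁₎ ⊗ π(x₍₂₎) = x ⊗ b`: it maps `x` into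
`f(π(x₍₁₎), π(x₍₃₎)) x₍₂₎`, where `f` is extended bilinearly. -/
def bigradedScale (π : H →ₐc[ℂ] Pol T) (f : PontryaginDual T → PontryaginDual T → ℂ) :
    H →ₗ[ℂ] H :=
  (TensorProduct.rid ℂ H).toLinearMap ∘ₗ
    TensorProduct.map .id (linExt₂ f ∘ₗ TensorProduct.map (π : H →ₗ[ℂ] Pol T) π) ∘ₗ
    (TensorProduct.leftComm ℂ H H H).toLinearMap ∘ₗ comul3 H

/-- The involution of the transmutation: `x ↦ β(a⁻¹b, a⁻¹) x^*` for `x ∈ H_{a,b}`. -/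
def transStar [StarRing H] [StarModule ℂ H] (π : H →ₐc[ℂ] Pol T)
    (β : PontryaginDual T →* PontryaginDual T →* Circle) : AntiLin H H :=
  (starLinearEquiv ℂ : H ≃ₗ⋆[ℂ] H).toLinearMap.comp
    (bigradedScale π fun a b => starRingEnd ℂ (β (a⁻¹ * b) a⁻¹ : ℂ))

/-- The adjoint coaction `ad_π` viewed as a coaction of `ℂ[T/T₀]`: the map
`H → H ⊗ ℂ[T/T₀]` whose composition with `ι ⊗ i` is `ad_π`. -/
def quotCoact (π : H →ₐc[ℂ] Pol T) (T₀ : Subgroup T) : H →ₗ[ℂ] H ⊗[ℂ] Pol (T ⧸ T₀) :=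
  corestrict (TensorProduct.map .id (quotMap T₀ : Pol (T ⧸ T₀) →ₗ[ℂ] Pol T))
    (adMap (π : H →ₗ[ℂ] Pol T))

variable [StarRing H] [StarModule ℂ H]

/-- `H` with its own operations and the coaction `ad_π` of `ℂ[T/T₀]`. -/
def untwisted (π : H →ₐc[ℂ] Pol T) (T₀ : Subgroup T) : BraidedOps (Pol (T ⧸ T₀)) H where
  toHopfStarOps := HopfStarOps.ofHopf H
  coact := quotCoact π T₀

/-- The transmutation `H_β`, over `ℂ[T/T₀]`. -/
def transmutation (π : H →ₐc[ℂ] Pol T)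
    (β : PontryaginDual T →* PontryaginDual T →* Circle) (T₀ : Subgroup T) :
    BraidedOps (Pol (T ⧸ T₀)) H where
  mul := transMul (bicharForm β) (π : H →ₗ[ℂ] Pol T)
  one := 1
  comul := Coalgebra.comul
  counit := Coalgebra.counit
  antipode := transAntipode (bicharForm β) (π : H →ₗ[ℂ] Pol T)
  star := transStar π β
  coact := quotCoact π T₀

/-- The restriction `i^*β` of the bicharacter to `ℂ[T/T₀]`. -/
def quotForm (β : PontryaginDual T →* PontryaginDual T →* Circle) (T₀ : Subgroup T) :
    Pol (T ⧸ T₀) ⊗[ℂ] Pol (T ⧸ T₀) →ₗ[ℂ] ℂ :=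
  bicharForm β ∘ₗ TensorProduct.map (quotMap T₀ : Pol (T ⧸ T₀) →ₗ[ℂ] Pol T) (quotMap T₀)

/-- The bosonization `ℂ[T/T₀] # H_β`. -/
def bosonizedTransmutation (π : H →ₐc[ℂ] Pol T)
    (β : PontryaginDual T →* PontryaginDual T →* Circle) (T₀ : Subgroup T) :
    HopfStarOps (Pol (T ⧸ T₀) ⊗[ℂ] H) :=
  (transmutation π β T₀).bosonization (HopfStarOps.ofHopf (Pol (T ⧸ T₀))) (quotForm β T₀)

/-- The semidirect product `ℂ[T/T₀] ⋉ H`, that is, the bosonization of `H` with respect to the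
trivial coquasitriangular structure `ε ⊗ ε` on `ℂ[T/T₀]`. -/
def semidirect (π : H →ₐc[ℂ] Pol T) (T₀ : Subgroup T) : HopfStarOps (Pol (T ⧸ T₀) ⊗[ℂ] H) :=
  (untwisted π T₀).bosonization (HopfStarOps.ofHopf (Pol (T ⧸ T₀)))
    (HopfStarOps.ofHopf (Pol (T ⧸ T₀))).counit₂

/-- The coinvariants `(ℂ[T] ⊗ H)^{Δ(T₀)}`: the elements `z ∈ ℂ[T] ⊗ H` such that
`z₍₁₎ ⊗ ρ(z₍₂₎) = z ⊗ 1`, where `ρ` is `ι ⊗ π` followed by the restriction of functions on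
`T × T` to `Δ(T₀)`, the latter group being identified with `T₀`. -/
def coinvariants (π : H →ₐc[ℂ] Pol T) (T₀ : Subgroup T) : Submodule ℂ (Pol T ⊗[ℂ] H) :=
  LinearMap.eqLocus
    (TensorProduct.map .id
      (LinearMap.mul' ℂ (Pol T₀) ∘ₗ
        TensorProduct.map (resMap T₀ : Pol T →ₗ[ℂ] Pol T₀)
          ((resMap T₀ : Pol T →ₗ[ℂ] Pol T₀) ∘ₗ (π : H →ₗ[ℂ] Pol T))) ∘ₗ
      (HopfStarOps.ofHopf (Pol T ⊗[ℂ] H)).comul)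
    ((TensorProduct.mk ℂ (Pol T ⊗[ℂ] H) (Pol T₀)).flip 1)

/-- `(ℂ[T] ⊗ H)^{Δ(T₀)}` with the operations inherited from `ℂ[T] ⊗ H`. -/
def coinvariantOps (π : H →ₐc[ℂ] Pol T) (T₀ : Subgroup T) : HopfStarOps (coinvariants π T₀) :=
  (HopfStarOps.ofHopf (Pol T ⊗[ℂ] H)).restrict (coinvariants π T₀)

/-- `J₁((a, b), (c, d)) = conj β(b, c)`. -/
def J₁ (β : PontryaginDual T →* PontryaginDual T →* Circle)
    (p p' : PontryaginDual T × PontryaginDual T) : ℂ :=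
  starRingEnd ℂ (β p.2 p'.1 : ℂ)

/-- `J₂((a, b), (c, d)) = conj β(b, c d⁻¹)`. -/
def J₂ (β : PontryaginDual T →* PontryaginDual T →* Circle)
    (p p' : PontryaginDual T × PontryaginDual T) : ℂ :=
  starRingEnd ℂ (β p.2 (p'.1 * p'.2⁻¹) : ℂ)

/-- The functional on `(ℂ[T] ⊗ H)^{Δ(T₀)}` defined by `J₁` and `ι ⊗ π`. -/
def cocycle₁ (π : H →ₐc[ℂ] Pol T) (β : PontryaginDual T →* PontryaginDual T →* Circle)
    (T₀ : Subgroup T) : coinvariants π T₀ ⊗[ℂ] coinvariants π T₀ →ₗ[ℂ] ℂ :=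
  let f : coinvariants π T₀ →ₗ[ℂ] Pol T ⊗[ℂ] Pol T :=
    TensorProduct.map .id (π : H →ₗ[ℂ] Pol T) ∘ₗ (coinvariants π T₀).subtype
  linExt₄ (J₁ β) ∘ₗ TensorProduct.map f f

/-- The functional on `ℂ[T/T₀] ⋉ H` defined by `J₂` and `i ⊗ π`. -/
def cocycle₂ (π : H →ₐc[ℂ] Pol T) (β : PontryaginDual T →* PontryaginDual T →* Circle)
    (T₀ : Subgroup T) : (Pol (T ⧸ T₀) ⊗[ℂ] H) ⊗[ℂ] (Pol (T ⧸ T₀) ⊗[ℂ] H) →ₗ[ℂ] ℂ :=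
  let f : Pol (T ⧸ T₀) ⊗[ℂ] H →ₗ[ℂ] Pol T ⊗[ℂ] Pol T :=
    TensorProduct.map (quotMap T₀ : Pol (T ⧸ T₀) →ₗ[ℂ] Pol T) (π : H →ₗ[ℂ] Pol T)
  linExt₄ (J₂ β) ∘ₗ TensorProduct.map f f

/-- The map `ℂ[T] ⊗ H → ℂ[T] ⊗ H`, `a ⊗ x ↦ a π(x₍₁₎) ⊗ x₍₂₎`. -/
def thetaMap (π : H →ₐc[ℂ] Pol T) : Pol T ⊗[ℂ] H →ₗ[ℂ] Pol T ⊗[ℂ] H :=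
  TensorProduct.map (LinearMap.mul' ℂ (Pol T) ∘ₗ TensorProduct.map .id (π : H →ₗ[ℂ] Pol T)) .id ∘ₗ
    (TensorProduct.assoc ℂ (Pol T) H H).symm.toLinearMap ∘ₗ
    TensorProduct.map .id Coalgebra.comul

end CompactGroup

end CocycleTwist

end

open scoped TensorProduct
open CocycleTwist

/-! # Transmutation by a bicharacter and cocycle twists

Every Hopf algebra `H` with a map `π : H → ℂ[T]` is bigraded by the dual group of `T`
(`isBigraded`): the two coactions of `ℂ[T]` on `H` commute, and `H` is the sum of the spaces
`H_{a,b}`. The coproduct maps `H_{a,b}` into the sum of `H_{a,c} ⊗ H_{c,b}`, and `π(x) = ε(x) a` for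
`x ∈ H_{a,b}`, which is zero unless `a = b`. Because of this, every formula in which `π` is applied
to the outer legs of an iterated coproduct collapses to a scalar multiple on homogeneous elements,
and equalities between operations become identities between values of bicharacters.

Consider operations on a space that is bigraded by a commutative group `Γ` in this sense, and a
functional of the form `J(x, y) = γ(a, c) ε(x) ε(y)` for `x` and `y` of left degrees `a` and `c`,
where `γ` is a bicharacter of `Γ` with values in the circle. Then `J` is a unitary Hopf 2-cocycle
(`HopfStarOps.IsBicharacter.isUnitaryCocycle`), and the twist by `J` multiplies the product of
elements of degrees `(a, b)` and `(c, d)` by `γ(a, c) γ(b, d)⁻¹`, with similar factors for the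
antipode and the involution. Hence the twist is a Hopf `*`-algebra
(`HopfStarOps.IsBicharacter.isHopfStar_twist`), and degree-preserving isomorphisms remain
isomorphisms after twisting (`HopfStarOps.IsBicharacter.isHopfStarHom_twist`).

For a cocentral subgroup `T₀`, a nonzero `H_{a,b}` has `a⁻¹ b` trivial on `T₀`, so that `ad_π` takes
values in `H ⊗ ℂ[T/T₀]`. The map `h ⊗ x ↦ h a⁻¹ ⊗ x`, for `x ∈ H_{a,b}`, is an injective homomorphism
of `ℂ[T/T₀] ⋉ H` into `ℂ[T] ⊗ H` (`isHopfStarHom_coinvEmbed`), and its image consists of the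
coinvariants (`range_coinvEmbed`). This shows that `ℂ[T/T₀] ⋉ H` and the coinvariants are isomorphic
Hopf `*`-algebras. The isomorphism turns `J₁` into `J₂`, and both are given by the bicharacter
`((a, b), (c, d)) ↦ β(b, c d⁻¹)⁻¹` for the bigrading of `ℂ[T/T₀] ⋉ H` by pairs of characters.

It remains to compare the twist of `ℂ[T/T₀] ⋉ H` by `J₂` with the bosonization of `H_β`: on
homogeneous elements both multiply the operations of `ℂ[T/T₀] ⋉ H` by the same scalars
(`isHopfStarHom_twist_semidirect`). In particular the bosonization of `H_β` is a Hopf `*`-algebra.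
That `H_β` is a braided Hopf `*`-algebra (`isBraidedHopfStar_transmutation`) is checked directly on
homogeneous elements. -/

noncomputable section

namespace CocycleTwist

/-! ### Linear maps and tensor products -/

section Linear

variable {U V W : Type*} [AddCommGroup U] [Module ℂ U] [AddCommGroup V] [Module ℂ V]
  [AddCommGroup W] [Module ℂ W]

/-- The junk value in the definition of `corestrict` does not occur if `f` takes values in the range
of `j`. -/
lemma comp_corestrict {σ : ℂ →+* ℂ} {j : W →ₗ[ℂ] V} (hj : Function.Injective j)
    {f : U →ₛₗ[σ] V} (hf : ∀ u, f u ∈ LinearMap.range j) (u : U) :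
    j (corestrict j f u) = f u := by
  have h : ∃ g : U →ₛₗ[σ] W, j.comp g = f := by
    obtain ⟨r, hr⟩ := LinearMap.exists_leftInverse_of_injective j (LinearMap.ker_eq_bot.2 hj)
    refine ⟨r.comp f, LinearMap.ext fun u => ?_⟩
    obtain ⟨w, hw⟩ := hf u
    have : r (j w) = w := LinearMap.congr_fun hr w
    simp [← hw, this]
  rw [corestrict, dif_pos h]
  exact LinearMap.congr_fun h.choose_spec u

/-- The tensor product of injective linear maps is injective: `ℂ`-vector spaces are flat. -/
lemma tensorMap_injective {U' V' : Type*} [AddCommGroup U'] [Module ℂ U'] [AddCommGroup V']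
    [Module ℂ V'] {f : U →ₗ[ℂ] V} {g : U' →ₗ[ℂ] V'} (hf : Function.Injective f)
    (hg : Function.Injective g) : Function.Injective (TensorProduct.map f g) := by
  obtain ⟨r, hr⟩ := LinearMap.exists_leftInverse_of_injective f (LinearMap.ker_eq_bot.2 hf)
  obtain ⟨s, hs⟩ := LinearMap.exists_leftInverse_of_injective g (LinearMap.ker_eq_bot.2 hg)
  refine Function.LeftInverse.injective (g := TensorProduct.map r s) fun x => ?_
  rw [← LinearMap.comp_apply, ← TensorProduct.map_comp, hr, hs, TensorProduct.map_id]
  rfl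

lemma ext_of_span_eq_top {σ : ℂ →+* ℂ} {S : Set U} (hS : Submodule.span ℂ S = ⊤)
    {f g : U →ₛₗ[σ] V} (h : ∀ x ∈ S, f x = g x) (x : U) : f x = g x :=
  LinearMap.congr_fun (LinearMap.ext_on hS h) x

lemma ext₂_of_span_eq_top {σ : ℂ →+* ℂ} {S : Set U} {S' : Set W} (hS : Submodule.span ℂ S = ⊤)
    (hS' : Submodule.span ℂ S' = ⊤) {B B' : U →ₛₗ[σ] W →ₛₗ[σ] V}
    (h : ∀ x ∈ S, ∀ y ∈ S', B x y = B' x y) (x : U) (y : W) : B x y = B' x y :=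
  LinearMap.congr_fun (ext_of_span_eq_top hS (fun x hx => LinearMap.ext fun y =>
    ext_of_span_eq_top hS' (h x hx) y) x) y

/-- Tensor products of commutative squares commute; the horizontal maps may be semilinear. -/
lemma map_map_of_comm {σ : ℂ →+* ℂ} {A A' B B' C C' D D' : Type*} [AddCommGroup A] [Module ℂ A]
    [AddCommGroup A'] [Module ℂ A'] [AddCommGroup B] [Module ℂ B] [AddCommGroup B'] [Module ℂ B']
    [AddCommGroup C] [Module ℂ C] [AddCommGroup C'] [Module ℂ C'] [AddCommGroup D] [Module ℂ D]
    [AddCommGroup D'] [Module ℂ D'] {f : B →ₛₗ[σ] D} {g : B' →ₛₗ[σ] D'} {k : A →ₗ[ℂ] B}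
    {l : A' →ₗ[ℂ] B'} {f' : A →ₛₗ[σ] C} {g' : A' →ₛₗ[σ] C'} {k' : C →ₗ[ℂ] D} {l' : C' →ₗ[ℂ] D'}
    (h : ∀ x, k' (f' x) = f (k x)) (h' : ∀ x, l' (g' x) = g (l x)) (t : A ⊗[ℂ] A') :
    TensorProduct.map k' l' (TensorProduct.map f' g' t) =
      TensorProduct.map f g (TensorProduct.map k l t) := by
  induction t with
  | zero => simp
  | add t t' ht ht' => simp only [map_add, ht, ht']
  | tmul x y => simp [h, h']

end Linear

/-! ### Homomorphisms of Hopf `*`-algebras -/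

namespace HopfStarOps

variable {V W : Type*} [AddCommGroup V] [Module ℂ V] [AddCommGroup W] [Module ℂ W]

lemma map_map₂_apply {A B A' B' C C' : Type*} [AddCommGroup A] [Module ℂ A] [AddCommGroup B]
    [Module ℂ B] [AddCommGroup A'] [Module ℂ A'] [AddCommGroup B'] [Module ℂ B'] [AddCommGroup C]
    [Module ℂ C] [AddCommGroup C'] [Module ℂ C'] {m : A →ₗ[ℂ] B →ₗ[ℂ] C}
    {m' : A' →ₗ[ℂ] B' →ₗ[ℂ] C'} {f : A →ₗ[ℂ] A'} {g : B →ₗ[ℂ] B'} {k : C →ₗ[ℂ] C'}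
    (h : ∀ x y, k (m x y) = m' (f x) (g y)) (t : A ⊗[ℂ] A) (s : B ⊗[ℂ] B) :
    TensorProduct.map k k (TensorProduct.map₂ m m t s) =
      TensorProduct.map₂ m' m' (TensorProduct.map f f t) (TensorProduct.map g g s) := by
  induction t with
  | zero => simp
  | add t t' ht ht' => simp [ht, ht']
  | tmul x y =>
    induction s with
    | zero => simp
    | add s s' hs hs' => simp only [map_add, hs, hs']
    | tmul x' y' => simp [h]

/-- The axioms of a Hopf `*`-algebra are inherited along injective maps that preserve the
operations. -/
lemma IsHopfStar.of_injective {O : HopfStarOps V} {O' : HopfStarOps W} (hO' : O'.IsHopfStar)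
    {f : V →ₗ[ℂ] W} (hf : Function.Injective f) (h : O.IsHopfStarHom O' f) : O.IsHopfStar := by
  have hf2 := tensorMap_injective hf hf
  have hf3 := tensorMap_injective hf hf2
  have hl : Function.Injective (TensorProduct.map (LinearMap.id : ℂ →ₗ[ℂ] ℂ) f) :=
    tensorMap_injective Function.injective_id hf
  have hr : Function.Injective (TensorProduct.map f (LinearMap.id : ℂ →ₗ[ℂ] ℂ)) :=
    tensorMap_injective hf Function.injective_id
  have hmulT : ∀ t, f (O.mulT t) = O'.mulT (TensorProduct.map f f t) := fun t => by
    induction t with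
    | zero => simp
    | add t t' ht ht' => simp [ht, ht']
    | tmul x y => simp [mulT, h.map_mul]
  have hid : ∀ x, f ((LinearMap.id : V →ₗ[ℂ] V) x) = (LinearMap.id : W →ₗ[ℂ] W) (f x) :=
    fun _ => rfl
  have hc : ∀ x, (LinearMap.id : ℂ →ₗ[ℂ] ℂ) (O.counit x) = O'.counit (f x) :=
    fun x => (h.map_counit x).symm
  refine ⟨fun x y z => hf ?_, fun x => hf ?_, fun x => hf ?_, fun x => hf3 ?_, fun x => hl ?_,
    fun x => hr ?_, fun x y => hf2 ?_, hf2 ?_, fun x y => ?_, ?_, fun x => hf ?_, fun x => hf ?_,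
    fun x => hf ?_, fun x y => hf ?_, fun x => hf2 ?_, fun x => ?_⟩
  · simp only [h.map_mul, hO'.mul_assoc]
  · simp only [h.map_mul, h.map_one, hO'.one_mul]
  · simp only [h.map_mul, h.map_one, hO'.mul_one]
  · exact (TensorProduct.map_map_assoc ..).trans <|
      (congrArg (TensorProduct.assoc ℂ W W W)
        ((map_map_of_comm h.map_comul hid _).trans (by rw [h.map_comul]))).trans <|
      (hO'.coassoc (f x)).trans <| (congrArg _ (h.map_comul x).symm).trans
      (map_map_of_comm hid h.map_comul _).symm
  · exact (map_map_of_comm hc hid _).trans <|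
      (congrArg _ (h.map_comul x)).trans (hO'.counit_comul (f x))
  · exact (map_map_of_comm hid hc _).trans <|
      (congrArg _ (h.map_comul x)).trans (hO'.comul_counit (f x))
  · rw [h.map_comul, h.map_mul, hO'.comul_mul, ← h.map_comul, ← h.map_comul,
      map_map₂_apply h.map_mul]
  · rw [h.map_comul, h.map_one, hO'.comul_one, TensorProduct.map_tmul, h.map_one]
  · simp only [← h.map_counit, h.map_mul, hO'.counit_mul]
  · simp only [← h.map_counit, h.map_one, hO'.counit_one]
  · refine (hmulT _).trans <| (congrArg _ (map_map_of_comm h.map_antipode hid _)).trans ?_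
    rw [h.map_comul, hO'.antipode_left, h.map_counit, map_smul, h.map_one]
  · refine (hmulT _).trans <| (congrArg _ (map_map_of_comm hid h.map_antipode _)).trans ?_
    rw [h.map_comul, hO'.antipode_right, h.map_counit, map_smul, h.map_one]
  · simp only [h.map_star, hO'.star_star]
  · simp only [h.map_star, h.map_mul, hO'.star_mul]
  · rw [h.map_comul, h.map_star, hO'.comul_star, ← h.map_comul]
    exact (map_map_of_comm h.map_star h.map_star _).symm
  · simp only [← h.map_counit, h.map_star, hO'.counit_star]

/-- Apply the counit to the antipode axiom. -/
lemma IsHopfStar.counit_antipode {O : HopfStarOps V} (hO : O.IsHopfStar) (x : V) :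
    O.counit (O.antipode x) = O.counit x := by
  have h1 := congrArg O.counit (hO.antipode_left x)
  have h2 : ∀ t, O.counit (O.mulT (TensorProduct.map O.antipode .id t)) =
      O.counit (O.antipode (TensorProduct.rid ℂ V (TensorProduct.map .id O.counit t))) :=
    fun t => by
      induction t with
      | zero => simp
      | add t t' ht ht' => simp only [map_add, ht, ht']
      | tmul x y => simp [mulT, hO.counit_mul, mul_comm]
  rw [h2, hO.comul_counit] at h1
  simpa [hO.counit_one] using h1

end HopfStarOps

/-! ### Bigraded coalgebras -/

/-- A counital coproduct on `C` together with a notion `D a b` of homogeneous elements of left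
degree `a` and right degree `b`, modelled on the coefficients of a decomposition of comodules into
isotypic parts: the homogeneous elements span `C`, the coproduct maps degree `(a, b)` into the sum
over `c` of the tensors of degree `(a, c)` and `(c, b)`, and the counit lives on the diagonal. -/
structure IsBigraded {Γ C : Type*} [AddCommGroup C] [Module ℂ C] (Δ : C →ₗ[ℂ] C ⊗[ℂ] C)
    (ε : C →ₗ[ℂ] ℂ) (D : Γ → Γ → C → Prop) : Prop where
  span_eq_top : Submodule.span ℂ {x | ∃ a b, D a b x} = ⊤
  comul_mem : ∀ {a b x}, D a b x →
    Δ x ∈ Submodule.span ℂ {t | ∃ c y z, D a c y ∧ D c b z ∧ t = y ⊗ₜ[ℂ] z}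
  counit_eq_zero : ∀ {a b x}, D a b x → a ≠ b → ε x = 0
  counit_left : ∀ x, TensorProduct.lid ℂ C (TensorProduct.map ε .id (Δ x)) = x
  counit_right : ∀ x, TensorProduct.rid ℂ C (TensorProduct.map .id ε (Δ x)) = x

namespace IsBigraded

variable {Γ C W : Type*} [AddCommGroup C] [Module ℂ C] [AddCommGroup W] [Module ℂ W]
  {Δ : C →ₗ[ℂ] C ⊗[ℂ] C} {ε : C →ₗ[ℂ] ℂ} {D : Γ → Γ → C → Prop} {σ : ℂ →+* ℂ}

lemma ext (h : IsBigraded Δ ε D) {f g : C →ₛₗ[σ] W} (hfg : ∀ a b x, D a b x → f x = g x) (x : C) :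
    f x = g x :=
  ext_of_span_eq_top h.span_eq_top (fun x ⟨a, b, hx⟩ => hfg a b x hx) x

lemma comul_ext (h : IsBigraded Δ ε D) {a b : Γ} {x : C} (hx : D a b x)
    {F G : C ⊗[ℂ] C →ₛₗ[σ] W}
    (hFG : ∀ c y z, D a c y → D c b z → F (y ⊗ₜ z) = G (y ⊗ₜ z)) : F (Δ x) = G (Δ x) := by
  refine LinearMap.eqOn_span (f := F) (g := G) ?_ (h.comul_mem hx)
  rintro _ ⟨c, y, z, hy, hz, rfl⟩
  exact hFG c y z hy hz

lemma ext₂ (h : IsBigraded Δ ε D) {B B' : C →ₛₗ[σ] C →ₛₗ[σ] W}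
    (hB : ∀ a b c d x y, D a b x → D c d y → B x y = B' x y) (x y : C) : B x y = B' x y :=
  ext₂_of_span_eq_top h.span_eq_top h.span_eq_top
    (fun x ⟨a, b, hx⟩ y ⟨c, d, hy⟩ => hB a b c d x y hx hy) x y

lemma comul_ext₂ (h : IsBigraded Δ ε D) {a b c d : Γ} {x y : C} (hx : D a b x)
    (hy : D c d y) {B B' : C ⊗[ℂ] C →ₗ[ℂ] C ⊗[ℂ] C →ₗ[ℂ] W}
    (hB : ∀ e f x₁ x₂ y₁ y₂, D a e x₁ → D e b x₂ → D c f y₁ → D f d y₂ →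
      B (x₁ ⊗ₜ x₂) (y₁ ⊗ₜ y₂) = B' (x₁ ⊗ₜ x₂) (y₁ ⊗ₜ y₂)) :
    B (Δ x) (Δ y) = B' (Δ x) (Δ y) :=
  h.comul_ext hx (F := B.flip (Δ y)) (G := B'.flip (Δ y)) fun e x₁ x₂ hx₁ hx₂ =>
    h.comul_ext hy (F := B (x₁ ⊗ₜ x₂)) (G := B' (x₁ ⊗ₜ x₂)) fun f y₁ y₂ hy₁ hy₂ =>
      hB e f x₁ x₂ y₁ y₂ hx₁ hx₂ hy₁ hy₂

lemma _root_.CocycleTwist.convL_eq_comp (Δ : C →ₗ[ℂ] C ⊗[ℂ] C) (f : C →ₗ[ℂ] ℂ)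
    (g : C →ₗ[ℂ] W) : convL Δ f g = g ∘ₗ convL Δ f .id := by
  ext x
  simp only [convL, LinearMap.comp_apply]
  generalize Δ x = t
  induction t with
  | zero => simp
  | add _ _ h₁ h₂ => simp only [map_add, h₁, h₂]
  | tmul y z => simp

/-- Convolution on the left by a functional which is a multiple of the counit in each left degree
rescales homogeneous elements. -/
lemma convL_apply (h : IsBigraded Δ ε D) {f : C →ₛₗ[σ] ℂ} {w : Γ → ℂ}
    (hf : ∀ a b x, D a b x → f x = w a * σ (ε x)) (g : C →ₛₗ[σ] W) {a b : Γ} {x : C}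
    (hx : D a b x) : convL Δ f g x = w a • g x := by
  have key := h.comul_ext hx
    (F := (TensorProduct.lid ℂ W).toLinearMap.comp (TensorProduct.map f g))
    (G := w a • g.comp ((TensorProduct.lid ℂ C).toLinearMap.comp (TensorProduct.map ε .id)))
    fun c y z hy _ => by simp [hf a c y hy, mul_smul]
  simpa [convL, h.counit_left] using key

lemma convR_apply (h : IsBigraded Δ ε D) {f : C →ₛₗ[σ] ℂ} {w : Γ → ℂ}
    (hf : ∀ a b x, D a b x → f x = w b * σ (ε x)) (g : C →ₛₗ[σ] W) {a b : Γ} {x : C}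
    (hx : D a b x) : convR Δ g f x = w b • g x := by
  have key := h.comul_ext hx
    (F := (TensorProduct.rid ℂ W).toLinearMap.comp (TensorProduct.map g f))
    (G := w b • g.comp ((TensorProduct.rid ℂ C).toLinearMap.comp (TensorProduct.map .id ε)))
    fun c y z _ hz => by simp [hf c b z hz, mul_smul]
  simpa [convR, h.counit_right] using key

/-- As the counit vanishes off the diagonal, the left and right degrees are interchangeable in the
weight of a multiple of the counit. -/
lemma weight_comm (h : IsBigraded Δ ε D) (w : Γ → ℂ) {a b : Γ} {x : C} (hx : D a b x) :
    w a * σ (ε x) = w b * σ (ε x) := by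
  by_cases hab : a = b
  · rw [hab]
  · simp [h.counit_eq_zero hx hab]

lemma isConvInv (h : IsBigraded Δ ε D) {f g : C →ₗ[ℂ] ℂ} {w v : Γ → ℂ} (hwv : ∀ a, w a * v a = 1)
    (hf : ∀ a b x, D a b x → f x = w a * ε x) (hg : ∀ a b x, D a b x → g x = v a * ε x) :
    IsConvInv Δ ε f g := by
  constructor
  · refine LinearMap.ext <| h.ext fun a b x hx => ?_
    rw [h.convL_apply hf g hx, hg a b x hx, smul_eq_mul, ← mul_assoc, hwv, one_mul]
  · refine LinearMap.ext <| h.ext fun a b x hx => ?_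
    rw [h.convL_apply hg f hx, hf a b x hx, smul_eq_mul, ← mul_assoc, mul_comm (v a), hwv,
      one_mul]

/-- The inverse weights give a convolution inverse, so that the junk value of `convInv` does not
occur. -/
lemma convInv_apply (h : IsBigraded Δ ε D) {f g : C →ₗ[ℂ] ℂ} {w v : Γ → ℂ}
    (hwv : ∀ a, w a * v a = 1) (hf : ∀ a b x, D a b x → f x = w a * ε x)
    (hg : ∀ a b x, D a b x → g x = v a * ε x) {a b : Γ} {x : C} (hx : D a b x) :
    convInv Δ ε f x = v a * ε x := by
  have hex : ∃ g, IsConvInv Δ ε f g := ⟨g, h.isConvInv hwv hf hg⟩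
  have key := LinearMap.congr_fun hex.choose_spec.1 x
  rw [h.convL_apply hf _ hx, smul_eq_mul] at key
  rw [convInv, dif_pos hex, ← key, ← mul_assoc, mul_comm (v a), hwv, one_mul]

end IsBigraded

/-! ### Cocycles given by bicharacters -/

namespace HopfStarOps

variable {Γ V W : Type*} [AddCommGroup V] [Module ℂ V] [AddCommGroup W] [Module ℂ W]
  {O : HopfStarOps V} {D : Γ → Γ → V → Prop}

/-- Elementary tensors of homogeneous elements of `V`: the homogeneous elements of `V ⊗ V`, whose
left and right degrees are pairs of degrees. -/
def Deg₂ (D : Γ → Γ → V → Prop) (p q : Γ × Γ) (t : V ⊗[ℂ] V) : Prop :=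
  ∃ x y, D p.1 q.1 x ∧ D p.2 q.2 y ∧ t = x ⊗ₜ y

lemma comul₂_tmul (x y : V) : O.comul₂ (x ⊗ₜ y) =
    TensorProduct.tensorTensorTensorComm ℂ V V V V (O.comul x ⊗ₜ O.comul y) := rfl

lemma counit₂_tmul (x y : V) : O.counit₂ (x ⊗ₜ y) = O.counit x * O.counit y := rfl

lemma isBigraded_tensor (h : IsBigraded O.comul O.counit D) :
    IsBigraded O.comul₂ O.counit₂ (Deg₂ D) where
  span_eq_top := by
    rw [eq_top_iff, ← TensorProduct.map₂_mk_top_top_eq_top, ← h.span_eq_top,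
      Submodule.map₂_span_span, Submodule.span_le]
    rintro _ ⟨x, ⟨a, b, hx⟩, y, ⟨c, d, hy⟩, rfl⟩
    exact Submodule.subset_span ⟨(a, c), (b, d), x, y, hx, hy, rfl⟩
  comul_mem := by
    rintro p q _ ⟨x, y, hx, hy, rfl⟩
    have h1 := Submodule.apply_mem_map₂
      ((TensorProduct.mk ℂ _ _).compr₂
        (TensorProduct.tensorTensorTensorComm ℂ V V V V).toLinearMap)
      (h.comul_mem hx) (h.comul_mem hy)
    rw [Submodule.map₂_span_span] at h1
    refine Submodule.span_mono ?_ h1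
    rintro _ ⟨_, ⟨c, x₁, x₂, hx₁, hx₂, rfl⟩, _, ⟨d, y₁, y₂, hy₁, hy₂, rfl⟩, rfl⟩
    exact ⟨(c, d), _, _, ⟨x₁, y₁, hx₁, hy₁, rfl⟩, ⟨x₂, y₂, hx₂, hy₂, rfl⟩, rfl⟩
  counit_eq_zero := by
    rintro p q _ ⟨x, y, hx, hy, rfl⟩ hpq
    rw [counit₂_tmul]
    by_cases h1 : p.1 = q.1
    · rw [h.counit_eq_zero hy fun h2 => hpq (Prod.ext h1 h2), mul_zero]
    · rw [h.counit_eq_zero hx h1, zero_mul]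
  counit_left t := by
    have key : ∀ s s' : V ⊗[ℂ] V, TensorProduct.lid ℂ _ (TensorProduct.map O.counit₂ .id
        (TensorProduct.tensorTensorTensorComm ℂ V V V V (s ⊗ₜ s'))) =
        TensorProduct.lid ℂ V (TensorProduct.map O.counit .id s) ⊗ₜ
          TensorProduct.lid ℂ V (TensorProduct.map O.counit .id s') := fun s s' => by
      induction s with
      | zero => simp
      | add _ _ h₁ h₂ => simp only [TensorProduct.add_tmul, map_add, h₁, h₂]
      | tmul x₁ x₂ =>
        induction s' with
        | zero => simp
        | add _ _ h₁ h₂ => simp only [TensorProduct.tmul_add, map_add, h₁, h₂]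
        | tmul y₁ y₂ => simp [counit₂_tmul, TensorProduct.smul_tmul',
            TensorProduct.tmul_smul, smul_smul, mul_comm]
    induction t with
    | zero => simp
    | add _ _ h₁ h₂ => simp only [map_add, h₁, h₂]
    | tmul x y => rw [comul₂_tmul, key, h.counit_left, h.counit_left]
  counit_right t := by
    have key : ∀ s s' : V ⊗[ℂ] V, TensorProduct.rid ℂ _ (TensorProduct.map .id O.counit₂
        (TensorProduct.tensorTensorTensorComm ℂ V V V V (s ⊗ₜ s'))) =
        TensorProduct.rid ℂ V (TensorProduct.map .id O.counit s) ⊗ₜ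
          TensorProduct.rid ℂ V (TensorProduct.map .id O.counit s') := fun s s' => by
      induction s with
      | zero => simp
      | add _ _ h₁ h₂ => simp only [TensorProduct.add_tmul, map_add, h₁, h₂]
      | tmul x₁ x₂ =>
        induction s' with
        | zero => simp
        | add _ _ h₁ h₂ => simp only [TensorProduct.tmul_add, map_add, h₁, h₂]
        | tmul y₁ y₂ => simp [counit₂_tmul, TensorProduct.smul_tmul',
            TensorProduct.tmul_smul, smul_smul, mul_comm]
    induction t with
    | zero => simp
    | add _ _ h₁ h₂ => simp only [map_add, h₁, h₂]
    | tmul x y => rw [comul₂_tmul, key, h.counit_right, h.counit_right]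

variable [CommGroup Γ]

/-- A bigrading of the coalgebra underlying `O` that is compatible with the product, the antipode
and the involution. -/
structure IsBigradedBy (O : HopfStarOps V) (D : Γ → Γ → V → Prop) : Prop
    extends IsBigraded O.comul O.counit D where
  mul_mem : ∀ {a b c d x y}, D a b x → D c d y → D (a * c) (b * d) (O.mul x y)
  antipode_mem : ∀ {a b x}, D a b x → D b⁻¹ a⁻¹ (O.antipode x)
  star_mem : ∀ {a b x}, D a b x → D a⁻¹ b⁻¹ (O.star x)

/-- `J` is the functional on `V ⊗ V` defined by the bicharacter `γ` of the group of degrees. The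
left degrees are used; the right ones would give the same functional, since the counit vanishes on
elements with distinct left and right degrees. -/
def IsBicharacter (O : HopfStarOps V) (D : Γ → Γ → V → Prop) (γ : Γ →* Γ →* Circle)
    (J : V ⊗[ℂ] V →ₗ[ℂ] ℂ) : Prop :=
  ∀ ⦃a b c d x y⦄, D a b x → D c d y → J (x ⊗ₜ y) = γ a c * (O.counit x * O.counit y)

namespace IsBicharacter

variable {γ : Γ →* Γ →* Circle} {J : V ⊗[ℂ] V →ₗ[ℂ] ℂ}

lemma apply_deg₂ (hJ : O.IsBicharacter D γ J) (p q : Γ × Γ) (t : V ⊗[ℂ] V) (ht : Deg₂ D p q t) :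
    J t = (γ p.1 p.2 : ℂ) * O.counit₂ t := by
  obtain ⟨x, y, hx, hy, rfl⟩ := ht
  exact hJ hx hy

/-- The functional `(x, y) ↦ conj J(S(x)^*, S(y)^*)`. -/
def dualForm (O : HopfStarOps V) (J : V ⊗[ℂ] V →ₗ[ℂ] ℂ) : V ⊗[ℂ] V →ₗ[ℂ] ℂ :=
  ((starLinearEquiv ℂ : ℂ ≃ₗ⋆[ℂ] ℂ).toLinearMap.comp
    (J.comp (TensorProduct.map (O.star.comp O.antipode) (O.star.comp O.antipode))))

lemma dualForm_tmul (x y : V) : dualForm O J (x ⊗ₜ y) =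
    starRingEnd ℂ (J (O.star (O.antipode x) ⊗ₜ O.star (O.antipode y))) := rfl

/-- The maps `x ↦ S(x)^*` interchange left and right degrees, and complex conjugation inverts the
values of `γ`. -/
lemma dualForm_apply (hJ : O.IsBicharacter D γ J) (hO : O.IsHopfStar) (h : O.IsBigradedBy D)
    (p q : Γ × Γ) (t : V ⊗[ℂ] V) (ht : Deg₂ D p q t) :
    dualForm O J t = ((γ p.1 p.2)⁻¹ : Circle) * O.counit₂ t := by
  have hw := (isBigraded_tensor h.toIsBigraded).weight_comm (σ := RingHom.id ℂ)
    (fun p => (((γ p.1 p.2)⁻¹ : Circle) : ℂ)) ht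
  simp only [RingHom.id_apply] at hw
  rw [hw]
  obtain ⟨x, y, hx, hy, rfl⟩ := ht
  rw [dualForm_tmul, hJ (h.star_mem (h.antipode_mem hx)) (h.star_mem (h.antipode_mem hy)),
    counit₂_tmul]
  simp [hO.counit_star, hO.counit_antipode, ← Circle.coe_inv_eq_conj]

lemma isConvInv (hJ : O.IsBicharacter D γ J) (hO : O.IsHopfStar) (h : O.IsBigradedBy D) :
    IsConvInv O.comul₂ O.counit₂ J (dualForm O J) :=
  (isBigraded_tensor h.toIsBigraded).isConvInv (w := fun p => γ p.1 p.2)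
    (v := fun p => ((γ p.1 p.2)⁻¹ : Circle)) (fun p => by simp) hJ.apply_deg₂
    (hJ.dualForm_apply hO h)

lemma convInv_apply (hJ : O.IsBicharacter D γ J) (hO : O.IsHopfStar) (h : O.IsBigradedBy D)
    (p q : Γ × Γ) (t : V ⊗[ℂ] V) (ht : Deg₂ D p q t) :
    convInv O.comul₂ O.counit₂ J t = ((γ p.1 p.2)⁻¹ : Circle) * O.counit₂ t :=
  (isBigraded_tensor h.toIsBigraded).convInv_apply (w := fun p => γ p.1 p.2)
    (v := fun p => ((γ p.1 p.2)⁻¹ : Circle)) (fun p => by simp) hJ.apply_deg₂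
    (hJ.dualForm_apply hO h) ht

/-- The cocycle identity for `J` is the multiplicativity of `γ` in both variables. -/
lemma isUnitaryCocycle (hJ : O.IsBicharacter D γ J) (hO : O.IsHopfStar) (h : O.IsBigradedBy D) :
    O.IsUnitaryCocycle J where
  invertible := ⟨_, hJ.isConvInv hO h⟩
  cocycle x y z := by
    have h₂ := isBigraded_tensor h.toIsBigraded
    have main : ∀ {a b c d e f x y z}, D a b x → D c d y → D e f z →
        convL O.comul₂ J (J ∘ₗ (TensorProduct.mk ℂ V V).flip z ∘ₗ O.mulT) (x ⊗ₜ y) =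
          convL O.comul₂ J (J ∘ₗ TensorProduct.mk ℂ V V x ∘ₗ O.mulT) (y ⊗ₜ z) := by
      intro a b c d e f x y z hx hy hz
      rw [h₂.convL_apply (w := fun p => γ p.1 p.2) (σ := RingHom.id ℂ) hJ.apply_deg₂ _
          (a := (a, c)) (b := (b, d)) ⟨x, y, hx, hy, rfl⟩,
        h₂.convL_apply (w := fun p => γ p.1 p.2) (σ := RingHom.id ℂ) hJ.apply_deg₂ _
          (a := (c, e)) (b := (d, f)) ⟨y, z, hy, hz, rfl⟩]
      simp [mulT, hJ (h.mul_mem hx hy) hz, hJ hx (h.mul_mem hy hz), hO.counit_mul]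
      ring
    -- contracting with `J` first makes both sides visibly trilinear
    let C : V ⊗[ℂ] V →ₗ[ℂ] V ⊗[ℂ] V := convL O.comul₂ J .id
    simp only [convL_eq_comp O.comul₂ J (_ ∘ₗ _)] at main ⊢
    refine h.ext (f := J ∘ₗ (TensorProduct.mk ℂ V V).flip z ∘ₗ O.mulT ∘ₗ C ∘ₗ
      (TensorProduct.mk ℂ V V).flip y) (g := J ∘ₗ (TensorProduct.mk ℂ V V).flip
        (O.mulT (C (y ⊗ₜ z)))) (fun a b x hx => ?_) x
    refine h.ext (f := J ∘ₗ (TensorProduct.mk ℂ V V).flip z ∘ₗ O.mulT ∘ₗ C ∘ₗ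
      TensorProduct.mk ℂ V V x) (g := J ∘ₗ TensorProduct.mk ℂ V V x ∘ₗ O.mulT ∘ₗ C ∘ₗ
        (TensorProduct.mk ℂ V V).flip z) (fun c d y hy => ?_) y
    refine h.ext (f := J ∘ₗ TensorProduct.mk ℂ V V (O.mulT (C (x ⊗ₜ y))))
      (g := J ∘ₗ TensorProduct.mk ℂ V V x ∘ₗ O.mulT ∘ₗ C ∘ₗ TensorProduct.mk ℂ V V y)
      (fun e f z hz => ?_) z
    exact main hx hy hz
  unitary x y := by
    refine (LinearMap.congr_fun (f := convInv O.comul₂ O.counit₂ J) (g := dualForm O J) ?_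
      (x ⊗ₜ y)).trans (dualForm_tmul x y)
    exact LinearMap.ext <| (isBigraded_tensor h.toIsBigraded).ext fun p q t ht => by
      rw [hJ.convInv_apply hO h p q t ht, hJ.dualForm_apply hO h p q t ht]

/-- Twisting by `J` multiplies the product by `γ` of the left degrees and divides it by `γ` of the
right degrees. -/
lemma twist_mul (hJ : O.IsBicharacter D γ J) (hO : O.IsHopfStar) (h : O.IsBigradedBy D)
    {a b c d : Γ} {x y : V} (hx : D a b x) (hy : D c d y) :
    (O.twist J).mul x y = (γ a c * (γ b d)⁻¹ : Circle) • O.mul x y := by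
  have h₂ := isBigraded_tensor h.toIsBigraded
  have hxy : Deg₂ D (a, c) (b, d) (x ⊗ₜ[ℂ] y) := ⟨x, y, hx, hy, rfl⟩
  have e := h₂.convR_apply (f := convInv O.comul₂ O.counit₂ J) (σ := RingHom.id ℂ)
    (w := fun p => (((γ p.1 p.2)⁻¹ : Circle) : ℂ))
    (fun p q t ht => (hJ.convInv_apply hO h p q t ht).trans
      (h₂.weight_comm (σ := RingHom.id ℂ) (fun p => (((γ p.1 p.2)⁻¹ : Circle) : ℂ)) ht))
    (convL O.comul₂ J O.mulT) hxy
  refine e.trans ?_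
  rw [h₂.convL_apply (w := fun p => γ p.1 p.2) (σ := RingHom.id ℂ) hJ.apply_deg₂ _ hxy, smul_smul,
    Circle.smul_def, mul_comm (γ a c), Circle.coe_mul]
  rfl

lemma twistU_apply (hJ : O.IsBicharacter D γ J) (hO : O.IsHopfStar) (h : O.IsBigradedBy D)
    (a b : Γ) (x : V) (hx : D a b x) :
    O.twistU J x = ((γ a a)⁻¹ : Circle) * O.counit x := by
  have e := h.comul_ext hx (F := J ∘ₗ TensorProduct.map .id O.antipode)
    (G := (((γ a b)⁻¹ : Circle) : ℂ) • O.counit ∘ₗ (TensorProduct.lid ℂ V).toLinearMap ∘ₗ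
      TensorProduct.map O.counit .id) fun c y z hy hz => by
      simp [hJ hy (h.antipode_mem hz), hO.counit_antipode]
  refine e.trans ?_
  simpa [h.counit_left] using (h.weight_comm (σ := RingHom.id ℂ) (fun c => (γ a c : ℂ)⁻¹) hx).symm

/-- The convolution inverse of `u` is `x ↦ J(x₍₁₎, x₍₂₎)`. -/
lemma twistUInv_apply (hJ : O.IsBicharacter D γ J) (hO : O.IsHopfStar) (h : O.IsBigradedBy D)
    (a b : Γ) (x : V) (hx : D a b x) :
    O.twistUInv J x = (γ a a : ℂ) * O.counit x := by
  refine h.convInv_apply (w := fun a => ((γ a a)⁻¹ : Circle)) (v := fun a => γ a a)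
    (fun a => by simp) (hJ.twistU_apply hO h) (g := J ∘ₗ O.comul) (fun a b x hx => ?_) hx
  have e := h.comul_ext hx (F := J) (G := (γ a a : ℂ) • O.counit ∘ₗ
      (TensorProduct.lid ℂ V).toLinearMap ∘ₗ TensorProduct.map O.counit .id) fun c y z hy hz => by
      have := h.weight_comm (σ := RingHom.id ℂ) (fun c => (γ a c : ℂ)) hy
      simp only [RingHom.id_apply] at this
      rw [hJ hy hz, ← mul_assoc, ← this, mul_assoc]
      simp
  refine e.trans ?_
  simp [h.counit_left]

lemma twist_antipode (hJ : O.IsBicharacter D γ J) (hO : O.IsHopfStar) (h : O.IsBigradedBy D)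
    {a b : Γ} {x : V} (hx : D a b x) :
    (O.twist J).antipode x = ((γ a a)⁻¹ * γ b b : Circle) • O.antipode x := by
  have e := h.convR_apply (f := O.twistUInv J) (σ := RingHom.id ℂ) (w := fun a => γ a a)
    (fun a b x hx => (hJ.twistUInv_apply hO h a b x hx).trans
      (h.weight_comm (σ := RingHom.id ℂ) (fun a => (γ a a : ℂ)) hx))
    (convL O.comul (O.twistU J) O.antipode) hx
  refine e.trans ?_
  rw [h.convL_apply (w := fun a => ((γ a a)⁻¹ : Circle)) (σ := RingHom.id ℂ)
    (hJ.twistU_apply hO h) _ hx, smul_smul, Circle.smul_def, mul_comm (γ a a)⁻¹, Circle.coe_mul]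

lemma twist_star (hJ : O.IsBicharacter D γ J) (hO : O.IsHopfStar) (h : O.IsBigradedBy D)
    {a b : Γ} {x : V} (hx : D a b x) :
    (O.twist J).star x = (γ a a * (γ b b)⁻¹ : Circle) • O.star x := by
  have e := h.convR_apply (f := (O.twistU J).comp (O.star.comp O.antipode))
    (w := fun a => ((γ a a)⁻¹ : Circle))
    (fun a b x hx => (hJ.twistU_apply hO h b a _ (by
      simpa using h.star_mem (h.antipode_mem hx))).trans (by
      simp [hO.counit_star, hO.counit_antipode]))
    (convL O.comul ((O.twistUInv J).comp (O.star.comp O.antipode)) O.star) hx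
  refine e.trans ?_
  rw [h.convL_apply (f := (O.twistUInv J).comp (O.star.comp O.antipode))
    (w := fun a => γ a a) (fun a b x hx => (hJ.twistUInv_apply hO h b a _ (by
      simpa using h.star_mem (h.antipode_mem hx))).trans (by
      simpa [hO.counit_star, hO.counit_antipode] using
        (h.weight_comm (σ := starRingEnd ℂ) (fun a => (γ a a : ℂ)) hx).symm)) _ hx,
    smul_smul, Circle.smul_def, mul_comm (γ a a), Circle.coe_mul]

end IsBicharacter
end HopfStarOps

/-! ### Twisting by bicharacters -/

namespace HopfStarOps

variable {Γ V W : Type*} [CommGroup Γ] [AddCommGroup V] [Module ℂ V] [AddCommGroup W] [Module ℂ W]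
  {O : HopfStarOps V} {O' : HopfStarOps W} {D : Γ → Γ → V → Prop} {D' : Γ → Γ → W → Prop}
  {γ : Γ →* Γ →* Circle} {J : V ⊗[ℂ] V →ₗ[ℂ] ℂ} {J' : W ⊗[ℂ] W →ₗ[ℂ] ℂ}

namespace IsBicharacter

/-- On homogeneous elements the operations are multiplied by values of `γ`, so every axiom follows
from the axiom for `O` and an identity between values of `γ`. -/
lemma isHopfStar_twist (hJ : O.IsBicharacter D γ J) (hO : O.IsHopfStar) (h : O.IsBigradedBy D)
    (h1 : D 1 1 O.one) : (O.twist J).IsHopfStar where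
  mul_assoc x y z := by
    refine h.ext (f := (O.twist J).mul.flip z ∘ₗ (O.twist J).mul.flip y)
      (g := (O.twist J).mul.flip ((O.twist J).mul y z)) (fun a b x hx => ?_) x
    refine h.ext₂ (B := (O.twist J).mul ∘ₗ (O.twist J).mul x)
      (B' := (O.twist J).mul.compr₂ ((O.twist J).mul x)) (fun c d e f y z hy hz => ?_) y z
    simp only [LinearMap.comp_apply, LinearMap.compr₂_apply]
    simp only [hJ.twist_mul hO h hx hy, hJ.twist_mul hO h hy hz, Circle.smul_def, map_smul,
      LinearMap.smul_apply, hJ.twist_mul hO h (h.mul_mem hx hy) hz,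
      hJ.twist_mul hO h hx (h.mul_mem hy hz), hO.mul_assoc, smul_smul]
    congr 1
    simp
    field_simp
  one_mul x := by
    refine h.ext (f := (O.twist J).mul O.one) (g := .id) (fun a b x hx => ?_) x
    rw [hJ.twist_mul hO h h1 hx]
    simp [hO.one_mul]
  mul_one x := by
    refine h.ext (f := (O.twist J).mul.flip O.one) (g := .id) (fun a b x hx => ?_) x
    rw [LinearMap.flip_apply, hJ.twist_mul hO h hx h1]
    simp [hO.mul_one]
  coassoc := hO.coassoc
  counit_comul := hO.counit_comul
  comul_counit := hO.comul_counit
  comul_mul x y := by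
    refine h.ext₂ (B := (O.twist J).mul.compr₂ O.comul)
      (B' := (TensorProduct.map₂ (O.twist J).mul (O.twist J).mul).compl₁₂ O.comul O.comul)
      (fun a b c d x y hx hy => ?_) x y
    simp only [LinearMap.compr₂_apply, LinearMap.compl₁₂_apply]
    rw [hJ.twist_mul hO h hx hy, Circle.smul_def, map_smul, hO.comul_mul]
    refine h.comul_ext₂ hx hy (B := ((γ a c * (γ b d)⁻¹ : Circle) : ℂ) •
      TensorProduct.map₂ O.mul O.mul) (B' := TensorProduct.map₂ (O.twist J).mul (O.twist J).mul)
      fun e f x₁ x₂ y₁ y₂ hx₁ hx₂ hy₁ hy₂ => ?_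
    simp only [LinearMap.smul_apply, TensorProduct.map₂_apply_tmul, TensorProduct.map_tmul,
      hJ.twist_mul hO h hx₁ hy₁,
      hJ.twist_mul hO h hx₂ hy₂, Circle.smul_def, TensorProduct.smul_tmul_smul]
    congr 1
    simp
    field_simp
  comul_one := hO.comul_one
  counit_mul x y := by
    refine h.ext₂ (B := (O.twist J).mul.compr₂ O.counit)
      (B' := (LinearMap.mul ℂ ℂ).compl₁₂ O.counit O.counit)
      (fun a b c d x y hx hy => ?_) x y
    simp only [LinearMap.compr₂_apply, LinearMap.compl₁₂_apply, LinearMap.mul_apply']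
    rw [hJ.twist_mul hO h hx hy, Circle.smul_def, map_smul, hO.counit_mul]
    by_cases hab : a = b
    · by_cases hcd : c = d
      · simp [hab, hcd]
      · simp [h.counit_eq_zero hy hcd]
    · simp [h.counit_eq_zero hx hab]
  counit_one := hO.counit_one
  antipode_left x := by
    refine h.ext (f := (O.twist J).mulT ∘ₗ TensorProduct.map (O.twist J).antipode .id ∘ₗ O.comul)
      (g := O.counit.smulRight O.one) (fun a b x hx => ?_) x
    have e := h.comul_ext hx
      (F := (O.twist J).mulT ∘ₗ TensorProduct.map (O.twist J).antipode .id)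
      (G := (((γ a a)⁻¹ * γ a b : Circle) : ℂ) • O.mulT ∘ₗ TensorProduct.map O.antipode .id)
      fun c y z hy hz => by
        simp only [mulT, LinearMap.comp_apply, TensorProduct.map_tmul, TensorProduct.lift.tmul,
          hJ.twist_antipode hO h hy, LinearMap.smul_apply, LinearMap.id_apply, Circle.smul_def,
          map_smul, hJ.twist_mul hO h (h.antipode_mem hy) hz, smul_smul]
        congr 1
        simp
        field_simp
    refine e.trans ?_
    simp only [LinearMap.comp_apply, LinearMap.smul_apply, hO.antipode_left]
    by_cases hab : a = b
    · simp [hab]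
    · simp [h.counit_eq_zero hx hab]
  antipode_right x := by
    refine h.ext (f := (O.twist J).mulT ∘ₗ TensorProduct.map .id (O.twist J).antipode ∘ₗ O.comul)
      (g := O.counit.smulRight O.one) (fun a b x hx => ?_) x
    have e := h.comul_ext hx
      (F := (O.twist J).mulT ∘ₗ TensorProduct.map .id (O.twist J).antipode)
      (G := ((γ b b * (γ a b)⁻¹ : Circle) : ℂ) • O.mulT ∘ₗ TensorProduct.map .id O.antipode)
      fun c y z hy hz => by
        simp only [mulT, LinearMap.comp_apply, TensorProduct.map_tmul, TensorProduct.lift.tmul,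
          hJ.twist_antipode hO h hz, LinearMap.smul_apply, LinearMap.id_apply, Circle.smul_def,
          map_smul, hJ.twist_mul hO h hy (h.antipode_mem hz), smul_smul]
        congr 1
        simp
        field_simp
    refine e.trans ?_
    simp only [LinearMap.comp_apply, LinearMap.smul_apply, hO.antipode_right]
    by_cases hab : a = b
    · simp [hab]
    · simp [h.counit_eq_zero hx hab]
  star_star x := by
    refine h.ext (f := (O.twist J).star.comp (O.twist J).star) (g := .id) (fun a b x hx => ?_) x
    rw [LinearMap.comp_apply, hJ.twist_star hO h hx, Circle.smul_def, LinearMap.map_smulₛₗ,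
      hJ.twist_star hO h (h.star_mem hx), hO.star_star, Circle.smul_def, smul_smul,
      ← Circle.coe_inv_eq_conj, ← Circle.coe_mul]
    refine Eq.trans ?_ (one_smul ℂ x)
    congr 1
    simp
  star_mul x y := by
    refine h.ext (f := (O.twist J).star.comp ((O.twist J).mul.flip y))
      (g := ((O.twist J).mul ((O.twist J).star y)).comp (O.twist J).star)
      (fun a b x hx => ?_) x
    refine h.ext (f := (O.twist J).star.comp ((O.twist J).mul x))
      (g := ((O.twist J).mul.flip ((O.twist J).star x)).comp (O.twist J).star)
      (fun c d y hy => ?_) y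
    simp only [LinearMap.comp_apply, LinearMap.flip_apply]
    simp only [hJ.twist_star hO h hx, hJ.twist_star hO h hy, hJ.twist_mul hO h hx hy,
      Circle.smul_def, LinearMap.map_smulₛₗ, LinearMap.smul_apply,
      hJ.twist_star hO h (h.mul_mem hx hy), hJ.twist_mul hO h (h.star_mem hy) (h.star_mem hx),
      hO.star_mul, smul_smul, ← Circle.coe_inv_eq_conj]
    congr 1
    simp
    field_simp
  comul_star x := by
    refine h.ext (f := O.comul.comp (O.twist J).star)
      (g := (TensorProduct.map (O.twist J).star (O.twist J).star).comp O.comul)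
      (fun a b x hx => ?_) x
    simp only [LinearMap.comp_apply]
    rw [hJ.twist_star hO h hx, Circle.smul_def, map_smul, hO.comul_star]
    refine h.comul_ext hx
      (F := ((γ a a * (γ b b)⁻¹ : Circle) : ℂ) • TensorProduct.map O.star O.star)
      (G := TensorProduct.map (O.twist J).star (O.twist J).star) fun c y z hy hz => ?_
    simp only [LinearMap.smul_apply, TensorProduct.map_tmul, hJ.twist_star hO h hy,
      hJ.twist_star hO h hz, Circle.smul_def, TensorProduct.smul_tmul_smul]
    congr 1
    simp
    field_simp
  counit_star x := by
    refine h.ext (f := O.counit.comp (O.twist J).star)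
      (g := ((starLinearEquiv ℂ : ℂ ≃ₗ⋆[ℂ] ℂ).toLinearMap.comp O.counit))
      (fun a b x hx => ?_) x
    simp only [LinearMap.comp_apply]
    rw [hJ.twist_star hO h hx, Circle.smul_def, map_smul, hO.counit_star]
    by_cases hab : a = b
    · simp [hab]
    · simp [h.counit_eq_zero hx hab]

/-- Twisting by bicharacters of the group of degrees is functorial. -/
lemma isHopfStarHom_twist (hJ : O.IsBicharacter D γ J) (hO : O.IsHopfStar) (h : O.IsBigradedBy D)
    (hJ' : O'.IsBicharacter D' γ J') (hO' : O'.IsHopfStar) (h' : O'.IsBigradedBy D')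
    {f : V →ₗ[ℂ] W} (hf : O.IsHopfStarHom O' f) (hD : ∀ a b x, D a b x → D' a b (f x)) :
    (O.twist J).IsHopfStarHom (O'.twist J') f where
  map_mul := h.ext₂ (B := (O.twist J).mul.compr₂ f) (B' := (O'.twist J').mul.compl₁₂ f f)
    fun a b c d x y hx hy => by
      simp only [LinearMap.compr₂_apply, LinearMap.compl₁₂_apply]
      rw [hJ.twist_mul hO h hx hy, hJ'.twist_mul hO' h' (hD _ _ _ hx) (hD _ _ _ hy),
        Circle.smul_def, map_smul, hf.map_mul, Circle.smul_def]
  map_one := hf.map_one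
  map_comul := hf.map_comul
  map_counit := hf.map_counit
  map_antipode := h.ext (f := f ∘ₗ (O.twist J).antipode) (g := (O'.twist J').antipode ∘ₗ f)
    fun a b x hx => by
      simp only [LinearMap.comp_apply]
      rw [hJ.twist_antipode hO h hx, hJ'.twist_antipode hO' h' (hD _ _ _ hx),
        Circle.smul_def, map_smul, hf.map_antipode, Circle.smul_def]
  map_star := h.ext (f := f.comp (O.twist J).star) (g := (O'.twist J').star.comp f)
    fun a b x hx => by
      simp only [LinearMap.comp_apply]
      rw [hJ.twist_star hO h hx, hJ'.twist_star hO' h' (hD _ _ _ hx),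
        Circle.smul_def, map_smul, hf.map_star, Circle.smul_def]

end IsBicharacter

/-! ### Transport of structure -/

/-- Bigradings can be pulled back along isomorphisms. -/
lemma IsBigradedBy.comap (h' : O'.IsBigradedBy D') (hO : O.IsHopfStar) (f : V ≃ₗ[ℂ] W)
    (hf : O.IsHopfStarHom O' f.toLinearMap) : O.IsBigradedBy fun a b x => D' a b (f x) where
  span_eq_top := by
    have : {x | ∃ a b, D' a b (f x)} = f.symm '' {x | ∃ a b, D' a b x} := by
      ext x
      simp [LinearEquiv.image_symm_eq_preimage]
    rw [this]
    exact (Submodule.map_span f.symm.toLinearMap _).symm.trans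
      (by rw [h'.span_eq_top, Submodule.map_top, LinearEquiv.range])
  comul_mem {a b x} hx := by
    have e : O.comul x = TensorProduct.map f.symm.toLinearMap f.symm.toLinearMap
        (O'.comul (f x)) := by
      have := hf.map_comul x
      refine ((congrArg _ this.symm).trans ?_).symm
      rw [TensorProduct.map_map]
      simp
    rw [e]
    have := Submodule.mem_map_of_mem
      (f := TensorProduct.map f.symm.toLinearMap f.symm.toLinearMap) (h'.comul_mem hx)
    rw [Submodule.map_span] at this
    refine Submodule.span_mono ?_ this
    rintro _ ⟨_, ⟨c, y, z, hy, hz, rfl⟩, rfl⟩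
    exact ⟨c, f.symm y, f.symm z, by simpa using hy, by simpa using hz, rfl⟩
  counit_eq_zero hx hab := (hf.map_counit _).symm.trans (h'.counit_eq_zero hx hab)
  counit_left x := by simp [hO.counit_comul]
  counit_right x := by simp [hO.comul_counit]
  mul_mem {a b c d x y} hx hy := by
    have := hf.map_mul x y
    simp only [LinearEquiv.coe_coe] at this
    simpa only [this] using h'.mul_mem hx hy
  antipode_mem {a b x} hx := by
    have := hf.map_antipode x
    simp only [LinearEquiv.coe_coe] at this
    simpa only [this] using h'.antipode_mem hx
  star_mem {a b x} hx := by
    have := hf.map_star x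
    simp only [LinearEquiv.coe_coe] at this
    simpa only [this] using h'.star_mem hx

section Restrict

variable {U : Type*} [AddCommGroup U] [Module ℂ U] {N : HopfStarOps U}

/-- The image of a homomorphism is closed under all operations, so that no junk value occurs in the
operations induced on it. -/
lemma isHopfStarHom_restrict {Ψ : U →ₗ[ℂ] V} (hΨ : N.IsHopfStarHom O Ψ) {X : Submodule ℂ V}
    (hX : LinearMap.range Ψ = X) : (O.restrict X).IsHopfStarHom O X.subtype := by
  subst hX
  set X := LinearMap.range Ψ
  have hX : LinearMap.range X.subtype = X := X.range_subtype
  have hi : Function.Injective X.subtype := X.injective_subtype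
  have hmul : ∀ t, (O.mulT ∘ₗ TensorProduct.map X.subtype X.subtype) t ∈
      LinearMap.range X.subtype := fun t => by
    rw [hX]
    induction t with
    | zero => simp
    | add t t' ht ht' => rw [map_add]; exact X.add_mem ht ht'
    | tmul x y =>
      obtain ⟨_, u, rfl⟩ := x
      obtain ⟨_, v, rfl⟩ := y
      exact ⟨N.mul u v, hΨ.map_mul u v⟩
  refine ⟨fun x y => comp_corestrict hi hmul (x ⊗ₜ y), ?_, fun x => comp_corestrict
    (tensorMap_injective hi hi) (fun x => ?_) x, fun x => rfl, fun x => comp_corestrict hi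
    (fun x => ?_) x, fun x => comp_corestrict hi (fun x => ?_) x⟩
  · have h1 : O.one ∈ X := ⟨N.one, hΨ.map_one⟩
    simp [restrict, h1]
  · obtain ⟨_, u, rfl⟩ := x
    exact ⟨TensorProduct.map Ψ.rangeRestrict Ψ.rangeRestrict (N.comul u),
      (TensorProduct.map_map ..).trans (hΨ.map_comul u)⟩
  · obtain ⟨_, u, rfl⟩ := x
    exact ⟨⟨_, N.antipode u, rfl⟩, hΨ.map_antipode u⟩
  · obtain ⟨_, u, rfl⟩ := x
    exact ⟨⟨_, N.star u, rfl⟩, hΨ.map_star u⟩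

/-- Homomorphisms can be divided by injective homomorphisms. -/
lemma IsHopfStarHom.of_comp {f : U →ₗ[ℂ] V} {g : V →ₗ[ℂ] W} (hg : O.IsHopfStarHom O' g)
    (hgf : N.IsHopfStarHom O' (g ∘ₗ f)) (hi : Function.Injective g) : N.IsHopfStarHom O f := by
  refine ⟨fun x y => hi ?_, hi ?_, fun x => tensorMap_injective hi hi ?_, fun x => ?_,
    fun x => hi ?_, fun x => hi ?_⟩
  · exact (hgf.map_mul x y).trans (hg.map_mul _ _).symm
  · exact hgf.map_one.trans hg.map_one.symm
  · exact (TensorProduct.map_map ..).trans ((hgf.map_comul x).trans (hg.map_comul _).symm)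
  · exact (hg.map_counit _).symm.trans (hgf.map_counit x)
  · exact (hgf.map_antipode x).trans (hg.map_antipode _).symm
  · exact (hgf.map_star x).trans (hg.map_star _).symm

lemma IsHopfStarHom.symm {e : V ≃ₗ[ℂ] W} (h : O.IsHopfStarHom O' e.toLinearMap) :
    O'.IsHopfStarHom O e.symm.toLinearMap := by
  refine h.of_comp ⟨?_, ?_, ?_, ?_, ?_, ?_⟩ e.injective <;> simp

lemma IsHopfStarHom.comp {f : U →ₗ[ℂ] V} {g : V →ₗ[ℂ] W} (hg : O.IsHopfStarHom O' g)
    (hf : N.IsHopfStarHom O f) : N.IsHopfStarHom O' (g ∘ₗ f) := by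
  refine ⟨fun x y => ?_, ?_, fun x => ?_, fun x => ?_, fun x => ?_, fun x => ?_⟩
  · simp [hf.map_mul, hg.map_mul]
  · simp [hf.map_one, hg.map_one]
  · rw [TensorProduct.map_comp, LinearMap.comp_apply, hf.map_comul, hg.map_comul]; rfl
  · simp [hf.map_counit, hg.map_counit]
  · simp [hf.map_antipode, hg.map_antipode]
  · simp [hf.map_star, hg.map_star]

end Restrict

end HopfStarOps

/-! ### Linear functionals on group algebras -/

section GroupAlgebra

variable {G G' : Type*} {V : Type*} [AddCommGroup V] [Module ℂ V]

@[simp]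
lemma linExt_single (f : G → V) (a : G) (r : ℂ) :
    linExt f (MonoidAlgebra.single a r) = r • f a := by
  exact Finsupp.linearCombination_single ..

@[simp]
lemma linExt₂_single (f : G → G' → V) (a : G) (b : G') (r s : ℂ) :
    linExt₂ f (MonoidAlgebra.single a r ⊗ₜ MonoidAlgebra.single b s) = r • s • f a b := by
  simp [linExt₂]

lemma span_single_eq_top :
    Submodule.span ℂ {x | ∃ a : G, x = MonoidAlgebra.single a (1 : ℂ)} = ⊤ := by
  refine eq_top_iff.2 fun x _ => ?_
  induction x using MonoidAlgebra.induction_linear with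
  | zero => exact Submodule.zero_mem _
  | add x y hx hy => exact Submodule.add_mem _ (hx trivial) (hy trivial)
  | single a r =>
    have := Submodule.smul_mem (Submodule.span ℂ {x | ∃ a : G, x = MonoidAlgebra.single a (1 : ℂ)})
      r (Submodule.subset_span ⟨a, rfl⟩)
    simpa [MonoidAlgebra.smul_single] using this

end GroupAlgebra

section Comodule

/-! ### Comodules over group algebras -/

variable {G : Type*} {M : Type*} [AddCommGroup M] [Module ℂ M]

/-- The coefficient of a group element as a functional on the group algebra. -/
def coeffAt (c : G) : MonoidAlgebra ℂ G →ₗ[ℂ] ℂ := by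
  classical exact linExt fun g => if g = c then 1 else 0

lemma coeffAt_single [DecidableEq G] (c g : G) (r : ℂ) :
    coeffAt c (MonoidAlgebra.single g r) = if g = c then r else 0 := by
  simp only [coeffAt, linExt_single]
  split_ifs <;> simp

/-- The isotypic projections of a right comodule over a group algebra. -/
def isoProj (ρ : M →ₗ[ℂ] M ⊗[ℂ] MonoidAlgebra ℂ G) (c : G) : M →ₗ[ℂ] M :=
  (TensorProduct.rid ℂ M).toLinearMap ∘ₗ TensorProduct.map .id (coeffAt c) ∘ₗ ρ

lemma isoProj_of_mem {ρ : M →ₗ[ℂ] M ⊗[ℂ] MonoidAlgebra ℂ G} {c : G} {x : M}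
    (hx : ρ x = x ⊗ₜ MonoidAlgebra.single c 1) : isoProj ρ c x = x := by
  classical simp [isoProj, hx, coeffAt_single]

/-- The image of an isotypic projection is the corresponding isotypic component. -/
lemma coact_isoProj {ρ : M →ₗ[ℂ] M ⊗[ℂ] MonoidAlgebra ℂ G}
    (hρ : ∀ x, TensorProduct.assoc ℂ _ _ _ (TensorProduct.map ρ .id (ρ x)) =
      TensorProduct.map .id Coalgebra.comul (ρ x)) (c : G) (x : M) :
    ρ (isoProj ρ c x) = isoProj ρ c x ⊗ₜ MonoidAlgebra.single c 1 := by
  classical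
  have h1 : ∀ t : M ⊗[ℂ] MonoidAlgebra ℂ G,
      ρ (TensorProduct.rid ℂ M (TensorProduct.map .id (coeffAt c) t)) =
        TensorProduct.map .id ((TensorProduct.rid ℂ _).toLinearMap ∘ₗ
          TensorProduct.map .id (coeffAt c))
          (TensorProduct.assoc ℂ _ _ _ (TensorProduct.map ρ .id t)) := fun t => by
    induction t with
    | zero => simp
    | add _ _ h₁ h₂ => simp only [map_add, h₁, h₂]
    | tmul y g =>
      simp only [TensorProduct.map_tmul, LinearMap.id_apply, TensorProduct.rid_tmul, map_smul]
      generalize ρ y = s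
      induction s with
      | zero => simp
      | add _ _ h₁ h₂ => simp only [smul_add, TensorProduct.add_tmul, map_add, h₁, h₂]
      | tmul z g' => simp
  have h2 : ∀ t : M ⊗[ℂ] MonoidAlgebra ℂ G,
      TensorProduct.map .id ((TensorProduct.rid ℂ _).toLinearMap ∘ₗ
          TensorProduct.map .id (coeffAt c)) (TensorProduct.map .id Coalgebra.comul t) =
        TensorProduct.rid ℂ M (TensorProduct.map .id (coeffAt c) t) ⊗ₜ
          MonoidAlgebra.single c 1 := fun t => by
    induction t with
    | zero => simp
    | add _ _ h₁ h₂ => simp only [map_add, h₁, h₂, TensorProduct.add_tmul]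
    | tmul y g =>
      induction g using MonoidAlgebra.induction_linear with
      | zero => simp
      | add _ _ h₁ h₂ => simp only [map_add, TensorProduct.tmul_add, h₁, h₂, TensorProduct.add_tmul]
      | single g r =>
        by_cases hg : g = c <;>
          simp [coeffAt_single, hg, TensorProduct.smul_tmul, MonoidAlgebra.smul_single]
  exact (h1 (ρ x)).trans ((congrArg _ (hρ x)).trans (h2 (ρ x)))

/-- Every element is the sum of its isotypic projections. All but finitely many of them vanish,
which is expressed by means of the finite sets `s'` containing a given one. -/
lemma exists_sum_isoProj {ρ : M →ₗ[ℂ] M ⊗[ℂ] MonoidAlgebra ℂ G}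
    (hε : ∀ x, TensorProduct.map .id Coalgebra.counit (ρ x) = x ⊗ₜ (1 : ℂ)) (x : M) :
    ∃ s : Finset G, ∀ s', s ⊆ s' → ∑ c ∈ s', isoProj ρ c x = x := by
  classical
  have key : ∀ t : M ⊗[ℂ] MonoidAlgebra ℂ G, ∃ s : Finset G, ∀ s', s ⊆ s' →
      ∑ c ∈ s', TensorProduct.rid ℂ M (TensorProduct.map .id (coeffAt c) t) =
        TensorProduct.rid ℂ M (TensorProduct.map .id Coalgebra.counit t) := fun t => by
    induction t with
    | zero => exact ⟨∅, by simp⟩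
    | add _ _ h₁ h₂ =>
      obtain ⟨s₁, h₁⟩ := h₁
      obtain ⟨s₂, h₂⟩ := h₂
      refine ⟨s₁ ∪ s₂, fun s' hs' => ?_⟩
      simp only [map_add, Finset.sum_add_distrib]
      rw [h₁ s' (Finset.union_subset_left hs'), h₂ s' (Finset.union_subset_right hs')]
    | tmul y g =>
      induction g using MonoidAlgebra.induction_linear with
      | zero => exact ⟨∅, by simp⟩
      | add _ _ h₁ h₂ =>
        obtain ⟨s₁, h₁⟩ := h₁
        obtain ⟨s₂, h₂⟩ := h₂
        refine ⟨s₁ ∪ s₂, fun s' hs' => ?_⟩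
        simp only [TensorProduct.tmul_add, map_add, Finset.sum_add_distrib]
        rw [h₁ s' (Finset.union_subset_left hs'), h₂ s' (Finset.union_subset_right hs')]
      | single g r =>
        refine ⟨{g}, fun s' hs' => ?_⟩
        simp only [TensorProduct.map_tmul, TensorProduct.rid_tmul, coeffAt_single]
        simp [ite_smul, Finset.singleton_subset_iff.1 hs']
  obtain ⟨s, hs⟩ := key (ρ x)
  refine ⟨s, fun s' hs' => (hs s' hs').trans ?_⟩
  rw [hε, TensorProduct.rid_tmul, one_smul]

/-- A finite sum of isotypic projections acts as the identity on the first leg of a tensor. -/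
lemma exists_sum_map_isoProj {N : Type*} [AddCommGroup N] [Module ℂ N]
    {ρ : M →ₗ[ℂ] M ⊗[ℂ] MonoidAlgebra ℂ G}
    (hε : ∀ x, TensorProduct.map .id Coalgebra.counit (ρ x) = x ⊗ₜ (1 : ℂ)) (t : M ⊗[ℂ] N) :
    ∃ s : Finset G, ∀ s', s ⊆ s' → ∑ c ∈ s', TensorProduct.map (isoProj ρ c) .id t = t := by
  classical
  induction t with
  | zero => exact ⟨∅, by simp⟩
  | add _ _ h₁ h₂ =>
    obtain ⟨s₁, h₁⟩ := h₁
    obtain ⟨s₂, h₂⟩ := h₂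
    refine ⟨s₁ ∪ s₂, fun s' hs' => ?_⟩
    simp only [map_add, Finset.sum_add_distrib]
    rw [h₁ s' (Finset.union_subset_left hs'), h₂ s' (Finset.union_subset_right hs')]
  | tmul y n =>
    obtain ⟨s, hs⟩ := exists_sum_isoProj hε y
    refine ⟨s, fun s' hs' => ?_⟩
    simp only [TensorProduct.map_tmul, ← TensorProduct.sum_tmul, hs s' hs', LinearMap.id_apply]

end Comodule

section Bigrading

/-! ### The bigrading of a Hopf algebra over a group algebra -/

variable {G : Type*} [CommGroup G] {H : Type*} [Ring H] [HopfAlgebra ℂ H]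
  (π : H →ₐc[ℂ] MonoidAlgebra ℂ G)

/-- The coaction `x ↦ x₍₁₎ ⊗ π(x₍₂₎)` of the group algebra as an algebra homomorphism. -/
def rightCoact : H →ₐ[ℂ] H ⊗[ℂ] MonoidAlgebra ℂ G :=
  (Algebra.TensorProduct.map (.id ℂ H) (π : H →ₐ[ℂ] MonoidAlgebra ℂ G)).comp
    (Bialgebra.comulAlgHom ℂ H)

/-- The coaction `x ↦ x₍₂₎ ⊗ π(x₍₁₎)`; the group algebra being cocommutative, left comodules can be
viewed as right comodules. -/
def leftCoact : H →ₐ[ℂ] H ⊗[ℂ] MonoidAlgebra ℂ G :=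
  (Algebra.TensorProduct.comm ℂ (MonoidAlgebra ℂ G) H).toAlgHom.comp
    ((Algebra.TensorProduct.map (π : H →ₐ[ℂ] MonoidAlgebra ℂ G) (.id ℂ H)).comp
      (Bialgebra.comulAlgHom ℂ H))

lemma rightCoact_apply (x : H) : rightCoact π x =
    TensorProduct.map .id (π : H →ₗ[ℂ] MonoidAlgebra ℂ G) (Coalgebra.comul x) := rfl

lemma leftCoact_apply (x : H) : leftCoact π x = TensorProduct.comm ℂ _ _
    (TensorProduct.map (π : H →ₗ[ℂ] MonoidAlgebra ℂ G) .id (Coalgebra.comul x)) := rfl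

/-- `x ∈ H_{a,b}`: `x` has left degree `a` and right degree `b`. -/
def IsHomogeneous (a b : G) (x : H) : Prop :=
  leftCoact π x = x ⊗ₜ MonoidAlgebra.single a 1 ∧ rightCoact π x = x ⊗ₜ MonoidAlgebra.single b 1

lemma map_comul_apply (x : H) : TensorProduct.map (π : H →ₗ[ℂ] MonoidAlgebra ℂ G)
    (π : H →ₗ[ℂ] MonoidAlgebra ℂ G) (Coalgebra.comul x) = Coalgebra.comul (π x) :=
  CoalgHomClass.map_comp_comul_apply π x

lemma coassoc_apply' (x : H) :
    TensorProduct.assoc ℂ H H H (TensorProduct.map Coalgebra.comul .id (Coalgebra.comul x)) =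
      TensorProduct.map .id Coalgebra.comul (Coalgebra.comul (R := ℂ) x) :=
  Coalgebra.coassoc_apply x

lemma rightCoact_coassoc (x : H) :
    TensorProduct.assoc ℂ _ _ _ (TensorProduct.map (rightCoact π).toLinearMap .id
      (rightCoact π x)) = TensorProduct.map .id Coalgebra.comul (rightCoact π x) := by
  have h1 : ∀ t, TensorProduct.assoc ℂ _ _ _ (TensorProduct.map (rightCoact π).toLinearMap .id
      (TensorProduct.map .id (π : H →ₗ[ℂ] MonoidAlgebra ℂ G) t)) =
      TensorProduct.map .id (TensorProduct.map (π : H →ₗ[ℂ] MonoidAlgebra ℂ G)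
        (π : H →ₗ[ℂ] MonoidAlgebra ℂ G))
        (TensorProduct.assoc ℂ H H H (TensorProduct.map Coalgebra.comul .id t)) := fun t => by
    induction t with
    | zero => simp
    | add _ _ h₁ h₂ => simp only [map_add, h₁, h₂]
    | tmul y z =>
      simp only [TensorProduct.map_tmul, LinearMap.id_apply, AlgHom.toLinearMap_apply,
        rightCoact_apply]
      generalize (Coalgebra.comul (R := ℂ) y) = s
      induction s with
      | zero => simp
      | add _ _ h₁ h₂ => simp only [map_add, TensorProduct.add_tmul, h₁, h₂]
      | tmul _ _ => rfl
  refine (h1 (Coalgebra.comul x)).trans ?_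
  rw [coassoc_apply', rightCoact_apply, TensorProduct.map_map, TensorProduct.map_map]
  congr 2
  exact LinearMap.ext (map_comul_apply π)

lemma leftCoact_coassoc (x : H) :
    TensorProduct.assoc ℂ _ _ _ (TensorProduct.map (leftCoact π).toLinearMap .id
      (leftCoact π x)) = TensorProduct.map .id Coalgebra.comul (leftCoact π x) := by
  -- the reversal `a ⊗ (b ⊗ c) ↦ c ⊗ (π(b) ⊗ π(a))`
  let P : H ⊗[ℂ] (H ⊗[ℂ] H) →ₗ[ℂ] H ⊗[ℂ] (MonoidAlgebra ℂ G ⊗[ℂ] MonoidAlgebra ℂ G) :=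
    TensorProduct.map .id (TensorProduct.map (π : H →ₗ[ℂ] MonoidAlgebra ℂ G)
      (π : H →ₗ[ℂ] MonoidAlgebra ℂ G)) ∘ₗ (TensorProduct.assoc ℂ H H H).toLinearMap ∘ₗ
      (TensorProduct.comm ℂ H (H ⊗[ℂ] H)).toLinearMap ∘ₗ
      TensorProduct.map .id (TensorProduct.comm ℂ H H).toLinearMap
  have h1 : ∀ t, TensorProduct.assoc ℂ _ _ _ (TensorProduct.map (leftCoact π).toLinearMap .id
      (TensorProduct.comm ℂ _ _ (TensorProduct.map (π : H →ₗ[ℂ] MonoidAlgebra ℂ G) .id t))) =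
      P (TensorProduct.map .id Coalgebra.comul t) := fun t => by
    induction t with
    | zero => simp
    | add _ _ h₁ h₂ => simp only [map_add, h₁, h₂]
    | tmul y z =>
      simp only [TensorProduct.map_tmul, LinearMap.id_apply, AlgHom.toLinearMap_apply,
        leftCoact_apply, TensorProduct.comm_tmul]
      generalize (Coalgebra.comul (R := ℂ) z) = s
      induction s with
      | zero => simp
      | add _ _ h₁ h₂ => simp only [map_add, TensorProduct.add_tmul, TensorProduct.tmul_add, h₁, h₂]
      | tmul _ _ => rfl
  have h2 : ∀ t, TensorProduct.map .id Coalgebra.comul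
      (TensorProduct.comm ℂ _ _ (TensorProduct.map (π : H →ₗ[ℂ] MonoidAlgebra ℂ G) .id t)) =
      P (TensorProduct.assoc ℂ H H H (TensorProduct.map Coalgebra.comul .id t)) := fun t => by
    induction t with
    | zero => simp
    | add _ _ h₁ h₂ => simp only [map_add, h₁, h₂]
    | tmul y z =>
      simp only [TensorProduct.map_tmul, LinearMap.id_apply, TensorProduct.comm_tmul]
      have : Coalgebra.comul (R := ℂ) (π y) = TensorProduct.comm ℂ _ _ (TensorProduct.map
          (π : H →ₗ[ℂ] MonoidAlgebra ℂ G) (π : H →ₗ[ℂ] MonoidAlgebra ℂ G) (Coalgebra.comul y)) := by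
        rw [map_comul_apply]
        exact (Coalgebra.comm_comul ℂ (π y)).symm
      refine (congrArg (fun s => z ⊗ₜ[ℂ] s) this).trans ?_
      generalize (Coalgebra.comul (R := ℂ) y) = s
      induction s with
      | zero => simp
      | add _ _ h₁ h₂ => simp only [map_add, TensorProduct.add_tmul, TensorProduct.tmul_add, h₁, h₂]
      | tmul _ _ => rfl
  exact (h1 _).trans ((congrArg P (coassoc_apply' x).symm).trans (h2 _).symm)

lemma rightCoact_counit (x : H) :
    TensorProduct.map .id Coalgebra.counit (rightCoact π x) = x ⊗ₜ[ℂ] (1 : ℂ) := by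
  rw [rightCoact_apply, TensorProduct.map_map]
  refine Eq.trans ?_ (Coalgebra.lTensor_counit_comul x)
  congr 2
  exact LinearMap.ext fun x => CoalgHomClass.counit_comp_apply π x

lemma leftCoact_counit (x : H) :
    TensorProduct.map .id Coalgebra.counit (leftCoact π x) = x ⊗ₜ[ℂ] (1 : ℂ) := by
  rw [leftCoact_apply, ← TensorProduct.comm_tmul, TensorProduct.map_comm, TensorProduct.map_map]
  congr 1
  refine Eq.trans ?_ (Coalgebra.rTensor_counit_comul x)
  congr 2
  exact LinearMap.ext fun x => CoalgHomClass.counit_comp_apply π x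

/-- Two ways of splitting an element into three parts agree. -/
lemma coassoc_ext {W : Type*} [AddCommGroup W] [Module ℂ W] (Q : H ⊗[ℂ] (H ⊗[ℂ] H) →ₗ[ℂ] W)
    {F F' : H ⊗[ℂ] H →ₗ[ℂ] W}
    (h : ∀ y z, F (y ⊗ₜ z) = Q (TensorProduct.assoc ℂ H H H (Coalgebra.comul y ⊗ₜ z)))
    (h' : ∀ y z, F' (y ⊗ₜ z) = Q (y ⊗ₜ Coalgebra.comul z)) (x : H) :
    F (Coalgebra.comul x) = F' (Coalgebra.comul x) := by
  have e : F = Q ∘ₗ (TensorProduct.assoc ℂ H H H).toLinearMap ∘ₗ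
      TensorProduct.map Coalgebra.comul .id := TensorProduct.ext' h
  have e' : F' = Q ∘ₗ TensorProduct.map .id Coalgebra.comul := TensorProduct.ext' h'
  rw [e, e', LinearMap.comp_apply, LinearMap.comp_apply, LinearMap.comp_apply]
  exact congrArg Q (coassoc_apply' x)

/-- The projection onto the elements of left degree `a`. -/
abbrev leftProj (a : G) : H →ₗ[ℂ] H := isoProj (leftCoact π).toLinearMap a

/-- The projection onto the elements of right degree `b`. -/
abbrev rightProj (b : G) : H →ₗ[ℂ] H := isoProj (rightCoact π).toLinearMap b

lemma leftProj_apply (a : G) (x : H) : leftProj π a x = TensorProduct.lid ℂ H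
    (TensorProduct.map (coeffAt a ∘ₗ (π : H →ₗ[ℂ] MonoidAlgebra ℂ G)) .id
      (Coalgebra.comul x)) := by
  simp only [leftProj, isoProj, LinearMap.comp_apply, AlgHom.toLinearMap_apply, leftCoact_apply]
  generalize (Coalgebra.comul (R := ℂ) x) = t
  induction t with
  | zero => simp
  | add _ _ h₁ h₂ => simp only [map_add, h₁, h₂]
  | tmul _ _ => rfl

lemma rightProj_apply (b : G) (x : H) : rightProj π b x = TensorProduct.rid ℂ H
    (TensorProduct.map .id (coeffAt b ∘ₗ (π : H →ₗ[ℂ] MonoidAlgebra ℂ G))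
      (Coalgebra.comul x)) := by
  simp only [rightProj, isoProj, LinearMap.comp_apply, AlgHom.toLinearMap_apply, rightCoact_apply,
    TensorProduct.map_map, LinearMap.id_comp]
  rfl

/-- The two coactions commute. -/
lemma leftCoact_rightProj (c : G) (x : H) : leftCoact π (rightProj π c x) =
    TensorProduct.map (rightProj π c) .id (leftCoact π x) := by
  let p := (π : H →ₗ[ℂ] MonoidAlgebra ℂ G)
  let φ : H →ₗ[ℂ] ℂ := coeffAt c ∘ₗ p
  refine Eq.trans ?_ <| (coassoc_ext
    (F := (leftCoact π).toLinearMap ∘ₗ (TensorProduct.rid ℂ H).toLinearMap ∘ₗ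
      TensorProduct.map .id φ)
    (F' := TensorProduct.map (rightProj π c) .id ∘ₗ (TensorProduct.comm ℂ _ _).toLinearMap ∘ₗ
      TensorProduct.map p .id)
    ((TensorProduct.comm ℂ _ _).toLinearMap ∘ₗ
      TensorProduct.map p ((TensorProduct.rid ℂ H).toLinearMap ∘ₗ TensorProduct.map .id φ))
    (fun y z => ?_) (fun y z => ?_) x).trans ?_
  · rw [rightProj_apply]; rfl
  · simp only [LinearMap.comp_apply, TensorProduct.map_tmul, LinearEquiv.coe_coe,
      LinearMap.id_apply, TensorProduct.rid_tmul, map_smul, AlgHom.toLinearMap_apply,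
      leftCoact_apply]
    generalize (Coalgebra.comul (R := ℂ) y) = s
    induction s with
    | zero => simp
    | add _ _ h₁ h₂ => simp only [map_add, TensorProduct.add_tmul, smul_add, h₁, h₂]
    | tmul _ _ => simp [p]
  · simp only [LinearMap.comp_apply, TensorProduct.map_tmul, LinearEquiv.coe_coe,
      LinearMap.id_apply, TensorProduct.comm_tmul, rightProj_apply]
    rfl
  · rfl

/-- Projecting the first leg of a coproduct by its right degree is the same as projecting the second
leg by its left degree. -/
lemma map_rightProj_comul (c : G) (x : H) :
    TensorProduct.map (rightProj π c) .id (Coalgebra.comul x) =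
      TensorProduct.map .id (leftProj π c) (Coalgebra.comul x) := by
  let φ : H →ₗ[ℂ] ℂ := coeffAt c ∘ₗ (π : H →ₗ[ℂ] MonoidAlgebra ℂ G)
  refine coassoc_ext (TensorProduct.map .id ((TensorProduct.lid ℂ H).toLinearMap ∘ₗ
    TensorProduct.map φ .id)) (fun y z => ?_) (fun y z => ?_) x
  · simp only [TensorProduct.map_tmul, rightProj_apply]
    generalize (Coalgebra.comul (R := ℂ) y) = s
    induction s with
    | zero => simp
    | add _ _ h₁ h₂ => simp only [map_add, TensorProduct.add_tmul, h₁, h₂]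
    | tmul _ _ => simp [φ, TensorProduct.smul_tmul]
  · simp only [TensorProduct.map_tmul, leftProj_apply]
    rfl

lemma comul_leftProj (a : G) (x : H) : Coalgebra.comul (R := ℂ) (leftProj π a x) =
    TensorProduct.map (leftProj π a) .id (Coalgebra.comul x) := by
  let φ : H →ₗ[ℂ] ℂ := coeffAt a ∘ₗ (π : H →ₗ[ℂ] MonoidAlgebra ℂ G)
  refine Eq.trans ?_ (coassoc_ext ((TensorProduct.lid ℂ _).toLinearMap ∘ₗ TensorProduct.map φ .id)
    (F := TensorProduct.map (leftProj π a) .id)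
    (F' := Coalgebra.comul ∘ₗ (TensorProduct.lid ℂ H).toLinearMap ∘ₗ TensorProduct.map φ .id)
    (fun y z => ?_) (fun y z => ?_) x).symm
  · rw [leftProj_apply]; rfl
  · simp only [TensorProduct.map_tmul, leftProj_apply]
    generalize (Coalgebra.comul (R := ℂ) y) = s
    induction s with
    | zero => simp
    | add _ _ h₁ h₂ => simp only [map_add, TensorProduct.add_tmul, h₁, h₂]
    | tmul _ _ => simp [φ, TensorProduct.smul_tmul']
  · simp

lemma comul_rightProj (b : G) (x : H) : Coalgebra.comul (R := ℂ) (rightProj π b x) =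
    TensorProduct.map .id (rightProj π b) (Coalgebra.comul x) := by
  let φ : H →ₗ[ℂ] ℂ := coeffAt b ∘ₗ (π : H →ₗ[ℂ] MonoidAlgebra ℂ G)
  refine Eq.trans ?_ (coassoc_ext (TensorProduct.map .id ((TensorProduct.rid ℂ _).toLinearMap ∘ₗ
      TensorProduct.map .id φ))
    (F' := TensorProduct.map .id (rightProj π b))
    (F := Coalgebra.comul ∘ₗ (TensorProduct.rid ℂ H).toLinearMap ∘ₗ TensorProduct.map .id φ)
    (fun y z => ?_) (fun y z => ?_) x)
  · rw [rightProj_apply]; rfl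
  · simp only [LinearMap.comp_apply, TensorProduct.map_tmul, LinearEquiv.coe_coe,
      LinearMap.id_apply, TensorProduct.rid_tmul, map_smul]
    generalize (Coalgebra.comul (R := ℂ) y) = s
    induction s with
    | zero => simp
    | add _ _ h₁ h₂ => simp only [map_add, TensorProduct.add_tmul, smul_add, h₁, h₂]
    | tmul _ _ => simp [φ]
  · simp only [TensorProduct.map_tmul, rightProj_apply]
    rfl

lemma isHomogeneous_proj (a b : G) (x : H) :
    IsHomogeneous π a b (rightProj π b (leftProj π a x)) := by
  refine ⟨?_, coact_isoProj (rightCoact_coassoc π) b _⟩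
  have := coact_isoProj (leftCoact_coassoc π) a x
  rw [AlgHom.toLinearMap_apply] at this
  rw [leftCoact_rightProj, this]
  rfl

variable {π}

/-- `π(x) = ε(x) a` for `x ∈ H_{a,b}`. -/
lemma IsHomogeneous.apply_left {a b : G} {x : H} (hx : IsHomogeneous π a b x) :
    π x = Coalgebra.counit (R := ℂ) x • MonoidAlgebra.single a (1 : ℂ) := by
  have h : ∀ t : H ⊗[ℂ] H, TensorProduct.lid ℂ _ (TensorProduct.map Coalgebra.counit .id
      (TensorProduct.comm ℂ _ _ (TensorProduct.map (π : H →ₗ[ℂ] MonoidAlgebra ℂ G) .id t))) =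
      π (TensorProduct.rid ℂ H (TensorProduct.map .id Coalgebra.counit t)) := fun t => by
    induction t with
    | zero => simp
    | add _ _ h₁ h₂ => simp only [map_add, h₁, h₂]
    | tmul _ _ => simp
  have e := h (Coalgebra.comul x)
  rw [← LinearMap.lTensor_def, Coalgebra.lTensor_counit_comul, ← leftCoact_apply, hx.1] at e
  simpa using e.symm

lemma IsHomogeneous.apply_right {a b : G} {x : H} (hx : IsHomogeneous π a b x) :
    π x = Coalgebra.counit (R := ℂ) x • MonoidAlgebra.single b (1 : ℂ) := by
  have h : ∀ t : H ⊗[ℂ] H, TensorProduct.lid ℂ _ (TensorProduct.map Coalgebra.counit .id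
      (TensorProduct.map .id (π : H →ₗ[ℂ] MonoidAlgebra ℂ G) t)) =
      π (TensorProduct.lid ℂ H (TensorProduct.map Coalgebra.counit .id t)) := fun t => by
    induction t with
    | zero => simp
    | add _ _ h₁ h₂ => simp only [map_add, h₁, h₂]
    | tmul _ _ => simp
  have e := h (Coalgebra.comul x)
  have c : TensorProduct.map Coalgebra.counit .id (Coalgebra.comul (R := ℂ) x) = 1 ⊗ₜ x :=
    Coalgebra.rTensor_counit_comul x
  rw [c, ← rightCoact_apply, hx.2] at e
  simpa using e.symm

lemma IsHomogeneous.counit_eq_zero {a b : G} {x : H} (hx : IsHomogeneous π a b x) (hab : a ≠ b) :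
    Coalgebra.counit (R := ℂ) x = 0 := by
  classical
  simpa [coeffAt_single, hab, eq_comm] using
    congrArg (coeffAt b) (hx.apply_left.symm.trans hx.apply_right)

variable (π) in
lemma map_proj_mem (a b c : G) (t : H ⊗[ℂ] H) :
    TensorProduct.map (rightProj π c ∘ₗ leftProj π a) (rightProj π b ∘ₗ leftProj π c) t ∈
      Submodule.span ℂ {t | ∃ c y z, IsHomogeneous π a c y ∧ IsHomogeneous π c b z ∧
        t = y ⊗ₜ[ℂ] z} := by
  induction t with
  | zero => simp
  | add _ _ h₁ h₂ => rw [map_add]; exact Submodule.add_mem _ h₁ h₂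
  | tmul y z =>
    exact Submodule.subset_span
      ⟨c, _, _, isHomogeneous_proj π a c y, isHomogeneous_proj π c b z, rfl⟩

lemma IsHomogeneous.comul_mem {a b : G} {x : H} (hx : IsHomogeneous π a b x) :
    Coalgebra.comul x ∈ Submodule.span ℂ {t | ∃ c y z, IsHomogeneous π a c y ∧
      IsHomogeneous π c b z ∧ t = y ⊗ₜ[ℂ] z} := by
  obtain ⟨s, hs⟩ := exists_sum_map_isoProj (ρ := (rightCoact π).toLinearMap)
    (rightCoact_counit π) (Coalgebra.comul (R := ℂ) x)
  have hl : TensorProduct.map (leftProj π a) .id (Coalgebra.comul (R := ℂ) x) =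
      Coalgebra.comul x := by
    rw [← comul_leftProj, leftProj, isoProj_of_mem hx.1]
  have hr : TensorProduct.map .id (rightProj π b) (Coalgebra.comul (R := ℂ) x) =
      Coalgebra.comul x := by
    rw [← comul_rightProj, rightProj, isoProj_of_mem hx.2]
  rw [← hr, ← hs s subset_rfl, map_sum]
  refine Submodule.sum_mem _ fun c _ => ?_
  have hidem : rightProj π c ∘ₗ rightProj π c = rightProj π c :=
    LinearMap.ext fun y => isoProj_of_mem (coact_isoProj (rightCoact_coassoc π) c y)
  -- the middle degree can be read off from either side of the coproduct
  have e : TensorProduct.map .id (rightProj π b) (TensorProduct.map (rightProj π c) .id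
      (Coalgebra.comul (R := ℂ) x)) = TensorProduct.map (rightProj π c ∘ₗ leftProj π a)
        (rightProj π b ∘ₗ leftProj π c) (Coalgebra.comul x) := by
    rw [TensorProduct.map_map, LinearMap.id_comp, LinearMap.comp_id]
    nth_rw 1 [← hidem]
    rw [← LinearMap.comp_id (rightProj π b), TensorProduct.map_comp, LinearMap.comp_apply,
      map_rightProj_comul, TensorProduct.map_map, LinearMap.comp_id, LinearMap.comp_id]
    nth_rw 1 [← hl]
    rw [TensorProduct.map_map, LinearMap.comp_id]
  exact e ▸ map_proj_mem π a b c _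

variable (π) in
/-- `H` is the sum of the spaces `H_{a,b}`, and the coproduct and the counit respect the degrees. -/
lemma isBigraded : IsBigraded (Coalgebra.comul (R := ℂ) (A := H)) Coalgebra.counit
    (IsHomogeneous π) where
  span_eq_top := by
    refine eq_top_iff.2 fun x _ => ?_
    obtain ⟨s, hs⟩ := exists_sum_isoProj (ρ := (leftCoact π).toLinearMap)
      (leftCoact_counit π) x
    rw [← hs s subset_rfl]
    refine Submodule.sum_mem _ fun a _ => ?_
    obtain ⟨s', hs'⟩ := exists_sum_isoProj (ρ := (rightCoact π).toLinearMap)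
      (rightCoact_counit π) (leftProj π a x)
    refine hs' s' subset_rfl ▸ Submodule.sum_mem _ fun b _ => ?_
    exact Submodule.subset_span ⟨a, b, isHomogeneous_proj π a b x⟩
  comul_mem := IsHomogeneous.comul_mem
  counit_eq_zero := IsHomogeneous.counit_eq_zero
  counit_left x := by
    rw [← LinearMap.rTensor_def, Coalgebra.rTensor_counit_comul]
    simp
  counit_right x := by
    rw [← LinearMap.lTensor_def, Coalgebra.lTensor_counit_comul]
    simp

/-! ### Operations and degrees -/

lemma isHomogeneous_one : IsHomogeneous π 1 1 (1 : H) := by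
  simp [IsHomogeneous, Algebra.TensorProduct.one_def, MonoidAlgebra.one_def]

lemma IsHomogeneous.mul {a b c d : G} {x y : H} (hx : IsHomogeneous π a b x)
    (hy : IsHomogeneous π c d y) : IsHomogeneous π (a * c) (b * d) (x * y) := by
  simp [IsHomogeneous, hx.1, hx.2, hy.1, hy.2, MonoidAlgebra.single_mul_single]

lemma IsHomogeneous.star [StarRing H] [StarModule ℂ H]
    (hH : ∀ x : H, Coalgebra.comul (R := ℂ) (star x) = star (Coalgebra.comul (R := ℂ) x))
    (hπ : ∀ x : H, π (star x) = star (π x)) {a b : G} {x : H} (hx : IsHomogeneous π a b x) :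
    IsHomogeneous π a⁻¹ b⁻¹ (star x) := by
  have hl : ∀ t : H ⊗[ℂ] H, TensorProduct.comm ℂ _ _
      (TensorProduct.map (π : H →ₗ[ℂ] MonoidAlgebra ℂ G) .id (Star.star t)) =
      Star.star (TensorProduct.comm ℂ _ _
        (TensorProduct.map (π : H →ₗ[ℂ] MonoidAlgebra ℂ G) .id t)) := fun t => by
    induction t with
    | zero => simp
    | add _ _ h₁ h₂ => simp only [map_add, star_add, h₁, h₂]
    | tmul y z => simp [hπ]
  have hr : ∀ t : H ⊗[ℂ] H,
      TensorProduct.map .id (π : H →ₗ[ℂ] MonoidAlgebra ℂ G) (Star.star t) =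
      Star.star (TensorProduct.map .id (π : H →ₗ[ℂ] MonoidAlgebra ℂ G) t) := fun t => by
    induction t with
    | zero => simp
    | add _ _ h₁ h₂ => simp only [map_add, star_add, h₁, h₂]
    | tmul y z => simp [hπ]
  constructor
  · rw [leftCoact_apply, hH, hl, ← leftCoact_apply, hx.1, TensorProduct.star_tmul, star_single,
      map_one]
  · rw [rightCoact_apply, hH, hr, ← rightCoact_apply, hx.2, TensorProduct.star_tmul, star_single,
      map_one]

/-- An algebra homomorphism `f` and a linear map `g` on `H` satisfy `g = f ∘ S` as soon as `g` is a
right convolution inverse of `f`. -/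
lemma algHom_antipode_eq {A : Type*} [Ring A] [Algebra ℂ A] (f : H →ₐ[ℂ] A) (g : H →ₗ[ℂ] A)
    (h : ∀ x, LinearMap.mul' ℂ A (TensorProduct.map f.toLinearMap g (Coalgebra.comul x)) =
      algebraMap ℂ A (Coalgebra.counit x)) (x : H) : f (HopfAlgebra.antipode ℂ x) = g x := by
  have h1 : WithConv.toConv f.toLinearMap * WithConv.toConv g = 1 :=
    WithConv.ext (LinearMap.ext h)
  have h2 : WithConv.toConv (f.toLinearMap ∘ₗ HopfAlgebra.antipode ℂ) *
      WithConv.toConv f.toLinearMap = 1 := by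
    refine WithConv.ext (LinearMap.ext fun x => ?_)
    have e : ∀ t, LinearMap.mul' ℂ A (TensorProduct.map (f.toLinearMap ∘ₗ HopfAlgebra.antipode ℂ)
        f.toLinearMap t) = f (LinearMap.mul' ℂ H
          (TensorProduct.map (HopfAlgebra.antipode ℂ) .id t)) := fun t => by
      induction t with
      | zero => simp
      | add _ _ h₁ h₂ => simp only [map_add, h₁, h₂]
      | tmul y z => simp
    refine (e _).trans ?_
    rw [← LinearMap.rTensor_def, HopfAlgebra.mul_antipode_rTensor_comul_apply]
    simp
  have h3 := congrArg WithConv.ofConv (left_inv_eq_right_inv h2 h1)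
  exact LinearMap.congr_fun h3 x

/-- That the antipode interchanges and inverts the degrees follows, for each of the two coactions
`δ`, from `δ ∘ S` being the convolution inverse of the algebra homomorphism `δ`. -/
lemma IsHomogeneous.antipode {a b : G} {x : H} (hx : IsHomogeneous π a b x) :
    IsHomogeneous π b⁻¹ a⁻¹ (HopfAlgebra.antipode ℂ x) := by
  have key : ∀ x : H,
      LinearMap.mul' ℂ H (TensorProduct.map .id (HopfAlgebra.antipode ℂ) (Coalgebra.comul x)) =
        algebraMap ℂ H (Coalgebra.counit x) := HopfAlgebra.mul_antipode_lTensor_comul_apply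
  constructor
  · refine (algHom_antipode_eq (leftCoact π) (TensorProduct.map (HopfAlgebra.antipode ℂ)
      (HopfAlgebra.antipode ℂ) ∘ₗ (rightCoact π).toLinearMap) (fun x => ?_) x).trans ?_
    · refine (isBigraded π).ext (f := LinearMap.mul' ℂ _ ∘ₗ TensorProduct.map
        (leftCoact π).toLinearMap (TensorProduct.map (HopfAlgebra.antipode ℂ)
          (HopfAlgebra.antipode ℂ) ∘ₗ (rightCoact π).toLinearMap) ∘ₗ Coalgebra.comul)
        (g := Algebra.linearMap ℂ _ ∘ₗ Coalgebra.counit) (fun a b x hx => ?_) x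
      refine ((isBigraded π).comul_ext hx (F := LinearMap.mul' ℂ _ ∘ₗ TensorProduct.map
        (leftCoact π).toLinearMap (TensorProduct.map (HopfAlgebra.antipode ℂ)
          (HopfAlgebra.antipode ℂ) ∘ₗ (rightCoact π).toLinearMap))
        (G := (TensorProduct.mk ℂ _ _).flip
        (MonoidAlgebra.single (a * b⁻¹) (1 : ℂ)) ∘ₗ LinearMap.mul' ℂ H ∘ₗ
          TensorProduct.map .id (HopfAlgebra.antipode ℂ)) fun c y z hy hz => ?_).trans ?_
      · simp [hy.1, hz.2, MonoidAlgebra.single_mul_single]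
      · simp only [LinearMap.comp_apply, key]
        by_cases hab : a = b
        · simp [hab, Algebra.TensorProduct.algebraMap_apply, MonoidAlgebra.one_def]
        · simp [hx.counit_eq_zero hab]
    · simp [hx.2]
  · refine (algHom_antipode_eq (rightCoact π) (TensorProduct.map (HopfAlgebra.antipode ℂ)
      (HopfAlgebra.antipode ℂ) ∘ₗ (leftCoact π).toLinearMap) (fun x => ?_) x).trans ?_
    · refine (isBigraded π).ext (f := LinearMap.mul' ℂ _ ∘ₗ TensorProduct.map
        (rightCoact π).toLinearMap (TensorProduct.map (HopfAlgebra.antipode ℂ)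
          (HopfAlgebra.antipode ℂ) ∘ₗ (leftCoact π).toLinearMap) ∘ₗ Coalgebra.comul)
        (g := Algebra.linearMap ℂ _ ∘ₗ Coalgebra.counit) (fun a b x hx => ?_) x
      refine ((isBigraded π).comul_ext hx (F := LinearMap.mul' ℂ _ ∘ₗ TensorProduct.map
        (rightCoact π).toLinearMap (TensorProduct.map (HopfAlgebra.antipode ℂ)
          (HopfAlgebra.antipode ℂ) ∘ₗ (leftCoact π).toLinearMap))
        (G := (TensorProduct.mk ℂ _ _).flip
        (MonoidAlgebra.single 1 (1 : ℂ)) ∘ₗ LinearMap.mul' ℂ H ∘ₗ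
          TensorProduct.map .id (HopfAlgebra.antipode ℂ)) fun c y z hy hz => ?_).trans ?_
      · simp [hy.2, hz.1, MonoidAlgebra.single_mul_single]
      · simp only [LinearMap.comp_apply, key]
        simp [Algebra.TensorProduct.algebraMap_apply, MonoidAlgebra.one_def]
    · simp [hx.1]

lemma IsHomogeneous.apply_antipode {a b : G} {x : H} (hx : IsHomogeneous π a b x) :
    π (HopfAlgebra.antipode ℂ x) =
      Coalgebra.counit (R := ℂ) x • MonoidAlgebra.single a⁻¹ (1 : ℂ) := by
  rw [hx.antipode.apply_right, HopfAlgebra.counit_antipode]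

end Bigrading

/-! ### Contracting coproducts with the counit -/

namespace IsBigraded

variable {Γ C W : Type*} [AddCommGroup C] [Module ℂ C] [AddCommGroup W] [Module ℂ W]
  {Δ : C →ₗ[ℂ] C ⊗[ℂ] C} {ε : C →ₗ[ℂ] ℂ} {D : Γ → Γ → C → Prop}

/-- If `F(y ⊗ z) = ε(y) g(z)` for homogeneous `y` and `z` as in the coproduct of `x`, then
`F(Δ(x)) = g(x)` by the counit axiom. -/
lemma comul_eq_left (h : IsBigraded Δ ε D) {a b : Γ} {x : C} (hx : D a b x) {F : C ⊗[ℂ] C →ₗ[ℂ] W}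
    {g : C →ₗ[ℂ] W} (hF : ∀ c y z, D a c y → D c b z → F (y ⊗ₜ z) = ε y • g z) :
    F (Δ x) = g x := by
  refine (h.comul_ext hx (G := g ∘ₗ (TensorProduct.lid ℂ C).toLinearMap ∘ₗ
    TensorProduct.map ε .id) fun c y z hy hz => ?_).trans ?_
  · simpa using hF c y z hy hz
  · simp [h.counit_left]

lemma comul_eq_right (h : IsBigraded Δ ε D) {a b : Γ} {x : C} (hx : D a b x)
    {F : C ⊗[ℂ] C →ₗ[ℂ] W} {g : C →ₗ[ℂ] W}
    (hF : ∀ c y z, D a c y → D c b z → F (y ⊗ₜ z) = ε z • g y) : F (Δ x) = g x := by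
  refine (h.comul_ext hx (G := g ∘ₗ (TensorProduct.rid ℂ C).toLinearMap ∘ₗ
    TensorProduct.map .id ε) fun c y z hy hz => ?_).trans ?_
  · simpa using hF c y z hy hz
  · simp [h.counit_right]

end IsBigraded

/-! ### Hopf `*`-algebras in terms of operations -/

section OfHopf

variable {A : Type*} [Ring A] [HopfAlgebra ℂ A] [StarRing A] [StarModule ℂ A]

/-- The counit of a Hopf `*`-algebra is `*`-preserving, as `x ↦ conj ε(x^*)` is a counit too and
counits are unique. -/
lemma counit_star_of_comul_star
    (hA : ∀ x : A, Coalgebra.comul (R := ℂ) (star x) = star (Coalgebra.comul (R := ℂ) x)) (x : A) :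
    Coalgebra.counit (R := ℂ) (star x) = starRingEnd ℂ (Coalgebra.counit (R := ℂ) x) := by
  have c1 : TensorProduct.map Coalgebra.counit .id (Coalgebra.comul (R := ℂ) (star x)) =
      1 ⊗ₜ star x := Coalgebra.rTensor_counit_comul _
  have c2 : TensorProduct.map .id Coalgebra.counit (Coalgebra.comul (R := ℂ) x) =
      x ⊗ₜ (1 : ℂ) := Coalgebra.lTensor_counit_comul _
  have key : ∀ t : A ⊗[ℂ] A, Coalgebra.counit (R := ℂ) (star (TensorProduct.lid ℂ A
      (TensorProduct.map Coalgebra.counit .id (star t)))) = starRingEnd ℂ (Coalgebra.counit (R := ℂ)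
        (star (TensorProduct.rid ℂ A (TensorProduct.map .id Coalgebra.counit t)))) := fun t => by
    induction t with
    | zero => simp
    | add _ _ h₁ h₂ => simp only [map_add, star_add, h₁, h₂]
    | tmul y z => simp [mul_comm]
  have e := key (Coalgebra.comul x)
  rw [← hA, c1, c2] at e
  simpa using (congrArg (starRingEnd ℂ) e).symm

lemma isHopfStar_ofHopf
    (hA : ∀ x : A, Coalgebra.comul (R := ℂ) (star x) = star (Coalgebra.comul (R := ℂ) x)) :
    (HopfStarOps.ofHopf A).IsHopfStar where
  mul_assoc := mul_assoc
  one_mul := one_mul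
  mul_one := mul_one
  coassoc := Coalgebra.coassoc_apply
  counit_comul := Coalgebra.rTensor_counit_comul
  comul_counit := Coalgebra.lTensor_counit_comul
  comul_mul x y := by
    refine (Bialgebra.comul_mul x y).trans ?_
    change _ = TensorProduct.map₂ _ _ (Coalgebra.comul x) (Coalgebra.comul y)
    generalize (Coalgebra.comul (R := ℂ) x) = s
    generalize (Coalgebra.comul (R := ℂ) y) = t
    induction s with
    | zero => simp
    | add _ _ h₁ h₂ => simp only [add_mul, map_add, LinearMap.add_apply, h₁, h₂]
    | tmul _ _ =>
      induction t with
      | zero => simp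
      | add _ _ h₁ h₂ => simp only [mul_add, map_add, h₁, h₂]
      | tmul _ _ =>
        rw [TensorProduct.map₂_apply_tmul, TensorProduct.map_tmul]
        exact Algebra.TensorProduct.tmul_mul_tmul ..
  comul_one := Bialgebra.comul_one
  counit_mul := Bialgebra.counit_mul
  counit_one := Bialgebra.counit_one
  antipode_left x := (HopfAlgebra.mul_antipode_rTensor_comul_apply x).trans
    (Algebra.algebraMap_eq_smul_one _)
  antipode_right x := (HopfAlgebra.mul_antipode_lTensor_comul_apply x).trans
    (Algebra.algebraMap_eq_smul_one _)
  star_star := star_star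
  star_mul := star_mul
  comul_star := hA
  counit_star := counit_star_of_comul_star hA

end OfHopf

section Duality

/-! ### Characters of a group and of its quotient -/

variable {T : Type*} [CommGroup T] [TopologicalSpace T] (T₀ : Subgroup T)

/-- The restriction of characters of `T` to `T₀`. -/
def dualRes : PontryaginDual T →* PontryaginDual T₀ :=
  (PontryaginDual.map (⟨T₀.subtype, continuous_subtype_val⟩ : T₀ →ₜ* T)).toMonoidHom

/-- The embedding of the dual of `T/T₀` into the dual of `T`. -/
def dualQuot : PontryaginDual (T ⧸ T₀) →* PontryaginDual T :=
  (PontryaginDual.map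
      (⟨QuotientGroup.mk' T₀, QuotientGroup.continuous_mk⟩ : T →ₜ* T ⧸ T₀)).toMonoidHom

lemma dualRes_apply (χ : PontryaginDual T) (t : T₀) : dualRes T₀ χ t = χ t := rfl

lemma dualQuot_apply (χ : PontryaginDual (T ⧸ T₀)) (t : T) :
    dualQuot T₀ χ t = χ (QuotientGroup.mk t) := rfl

lemma dualQuot_injective : Function.Injective (dualQuot T₀) := fun χ χ' h => by
  ext t
  obtain ⟨t, rfl⟩ := QuotientGroup.mk_surjective t
  rw [← dualQuot_apply, h, dualQuot_apply]

/-- The annihilator of `T₀` consists of the characters that factor through `T/T₀`. -/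
lemma dualRes_eq_one_iff (χ : PontryaginDual T) :
    dualRes T₀ χ = 1 ↔ ∃ n, dualQuot T₀ n = χ := by
  constructor
  · intro h
    have h' : ∀ t ∈ T₀, χ t = 1 := fun t ht => by
      rw [← dualRes_apply T₀ χ ⟨t, ht⟩, h, PontryaginDual.one_apply]
    let f : T ⧸ T₀ →* Circle := QuotientGroup.lift T₀ (χ : T →* Circle) h'
    have hf : Continuous f := continuous_quot_lift _ (map_continuous χ)
    exact ⟨(⟨f, hf⟩ : T ⧸ T₀ →ₜ* Circle), rfl⟩
  · rintro ⟨n, rfl⟩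
    ext t
    rw [dualRes_apply, dualQuot_apply, (QuotientGroup.eq_one_iff _).2 t.2, map_one,
      PontryaginDual.one_apply]

@[simp]
lemma resMap_single (χ : PontryaginDual T) (r : ℂ) :
    resMap T₀ (MonoidAlgebra.single χ r) = MonoidAlgebra.single (dualRes T₀ χ) r :=
  MonoidAlgebra.mapDomainBialgHom_single ..

@[simp]
lemma quotMap_single (χ : PontryaginDual (T ⧸ T₀)) (r : ℂ) :
    quotMap T₀ (MonoidAlgebra.single χ r) = MonoidAlgebra.single (dualQuot T₀ χ) r :=
  MonoidAlgebra.mapDomainBialgHom_single ..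

lemma quotMap_injective : Function.Injective (quotMap T₀) :=
  MonoidAlgebra.mapDomain_injective (dualQuot_injective T₀)

lemma quotForm_single (β : PontryaginDual T →* PontryaginDual T →* Circle)
    (n m : PontryaginDual (T ⧸ T₀)) :
    quotForm β T₀ (MonoidAlgebra.single n 1 ⊗ₜ MonoidAlgebra.single m 1) =
      β (dualQuot T₀ n) (dualQuot T₀ m) := by
  simp [quotForm, bicharForm]

end Duality

section Homogeneous

variable {T : Type*} [CommGroup T] [TopologicalSpace T]
  {H : Type*} [Ring H] [HopfAlgebra ℂ H] {π : H →ₐc[ℂ] Pol T} {T₀ : Subgroup T}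

/-! ### The adjoint coaction -/

lemma IsHomogeneous.adMap {a b : PontryaginDual T} {x : H} (hx : IsHomogeneous π a b x) :
    adMap (π : H →ₗ[ℂ] Pol T) x = x ⊗ₜ MonoidAlgebra.single (a⁻¹ * b) 1 := by
  let P : H ⊗[ℂ] (H ⊗[ℂ] H) →ₗ[ℂ] H ⊗[ℂ] Pol T := TensorProduct.map .id (π : H →ₗ[ℂ] Pol T) ∘ₗ
    TensorProduct.map .id (LinearMap.mul' ℂ H ∘ₗ TensorProduct.map (HopfAlgebra.antipode ℂ) .id) ∘ₗ
    (TensorProduct.leftComm ℂ H H H).toLinearMap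
  refine (isBigraded π).comul_eq_left hx (F := P ∘ₗ TensorProduct.map .id Coalgebra.comul)
    (g := (TensorProduct.mk ℂ _ _).flip (MonoidAlgebra.single (a⁻¹ * b) 1)) fun c y z hy hz => ?_
  refine (isBigraded π).comul_eq_right hz (F := P ∘ₗ TensorProduct.mk ℂ _ _ y)
    (g := Coalgebra.counit (R := ℂ) y • (TensorProduct.mk ℂ _ _).flip
      (MonoidAlgebra.single (a⁻¹ * b) 1)) fun d z₁ z₂ hz₁ hz₂ => ?_
  simp [P, hy.apply_antipode, hz₂.apply_right, MonoidAlgebra.single_mul_single,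
    MonoidAlgebra.smul_single]
  rw [smul_smul, ← TensorProduct.tmul_smul, MonoidAlgebra.smul_single, smul_eq_mul, mul_one,
    mul_comm (Coalgebra.counit _)]

lemma adMap_comp {K : Type*} [Ring K] [HopfAlgebra ℂ K] (f : Pol T →ₗ[ℂ] K) (x : H) :
    adMap (f ∘ₗ (π : H →ₗ[ℂ] Pol T)) x =
      TensorProduct.map .id f (adMap (π : H →ₗ[ℂ] Pol T) x) := by
  simp only [CocycleTwist.adMap, LinearMap.comp_apply, TensorProduct.map_map]
  simp

/-- Cocentrality means that `a⁻¹ b` is trivial on `T₀` whenever `H_{a,b} ≠ 0`. -/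
lemma IsHomogeneous.exists_dualQuot (hcoc : IsCocentral π T₀) {a b : PontryaginDual T} {x : H}
    (hx : IsHomogeneous π a b x) (h0 : x ≠ 0) : ∃ n, dualQuot T₀ n = a⁻¹ * b := by
  classical
  rw [← dualRes_eq_one_iff]
  by_contra hne
  have h := hcoc x
  rw [adMap_comp, hx.adMap] at h
  have h' := congrArg (fun t => TensorProduct.rid ℂ H (TensorProduct.map .id (coeffAt 1) t)) h
  simp only [TensorProduct.map_tmul, MonoidAlgebra.one_def, TensorProduct.rid_tmul] at h'
  change coeffAt 1 (resMap T₀ _) • _ = _ at h'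
  rw [resMap_single, coeffAt_single, coeffAt_single, if_neg hne, if_pos rfl] at h'
  simp at h'
  exact h0 h'.symm

variable (π T₀) in
/-- `x ∈ H_{a,b}`, where `a⁻¹ b` is trivial on `T₀`. If `T₀` is cocentral, these elements include
all nonzero homogeneous elements. -/
def IsCoHomogeneous (a b : PontryaginDual T) (x : H) : Prop :=
  IsHomogeneous π a b x ∧ ∃ n, dualQuot T₀ n = a⁻¹ * b

lemma isBigraded_coHomogeneous (hcoc : IsCocentral π T₀) :
    IsBigraded (Coalgebra.comul (R := ℂ) (A := H)) Coalgebra.counit (IsCoHomogeneous π T₀) where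
  span_eq_top := by
    rw [eq_top_iff, ← (isBigraded π).span_eq_top, Submodule.span_le]
    rintro x ⟨a, b, hx⟩
    by_cases h0 : x = 0
    · simp [h0]
    · exact Submodule.subset_span ⟨a, b, hx, hx.exists_dualQuot hcoc h0⟩
  comul_mem {a b x} hx := by
    refine Submodule.span_le.2 ?_ hx.1.comul_mem
    rintro _ ⟨c, y, z, hy, hz, rfl⟩
    by_cases hy0 : y = 0
    · simp [hy0]
    by_cases hz0 : z = 0
    · simp [hz0]
    exact Submodule.subset_span ⟨c, y, z, ⟨hy, hy.exists_dualQuot hcoc hy0⟩,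
      ⟨hz, hz.exists_dualQuot hcoc hz0⟩, rfl⟩
  counit_eq_zero hx := hx.1.counit_eq_zero
  counit_left := (isBigraded π).counit_left
  counit_right := (isBigraded π).counit_right

/-- As `ad_π` takes values in `H ⊗ ℂ[T/T₀]`, the junk value in the definition of `quotCoact` does
not occur. -/
lemma map_quotCoact (hcoc : IsCocentral π T₀) (x : H) :
    TensorProduct.map .id (quotMap T₀ : Pol (T ⧸ T₀) →ₗ[ℂ] Pol T) (quotCoact π T₀ x) =
      adMap (π : H →ₗ[ℂ] Pol T) x := by
  refine comp_corestrict (tensorMap_injective (f := .id) Function.injective_id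
    (quotMap_injective T₀)) (fun x => ?_) x
  have hx : x ∈ Submodule.span ℂ _ :=
    ((isBigraded_coHomogeneous hcoc).span_eq_top ▸ Submodule.mem_top : x ∈ _)
  induction hx using Submodule.span_induction with
  | mem x hx =>
    obtain ⟨a, b, hx, n, hn⟩ := hx
    exact ⟨x ⊗ₜ MonoidAlgebra.single n 1, by rw [hx.adMap, ← hn, ← quotMap_single]; rfl⟩
  | zero => simp
  | add _ _ _ _ h₁ h₂ => rw [map_add]; exact Submodule.add_mem _ h₁ h₂
  | smul r _ _ h => rw [map_smul]; exact Submodule.smul_mem _ r h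

lemma quotCoact_apply (hcoc : IsCocentral π T₀) {a b : PontryaginDual T} {x : H}
    (hx : IsHomogeneous π a b x) {n : PontryaginDual (T ⧸ T₀)} (hn : dualQuot T₀ n = a⁻¹ * b) :
    quotCoact π T₀ x = x ⊗ₜ MonoidAlgebra.single n 1 := by
  refine tensorMap_injective (f := .id) Function.injective_id (quotMap_injective T₀) ?_
  refine (map_quotCoact hcoc x).trans ?_
  rw [hx.adMap, ← hn, ← quotMap_single]
  rfl

end Homogeneous

/-! ### Braided tensor products -/

section Braiding

variable {K M N A B : Type*} [AddCommGroup K] [Module ℂ K] [AddCommGroup M] [Module ℂ M]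
  [AddCommGroup N] [Module ℂ N] [AddCommGroup A] [Module ℂ A] [AddCommGroup B] [Module ℂ B]
  {R : K ⊗[ℂ] K →ₗ[ℂ] ℂ} {δA : A →ₗ[ℂ] A ⊗[ℂ] K} {δB : B →ₗ[ℂ] B ⊗[ℂ] K}

lemma braiding_tmul {a : A} {b : B} {k l : K} (ha : δA a = a ⊗ₜ k) (hb : δB b = b ⊗ₜ l) :
    braiding R δA δB (a ⊗ₜ b) = R (k ⊗ₜ l) • b ⊗ₜ a := by
  simp [braiding, ha, hb]

lemma braidedMul_tmul {mA : A →ₗ[ℂ] A →ₗ[ℂ] A} {mB : B →ₗ[ℂ] B →ₗ[ℂ] B} {a a' : A} {b b' : B}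
    {k l : K} (hb : δB b = b ⊗ₜ k) (ha' : δA a' = a' ⊗ₜ l) :
    braidedMul R mA δA mB δB (a ⊗ₜ b) (a' ⊗ₜ b') = R (k ⊗ₜ l) • mA a a' ⊗ₜ mB b b' := by
  simp [braidedMul, braiding_tmul hb ha', TensorProduct.smul_tmul']

lemma braidedStar_tmul {sA : AntiLin A A} {sB : AntiLin B B} {a : A} {b : B}
    {k l : K} (hb : δB (sB b) = sB b ⊗ₜ k) (ha : δA (sA a) = sA a ⊗ₜ l) :
    braidedStar R sA δA sB δB (a ⊗ₜ b) = R (k ⊗ₜ l) • sA a ⊗ₜ sB b := by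
  simp [braidedStar, braiding_tmul hb ha]

end Braiding

section Transmutation

/-! ### The operations of the transmutation -/

variable {T : Type*} [CommGroup T] [TopologicalSpace T]
  {H : Type*} [Ring H] [HopfAlgebra ℂ H] {π : H →ₐc[ℂ] Pol T}
  {β : PontryaginDual T →* PontryaginDual T →* Circle} {a b c d : PontryaginDual T} {x y : H}

lemma bicharForm_single (a b : PontryaginDual T) (r s : ℂ) :
    bicharForm β (MonoidAlgebra.single a r ⊗ₜ MonoidAlgebra.single b s) = r * s * β a b := by
  simp [bicharForm, mul_assoc]

/-- On homogeneous elements the product of the transmutation is a multiple of the original one. -/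
lemma IsHomogeneous.transMul (hx : IsHomogeneous π a b x) (hy : IsHomogeneous π c d y) :
    transMul (bicharForm β) (π : H →ₗ[ℂ] Pol T) x y = (β (a * b⁻¹) c : ℂ) • (x * y) := by
  let P : (H ⊗[ℂ] H) ⊗[ℂ] (H ⊗[ℂ] H) →ₗ[ℂ] H ⊗[ℂ] H := TensorProduct.map .id
    ((TensorProduct.lid ℂ H).toLinearMap ∘ₗ
      TensorProduct.map (bicharForm β ∘ₗ TensorProduct.map (π : H →ₗ[ℂ] Pol T)
        (HopfAlgebra.antipode ℂ ∘ₗ (π : H →ₗ[ℂ] Pol T))) .id ∘ₗ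
      (TensorProduct.assoc ℂ H H H).symm.toLinearMap) ∘ₗ
    (TensorProduct.assoc ℂ H H (H ⊗[ℂ] H)).toLinearMap
  let Q : (H ⊗[ℂ] H) ⊗[ℂ] (H ⊗[ℂ] H) →ₗ[ℂ] H ⊗[ℂ] H :=
    (TensorProduct.lid ℂ (H ⊗[ℂ] H)).toLinearMap ∘ₗ
    TensorProduct.map (bicharForm β ∘ₗ TensorProduct.map (π : H →ₗ[ℂ] Pol T)
      (π : H →ₗ[ℂ] Pol T)) .id ∘ₗ
    (TensorProduct.tensorTensorTensorComm ℂ H H H H).toLinearMap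
  -- `P` and `Q` are the two maps of which `transMul` is composed, without the coproducts.
  have hP : P (Coalgebra.comul x ⊗ₜ Coalgebra.comul y) = (β b c⁻¹ : ℂ) • x ⊗ₜ y := by
    refine (isBigraded π).comul_eq_right hx
      (F := P ∘ₗ (TensorProduct.mk ℂ _ _).flip (Coalgebra.comul y))
      (g := (β b c⁻¹ : ℂ) • (TensorProduct.mk ℂ _ _).flip y) fun e x₁ x₂ hx₁ hx₂ => ?_
    refine (isBigraded π).comul_eq_left hy (F := P ∘ₗ TensorProduct.mk ℂ _ _ (x₁ ⊗ₜ x₂))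
      (g := Coalgebra.counit (R := ℂ) x₂ • (β b c⁻¹ : ℂ) • TensorProduct.mk ℂ _ _ x₁)
      fun f y₁ y₂ hy₁ hy₂ => ?_
    simp [P, hx₂.apply_right, hy₁.apply_left, bicharForm_single, smul_smul]
    ring_nf
  have hQ : Q (Coalgebra.comul x ⊗ₜ Coalgebra.comul y) = (β a c : ℂ) • x ⊗ₜ y := by
    refine (isBigraded π).comul_eq_left hx
      (F := Q ∘ₗ (TensorProduct.mk ℂ _ _).flip (Coalgebra.comul y))
      (g := (β a c : ℂ) • (TensorProduct.mk ℂ _ _).flip y) fun e x₁ x₂ hx₁ hx₂ => ?_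
    refine (isBigraded π).comul_eq_left hy (F := Q ∘ₗ TensorProduct.mk ℂ _ _ (x₁ ⊗ₜ x₂))
      (g := Coalgebra.counit (R := ℂ) x₁ • (β a c : ℂ) • TensorProduct.mk ℂ _ _ x₂)
      fun f y₁ y₂ hy₁ hy₂ => ?_
    simp [Q, hx₁.apply_left, hy₁.apply_left, bicharForm_single, smul_smul]
    ring_nf
  let C : H ⊗[ℂ] H →ₗ[ℂ] (H ⊗[ℂ] H) ⊗[ℂ] (H ⊗[ℂ] H) :=
    TensorProduct.map Coalgebra.comul Coalgebra.comul
  have hQ' : Q (C (x ⊗ₜ y)) = (β a c : ℂ) • x ⊗ₜ y := hQ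
  change LinearMap.mul' ℂ H (Q (C (P (C (x ⊗ₜ y))))) = _
  rw [show P (C (x ⊗ₜ y)) = (β b c⁻¹ : ℂ) • x ⊗ₜ y from hP, map_smul, map_smul, hQ']
  simp [smul_smul, mul_comm]

lemma IsHomogeneous.bigradedScale (hx : IsHomogeneous π a b x)
    (f : PontryaginDual T → PontryaginDual T → ℂ) :
    bigradedScale π f x = f a b • x := by
  let P : H ⊗[ℂ] (H ⊗[ℂ] H) →ₗ[ℂ] H := (TensorProduct.rid ℂ H).toLinearMap ∘ₗ
    TensorProduct.map .id (linExt₂ f ∘ₗ TensorProduct.map (π : H →ₗ[ℂ] Pol T) π) ∘ₗ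
    (TensorProduct.leftComm ℂ H H H).toLinearMap
  refine (isBigraded π).comul_eq_left hx (F := P ∘ₗ TensorProduct.map .id Coalgebra.comul)
    (g := f a b • .id) fun c y z hy hz => ?_
  refine (isBigraded π).comul_eq_right hz (F := P ∘ₗ TensorProduct.mk ℂ _ _ y)
    (g := Coalgebra.counit (R := ℂ) y • f a b • .id) fun d z₁ z₂ hz₁ hz₂ => ?_
  simp [P, hy.apply_left, hz₂.apply_right, smul_smul]
  ring_nf

lemma IsHomogeneous.transAntipode (hx : IsHomogeneous π a b x) :
    transAntipode (bicharForm β) (π : H →ₗ[ℂ] Pol T) x =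
      (β (b * a⁻¹) b : ℂ) • HopfAlgebra.antipode ℂ x := by
  let S : H →ₗ[ℂ] H := HopfAlgebra.antipode ℂ
  let P : H ⊗[ℂ] (H ⊗[ℂ] (H ⊗[ℂ] H)) →ₗ[ℂ] H := (TensorProduct.rid ℂ H).toLinearMap ∘ₗ
    TensorProduct.map S (bicharForm β ∘ₗ
        TensorProduct.map ((π : H →ₗ[ℂ] Pol T) ∘ₗ LinearMap.mul' ℂ H ∘ₗ
            TensorProduct.map (S ∘ₗ S) S ∘ₗ (TensorProduct.comm ℂ H H).toLinearMap) π ∘ₗ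
        (TensorProduct.assoc ℂ H H H).symm.toLinearMap) ∘ₗ
    (TensorProduct.leftComm ℂ H H (H ⊗[ℂ] H)).toLinearMap
  refine (isBigraded π).comul_eq_left hx (F := P ∘ₗ TensorProduct.map .id (comul3 H))
    (g := (β (b * a⁻¹) b : ℂ) • S) fun c y z hy hz => ?_
  refine (isBigraded π).comul_eq_right hz
    (F := P ∘ₗ TensorProduct.mk ℂ _ _ y ∘ₗ TensorProduct.map .id Coalgebra.comul)
    (g := Coalgebra.counit (R := ℂ) y • (β (b * a⁻¹) b : ℂ) • S) fun d z₁ z₂ hz₁ hz₂ => ?_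
  refine (isBigraded π).comul_eq_right hz₂
    (F := P ∘ₗ TensorProduct.mk ℂ _ _ y ∘ₗ TensorProduct.mk ℂ _ _ z₁)
    (g := Coalgebra.counit (R := ℂ).smulRight (Coalgebra.counit (R := ℂ) y •
      (β (b * a⁻¹) b : ℂ) • S z₁)) fun e w₁ w₂ hw₁ hw₂ => ?_
  have h1 := hw₁.antipode.apply_antipode
  have h2 := hy.apply_antipode
  -- If `e ≠ b`, then `π(w₂) = 0`; otherwise the values of `β` do not depend on `e`.
  by_cases heb : e = b
  · subst heb
    simp [P, S, h1, h2, hw₂.apply_right, bicharForm_single, smul_smul]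
    ring_nf
  · simp [P, hw₂.apply_right, hw₂.counit_eq_zero heb]

lemma IsHomogeneous.transStar [StarRing H] [StarModule ℂ H] (hx : IsHomogeneous π a b x) :
    transStar π β x = (β (a⁻¹ * b) a⁻¹ : ℂ) • Star.star x := by
  simp [CocycleTwist.transStar, hx.bigradedScale]

end Transmutation

section Transmutation

/-! ### The transmutation as a braided Hopf `*`-algebra -/

variable {T : Type*} [CommGroup T] [TopologicalSpace T]
  {H : Type*} [Ring H] [HopfAlgebra ℂ H] [StarRing H] [StarModule ℂ H] {π : H →ₐc[ℂ] Pol T}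
  {β : PontryaginDual T →* PontryaginDual T →* Circle} {T₀ : Subgroup T}
  {a b c d : PontryaginDual T} {x y : H}

/-- All operations of the transmutation are multiples of those of `H` on homogeneous elements, so
every axiom follows from the one for `H` and an identity between values of `β`. -/
lemma isBraidedHopfStar_transmutation
    (hH : ∀ x : H, Coalgebra.comul (R := ℂ) (star x) = star (Coalgebra.comul (R := ℂ) x))
    (hπ : ∀ x : H, π (star x) = star (π x)) (hcoc : IsCocentral π T₀) :
    (transmutation π β T₀).IsBraidedHopfStar (HopfStarOps.ofHopf (Pol (T ⧸ T₀)))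
      (quotForm β T₀) := by
  have hb := isBigraded_coHomogeneous hcoc
  have hc : ∀ {a b x n}, IsHomogeneous π a b x → dualQuot T₀ n = a⁻¹ * b →
      (transmutation π β T₀).coact x = x ⊗ₜ MonoidAlgebra.single n 1 :=
    fun hx hn => quotCoact_apply hcoc hx hn
  have hm : ∀ {a b c d x y}, IsHomogeneous π a b x → IsHomogeneous π c d y →
      (transmutation π β T₀).mul x y = (β (a * b⁻¹) c : ℂ) • (x * y) :=
    fun hx hy => hx.transMul hy
  have hs : ∀ {a b x}, IsHomogeneous π a b x →
      (transmutation π β T₀).star x = (β (a⁻¹ * b) a⁻¹ : ℂ) • star x := fun hx => hx.transStar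
  have hS : ∀ {a b x}, IsHomogeneous π a b x →
      (transmutation π β T₀).antipode x = (β (b * a⁻¹) b : ℂ) • HopfAlgebra.antipode ℂ x :=
    fun hx => hx.transAntipode
  have hO := isHopfStar_ofHopf hH
  have hΔ : (transmutation π β T₀).comul = Coalgebra.comul := rfl
  have hε : (transmutation π β T₀).counit = Coalgebra.counit := rfl
  have h1 : (transmutation π β T₀).one = 1 := rfl
  generalize hB : transmutation π β T₀ = B at *
  constructor
  case coact_coassoc =>
    refine hb.ext (f := (TensorProduct.assoc ℂ _ _ _).toLinearMap ∘ₗ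
      TensorProduct.map B.coact .id ∘ₗ B.coact) (g := TensorProduct.map .id _ ∘ₗ B.coact) ?_
    rintro a b x ⟨hx, n, hn⟩
    simp [hc hx hn, HopfStarOps.ofHopf]
  case coact_counit =>
    refine hb.ext (f := TensorProduct.map .id _ ∘ₗ B.coact)
      (g := (TensorProduct.mk ℂ _ _).flip 1) ?_
    rintro a b x ⟨hx, n, hn⟩
    simp [hc hx hn, HopfStarOps.ofHopf]
  case mul_assoc =>
    intro x y z
    refine hb.ext (f := B.mul.flip z ∘ₗ B.mul.flip y) (g := B.mul.flip (B.mul y z))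
      (fun a b x hx => ?_) x
    refine hb.ext (f := B.mul.flip z ∘ₗ B.mul x) (g := B.mul x ∘ₗ B.mul.flip z)
      (fun c d y hy => ?_) y
    refine hb.ext (f := B.mul (B.mul x y)) (g := B.mul x ∘ₗ B.mul y) (fun e f z hz => ?_) z
    simp [hm hx.1 hy.1, hm hy.1 hz.1, hm (hx.1.mul hy.1) hz.1, hm hx.1 (hy.1.mul hz.1), smul_smul,
      _root_.mul_assoc]
    field_simp
  case one_mul =>
    refine hb.ext (f := B.mul B.one) (g := .id) fun a b x hx => ?_
    simp [h1, hm isHomogeneous_one hx.1]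
  case mul_one =>
    refine hb.ext (f := B.mul.flip B.one) (g := .id) fun a b x hx => ?_
    simp [h1, hm hx.1 isHomogeneous_one]
  case star_star =>
    refine hb.ext (f := B.star.comp B.star) (g := .id) fun a b x hx => ?_
    simp [hs hx.1, hs (hx.1.star hH hπ), smul_smul, ← Circle.coe_inv_eq_conj]
    field_simp
    exact one_smul ℂ x
  case star_mul =>
    intro x y
    refine hb.ext (f := B.star.comp (B.mul.flip y)) (g := (B.mul (B.star y)).comp B.star)
      (fun a b x hx => ?_) x
    refine hb.ext (f := B.star.comp (B.mul x)) (g := (B.mul.flip (B.star x)).comp B.star)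
      (fun c d y hy => ?_) y
    simp [hm hx.1 hy.1, hs hx.1, hs hy.1, hs (hx.1.mul hy.1),
      hm (hy.1.star hH hπ) (hx.1.star hH hπ), smul_smul, ← Circle.coe_inv_eq_conj]
    congr 1
    field_simp
  case coact_mul =>
    refine hb.ext₂ (B := B.mul.compr₂ B.coact)
      (B' := (TensorProduct.map₂ B.mul _).compl₁₂ B.coact B.coact) ?_
    rintro a b c d x y ⟨hx, n, hn⟩ ⟨hy, m, hm'⟩
    have hnm : dualQuot T₀ (n * m) = (a * c)⁻¹ * (b * d) := by
      rw [map_mul, hn, hm', mul_inv, mul_mul_mul_comm]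
    simp [hm hx hy, hc hx hn, hc hy hm', hc (hx.mul hy) hnm, HopfStarOps.ofHopf,
      MonoidAlgebra.single_mul_single, TensorProduct.smul_tmul']
  case coact_one =>
    rw [h1, hc isHomogeneous_one (n := 1) (by simp)]
    rfl
  case coact_star =>
    refine hb.ext (f := B.coact.comp B.star)
      (g := (TensorProduct.map B.star _).comp B.coact) ?_
    rintro a b x ⟨hx, n, hn⟩
    have hn' : dualQuot T₀ n⁻¹ = a⁻¹⁻¹ * b⁻¹ := by
      rw [map_inv, hn, mul_inv]
    simp [hs hx, hc hx hn, hc (hx.star hH hπ) hn', HopfStarOps.ofHopf, star_single,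
      TensorProduct.smul_tmul']
  case coassoc => rw [hΔ]; exact hO.coassoc
  case counit_comul => rw [hΔ, hε]; exact hO.counit_comul
  case comul_counit => rw [hΔ, hε]; exact hO.comul_counit
  case coact_comul =>
    refine hb.ext (f := B.coact₂ _ ∘ₗ B.comul)
      (g := TensorProduct.map B.comul .id ∘ₗ B.coact) ?_
    rintro a b x ⟨hx, n, hn⟩
    rw [LinearMap.comp_apply, LinearMap.comp_apply, hc hx hn, TensorProduct.map_tmul, hΔ]
    refine hb.comul_ext ⟨hx, n, hn⟩ (F := B.coact₂ _) (G := (TensorProduct.mk ℂ _ _).flip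
      (MonoidAlgebra.single n 1)) ?_
    rintro c y z ⟨hy, m, hm⟩ ⟨hz, l, hl⟩
    have hml : n = m * l := dualQuot_injective T₀ (by rw [map_mul, hn, hm, hl]; group)
    simp [BraidedOps.coact₂, hc hy hm, hc hz hl, HopfStarOps.mulT, HopfStarOps.ofHopf,
      MonoidAlgebra.single_mul_single, hml]
  case coact_counit' =>
    refine hb.ext (f := TensorProduct.map B.counit .id ∘ₗ B.coact)
      (g := (TensorProduct.mk ℂ _ _).flip _ ∘ₗ B.counit) ?_
    rintro a b x ⟨hx, n, hn⟩
    by_cases hab : a = b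
    · have : n = 1 := dualQuot_injective T₀ (by simp [hn, hab])
      simp [hc hx hn, this, HopfStarOps.ofHopf, MonoidAlgebra.one_def]
    · simp [hc hx hn, hε, hx.counit_eq_zero hab]
  case coact_antipode =>
    refine hb.ext (f := B.coact ∘ₗ B.antipode)
      (g := TensorProduct.map B.antipode .id ∘ₗ B.coact) ?_
    rintro a b x ⟨hx, n, hn⟩
    have hn' : dualQuot T₀ n = b⁻¹⁻¹ * a⁻¹ := by rw [hn, inv_inv, mul_comm]
    simp [hc hx hn, hS hx, hc hx.antipode hn', TensorProduct.smul_tmul']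
  case comul_mul =>
    refine hb.ext₂ (B := B.mul.compr₂ B.comul)
      (B' := (braidedMul _ B.mul B.coact B.mul B.coact).compl₁₂ B.comul B.comul) ?_
    rintro a b c d x y hx hy
    simp only [LinearMap.compr₂_apply, LinearMap.compl₁₂_apply, hm hx.1 hy.1, map_smul, hΔ]
    refine (congrArg _ (hO.comul_mul x y)).trans ?_
    refine hb.comul_ext₂ hx hy
      (B := (β (a * b⁻¹) c : ℂ) • TensorProduct.map₂ (LinearMap.mul ℂ H) (LinearMap.mul ℂ H))
      (B' := braidedMul _ B.mul B.coact B.mul B.coact) ?_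
    rintro e f x₁ x₂ y₁ y₂ ⟨hx₁, -⟩ ⟨hx₂, n, hn⟩ ⟨hy₁, m, hm'⟩ ⟨hy₂, -⟩
    rw [braidedMul_tmul (hc hx₂ hn) (hc hy₁ hm'), quotForm_single, hn, hm', hm hx₁ hy₁, hm hx₂ hy₂]
    simp [TensorProduct.smul_tmul', TensorProduct.tmul_smul, smul_smul]
    congr 2
    field_simp
  case comul_one => rw [hΔ, h1]; exact hO.comul_one
  case comul_star =>
    refine hb.ext (f := B.comul.comp B.star)
      (g := (braidedStar _ B.star B.coact B.star B.coact).comp B.comul) ?_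
    rintro a b x hx
    simp only [LinearMap.comp_apply, hs hx.1, map_smul, hΔ]
    refine (congrArg _ (hO.comul_star x)).trans ?_
    refine hb.comul_ext hx
      (F := (β (a⁻¹ * b) a⁻¹ : ℂ) • TensorProduct.map (starLinearEquiv ℂ : H ≃ₗ⋆[ℂ] H).toLinearMap
        (starLinearEquiv ℂ : H ≃ₗ⋆[ℂ] H).toLinearMap)
      (G := braidedStar _ B.star B.coact B.star B.coact) ?_
    rintro c y z ⟨hy, n, hn⟩ ⟨hz, m, hm⟩
    have hn' : dualQuot T₀ n⁻¹ = a⁻¹⁻¹ * c⁻¹ := by rw [map_inv, hn, mul_inv]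
    have hm' : dualQuot T₀ m⁻¹ = c⁻¹⁻¹ * b⁻¹ := by rw [map_inv, hm, mul_inv]
    have e1 : B.coact (B.star y) = B.star y ⊗ₜ MonoidAlgebra.single n⁻¹ 1 := by
      simp [hs hy, hc (hy.star hH hπ) hn', TensorProduct.smul_tmul']
    have e2 : B.coact (B.star z) = B.star z ⊗ₜ MonoidAlgebra.single m⁻¹ 1 := by
      simp [hs hz, hc (hz.star hH hπ) hm', TensorProduct.smul_tmul']
    rw [braidedStar_tmul e2 e1, quotForm_single, hn', hm', hs hy, hs hz]
    simp [TensorProduct.smul_tmul', TensorProduct.tmul_smul, smul_smul]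
    congr 2
    field_simp
  case counit_mul =>
    refine hb.ext₂ (B := B.mul.compr₂ B.counit)
      (B' := (LinearMap.mul ℂ ℂ).compl₁₂ B.counit B.counit) ?_
    rintro a b c d x y hx hy
    by_cases hab : a = b
    · simp [hm hx.1 hy.1, hε, hab]
    · simp [hm hx.1 hy.1, hε, hb.counit_eq_zero hx hab]
  case counit_one => rw [hε, h1]; exact hO.counit_one
  case counit_star =>
    refine hb.ext (f := B.counit.comp B.star)
      (g := (starLinearEquiv ℂ : ℂ ≃ₗ⋆[ℂ] ℂ).toLinearMap.comp B.counit) ?_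
    rintro a b x hx
    by_cases hab : a = b
    · simp [hs hx.1, hε, hab, counit_star_of_comul_star hH]
    · simp [hs hx.1, hε, counit_star_of_comul_star hH, hb.counit_eq_zero hx hab]
  case antipode_left =>
    refine hb.ext (f := B.mulT ∘ₗ TensorProduct.map B.antipode .id ∘ₗ B.comul)
      (g := B.counit.smulRight B.one) ?_
    rintro a b x hx
    refine Eq.trans ?_ ((hO.antipode_left x).trans (by simp [h1, hε, HopfStarOps.ofHopf]))
    simp only [LinearMap.comp_apply, hΔ]
    refine hb.comul_ext hx (F := B.mulT ∘ₗ TensorProduct.map B.antipode .id)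
      (G := LinearMap.mul' ℂ H ∘ₗ TensorProduct.map (HopfAlgebra.antipode ℂ) .id) ?_
    rintro c y z ⟨hy, -⟩ ⟨hz, -⟩
    simp [HopfStarOps.mulT, hS hy, hm hy.antipode hz, smul_smul]
    field_simp
    exact one_smul ℂ _
  case antipode_right =>
    refine hb.ext (f := B.mulT ∘ₗ TensorProduct.map .id B.antipode ∘ₗ B.comul)
      (g := B.counit.smulRight B.one) ?_
    rintro a b x hx
    -- The factor is not `1` when `a ≠ b`, in which case both sides vanish.
    have e : (β (b * a⁻¹) b : ℂ) * Coalgebra.counit (R := ℂ) x = Coalgebra.counit (R := ℂ) x := by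
      by_cases hab : a = b
      · simp [hab]
      · simp [hb.counit_eq_zero hx hab]
    refine Eq.trans ?_ ((congrArg ((β (b * a⁻¹) b : ℂ) • ·) (hO.antipode_right x)).trans
      (by simp [h1, hε, HopfStarOps.ofHopf, smul_smul, -map_mul, -map_inv, e]))
    simp only [LinearMap.comp_apply, hΔ]
    refine hb.comul_ext hx (F := B.mulT ∘ₗ TensorProduct.map .id B.antipode)
      (G := (β (b * a⁻¹) b : ℂ) • LinearMap.mul' ℂ H ∘ₗ
        TensorProduct.map .id (HopfAlgebra.antipode ℂ)) ?_
    rintro c y z ⟨hy, -⟩ ⟨hz, -⟩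
    simp [HopfStarOps.mulT, hS hz, hm hy hz.antipode, smul_smul]
    congr 1
    field_simp

end Transmutation

section Bosonization

/-! ### Bosonization over a group algebra -/

variable {N : Type*} [CommGroup N] {A : Type*} [AddCommGroup A] [Module ℂ A]
  {R : MonoidAlgebra ℂ N ⊗[ℂ] MonoidAlgebra ℂ N →ₗ[ℂ] ℂ} {B : BraidedOps (MonoidAlgebra ℂ N) A}

open BraidedOps

lemma bosonization_mul {x : A} {n : N} (hx : B.coact x = x ⊗ₜ MonoidAlgebra.single n 1)
    (g h : N) (y : A) :
    (B.bosonization (.ofHopf _) R).mul (MonoidAlgebra.single g 1 ⊗ₜ x)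
      (MonoidAlgebra.single h 1 ⊗ₜ y) = R (MonoidAlgebra.single n 1 ⊗ₜ MonoidAlgebra.single h 1) •
        MonoidAlgebra.single (g * h) 1 ⊗ₜ B.mul x y := by
  refine (braidedMul_tmul hx (l := MonoidAlgebra.single h 1) ?_).trans ?_ <;>
    simp [HopfStarOps.ofHopf, MonoidAlgebra.single_mul_single]

lemma bosonization_star {x : A} {n : N}
    (hx : B.coact (B.star x) = B.star x ⊗ₜ MonoidAlgebra.single n 1) (h : N) :
    (B.bosonization (.ofHopf _) R).star (MonoidAlgebra.single h 1 ⊗ₜ x) =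
      R (MonoidAlgebra.single n 1 ⊗ₜ MonoidAlgebra.single h⁻¹ 1) •
        MonoidAlgebra.single h⁻¹ 1 ⊗ₜ B.star x := by
  refine (braidedStar_tmul hx (l := MonoidAlgebra.single h⁻¹ 1) ?_).trans ?_ <;>
    simp [HopfStarOps.ofHopf, star_single]

lemma bosonization_antipode {x : A} {n m : N} (hx : B.coact x = x ⊗ₜ MonoidAlgebra.single n 1)
    (hS : B.coact (B.antipode x) = B.antipode x ⊗ₜ MonoidAlgebra.single m 1)
    (h1 : ∀ x, B.mul x B.one = x) (h : N) :
    (B.bosonization (.ofHopf _) R).antipode (MonoidAlgebra.single h 1 ⊗ₜ x) =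
      R (MonoidAlgebra.single m 1 ⊗ₜ MonoidAlgebra.single (h * n)⁻¹ 1) •
        MonoidAlgebra.single (h * n)⁻¹ 1 ⊗ₜ B.antipode x := by
  have e := bosonization_mul (R := R) hS 1 (h * n)⁻¹ B.one
  rw [one_mul, h1] at e
  refine Eq.trans ?_ e
  simp [bosonization, hx, HopfStarOps.mulT, HopfStarOps.ofHopf, MonoidAlgebra.single_mul_single,
    MonoidAlgebra.one_def]

/-- The map `y ⊗ z ↦ (h # y⁽¹⁾) ⊗ (h y⁽²⁾ # z)`, in terms of which the coproduct of the
bosonization is expressed. -/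
def bosonizationSplit (B : BraidedOps (MonoidAlgebra ℂ N) A) (h : N) :
    A ⊗[ℂ] A →ₗ[ℂ] (MonoidAlgebra ℂ N ⊗[ℂ] A) ⊗[ℂ] (MonoidAlgebra ℂ N ⊗[ℂ] A) :=
  TensorProduct.map .id (TensorProduct.map (LinearMap.mulLeft ℂ (MonoidAlgebra.single h 1)) .id) ∘ₗ
    (TensorProduct.assoc ℂ (MonoidAlgebra ℂ N ⊗[ℂ] A) (MonoidAlgebra ℂ N) A).toLinearMap ∘ₗ
    TensorProduct.map ((TensorProduct.assoc ℂ _ _ _).symm.toLinearMap ∘ₗ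
      TensorProduct.mk ℂ _ _ (MonoidAlgebra.single h 1) ∘ₗ B.coact) .id

lemma bosonizationSplit_tmul {y z : A} {n : N} (hy : B.coact y = y ⊗ₜ MonoidAlgebra.single n 1)
    (h : N) : bosonizationSplit B h (y ⊗ₜ z) =
      (MonoidAlgebra.single h 1 ⊗ₜ y) ⊗ₜ (MonoidAlgebra.single (h * n) 1 ⊗ₜ z) := by
  simp [bosonizationSplit, hy, MonoidAlgebra.single_mul_single]

lemma bosonization_comul (h : N) (x : A) :
    (B.bosonization (.ofHopf _) R).comul (MonoidAlgebra.single h 1 ⊗ₜ x) =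
      bosonizationSplit B h (B.comul x) := by
  simp only [bosonization, HopfStarOps.ofHopf, LinearMap.comp_apply, TensorProduct.map_tmul]
  generalize B.comul x = t
  induction t with
  | zero => simp
  | add _ _ h₁ h₂ => simp only [map_add, TensorProduct.tmul_add, h₁, h₂]
  | tmul y z =>
    simp only [MonoidAlgebra.comul_single, bosonizationSplit, LinearMap.comp_apply,
      TensorProduct.map_tmul]
    simp
    generalize B.coact y = s
    induction s with
    | zero => simp
    | add _ _ h₁ h₂ => simp only [map_add, TensorProduct.tmul_add, TensorProduct.add_tmul, h₁, h₂]
    | tmul y k => simp [HopfStarOps.mulT, mul_comm]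

lemma bosonization_counit (h : N) (x : A) :
    (B.bosonization (.ofHopf _) R).counit (MonoidAlgebra.single h 1 ⊗ₜ x) = B.counit x := by
  simp [bosonization, HopfStarOps.ofHopf]

end Bosonization

/-! ### Tensor products with a group algebra -/

section Spanning

variable {N : Type*} {A : Type*} [AddCommGroup A] [Module ℂ A]

lemma span_single_tmul_eq_top {S : Set A} (hS : Submodule.span ℂ S = ⊤) :
    Submodule.span ℂ {t | ∃ h : N, ∃ x ∈ S, t = MonoidAlgebra.single h (1 : ℂ) ⊗ₜ[ℂ] x} = ⊤ := by
  rw [eq_top_iff, ← TensorProduct.map₂_mk_top_top_eq_top, ← span_single_eq_top, ← hS,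
    Submodule.map₂_span_span]
  refine Submodule.span_mono ?_
  rintro _ ⟨_, ⟨h, rfl⟩, x, hx, rfl⟩
  exact ⟨h, x, hx, rfl⟩

end Spanning

section TensorHopf

lemma comul_star_groupAlgebra {G : Type*} [CommGroup G] (x : MonoidAlgebra ℂ G) :
    Coalgebra.comul (R := ℂ) (star x) = star (Coalgebra.comul (R := ℂ) x) := by
  induction x using MonoidAlgebra.induction_linear with
  | zero => simp
  | add x y hx hy => simp [hx, hy]
  | single a r => simp [star_single]

variable {A B : Type*} [Ring A] [HopfAlgebra ℂ A] [StarRing A] [StarModule ℂ A]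
  [Ring B] [HopfAlgebra ℂ B] [StarRing B] [StarModule ℂ B]

lemma comul_star_tensor
    (hA : ∀ x : A, Coalgebra.comul (R := ℂ) (star x) = star (Coalgebra.comul (R := ℂ) x))
    (hB : ∀ x : B, Coalgebra.comul (R := ℂ) (star x) = star (Coalgebra.comul (R := ℂ) x))
    (t : A ⊗[ℂ] B) :
    Coalgebra.comul (R := ℂ) (star t) = star (Coalgebra.comul (R := ℂ) t) := by
  induction t with
  | zero => simp
  | add _ _ h₁ h₂ => simp [h₁, h₂]
  | tmul x y =>
    rw [TensorProduct.star_tmul, TensorProduct.comul_tmul, TensorProduct.comul_tmul, hA, hB]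
    generalize Coalgebra.comul (R := ℂ) x = s
    generalize Coalgebra.comul (R := ℂ) y = t
    induction s with
    | zero => simp
    | add _ _ h₁ h₂ => simp only [star_add, TensorProduct.add_tmul, map_add, h₁, h₂]
    | tmul _ _ =>
      induction t with
      | zero => simp
      | add _ _ h₁ h₂ => simp only [star_add, TensorProduct.tmul_add, map_add, h₁, h₂]
      | tmul _ _ => simp

end TensorHopf

section Semidirect

/-! ### The semidirect product and the coinvariants -/

variable {T : Type*} [CommGroup T] [TopologicalSpace T]
  {H : Type*} [Ring H] [HopfAlgebra ℂ H] {π : H →ₐc[ℂ] Pol T} {T₀ : Subgroup T}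
  {a b : PontryaginDual T} {x : H} {n : PontryaginDual (T ⧸ T₀)}

lemma thetaMap_tmul (hx : IsHomogeneous π a b x) (g : PontryaginDual T) :
    thetaMap π (MonoidAlgebra.single g 1 ⊗ₜ x) = MonoidAlgebra.single (g * a) 1 ⊗ₜ x := by
  refine (isBigraded π).comul_eq_left hx (F := TensorProduct.map (LinearMap.mul' ℂ (Pol T) ∘ₗ
    TensorProduct.map .id (π : H →ₗ[ℂ] Pol T)) .id ∘ₗ
    (TensorProduct.assoc ℂ (Pol T) H H).symm.toLinearMap ∘ₗ
    TensorProduct.mk ℂ _ _ (MonoidAlgebra.single g 1))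
    (g := TensorProduct.mk ℂ _ _ (MonoidAlgebra.single (g * a) 1)) fun c y z hy hz => ?_
  simp [hy.apply_left, MonoidAlgebra.single_mul_single, MonoidAlgebra.smul_single,
    TensorProduct.smul_tmul']

variable (π T₀) in
/-- The map `ℂ[T/T₀] ⊗ H → ℂ[T] ⊗ H`, `h ⊗ x ↦ h S(π(x₍₁₎)) ⊗ x₍₂₎`. It is a right inverse
of `a ⊗ x ↦ a π(x₍₁₎) ⊗ x₍₂₎`. -/
def coinvEmbed : Pol (T ⧸ T₀) ⊗[ℂ] H →ₗ[ℂ] Pol T ⊗[ℂ] H :=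
  TensorProduct.map (LinearMap.mul' ℂ (Pol T) ∘ₗ
    TensorProduct.map .id (HopfAlgebra.antipode ℂ ∘ₗ (π : H →ₗ[ℂ] Pol T))) .id ∘ₗ
  (TensorProduct.assoc ℂ (Pol T) H H).symm.toLinearMap ∘ₗ
  TensorProduct.map (quotMap T₀ : Pol (T ⧸ T₀) →ₗ[ℂ] Pol T) Coalgebra.comul

lemma coinvEmbed_tmul (hx : IsHomogeneous π a b x) (h : PontryaginDual (T ⧸ T₀)) :
    coinvEmbed π T₀ (MonoidAlgebra.single h 1 ⊗ₜ x) =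
      MonoidAlgebra.single (dualQuot T₀ h * a⁻¹) 1 ⊗ₜ x := by
  refine (isBigraded π).comul_eq_left hx (F := TensorProduct.map (LinearMap.mul' ℂ (Pol T) ∘ₗ
    TensorProduct.map .id (HopfAlgebra.antipode ℂ ∘ₗ (π : H →ₗ[ℂ] Pol T))) .id ∘ₗ
    (TensorProduct.assoc ℂ (Pol T) H H).symm.toLinearMap ∘ₗ
    TensorProduct.mk ℂ _ _ (quotMap T₀ (MonoidAlgebra.single h 1)))
    (g := TensorProduct.mk ℂ _ _ (MonoidAlgebra.single (dualQuot T₀ h * a⁻¹) 1))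
    fun c y z hy hz => ?_
  simp [hy.apply_left, MonoidAlgebra.single_mul_single, MonoidAlgebra.smul_single,
    TensorProduct.smul_tmul']

variable (π T₀) in
/-- The elements `h ⊗ x` with `x` homogeneous. They span `ℂ[T/T₀] ⊗ H`. -/
def IsPure (t : Pol (T ⧸ T₀) ⊗[ℂ] H) : Prop :=
  ∃ h a b x, IsCoHomogeneous π T₀ a b x ∧ t = MonoidAlgebra.single h 1 ⊗ₜ x

lemma span_isPure (hcoc : IsCocentral π T₀) :
    Submodule.span ℂ {t | IsPure π T₀ t} = ⊤ := by
  rw [← span_single_tmul_eq_top (isBigraded_coHomogeneous hcoc).span_eq_top]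
  congr 1
  ext t
  constructor
  · rintro ⟨h, a, b, x, hx, rfl⟩
    exact ⟨h, x, ⟨a, b, hx⟩, rfl⟩
  · rintro ⟨h, x, ⟨a, b, hx⟩, rfl⟩
    exact ⟨h, a, b, x, hx, rfl⟩

lemma thetaMap_coinvEmbed (hcoc : IsCocentral π T₀) (t : Pol (T ⧸ T₀) ⊗[ℂ] H) :
    thetaMap π (coinvEmbed π T₀ t) =
      TensorProduct.map (quotMap T₀ : Pol (T ⧸ T₀) →ₗ[ℂ] Pol T) .id t := by
  refine ext_of_span_eq_top (span_isPure hcoc) (f := thetaMap π ∘ₗ coinvEmbed π T₀) ?_ t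
  rintro _ ⟨h, a, b, x, hx, rfl⟩
  simp [coinvEmbed_tmul hx.1, thetaMap_tmul hx.1]

lemma coinvEmbed_injective (hcoc : IsCocentral π T₀) : Function.Injective (coinvEmbed π T₀) := by
  refine Function.Injective.of_comp (f := thetaMap π) ?_
  rw [funext (thetaMap_coinvEmbed hcoc) (f := thetaMap π ∘ coinvEmbed π T₀)]
  exact tensorMap_injective (quotMap_injective T₀) Function.injective_id

variable (π T₀) in
/-- The coaction of `ℂ[T₀]` on `ℂ[T] ⊗ H` of which `coinvariants π T₀` are the coinvariants. -/
def diagCoact : Pol T ⊗[ℂ] H →ₗ[ℂ] (Pol T ⊗[ℂ] H) ⊗[ℂ] Pol T₀ :=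
  TensorProduct.map .id (LinearMap.mul' ℂ (Pol T₀) ∘ₗ
    TensorProduct.map (resMap T₀ : Pol T →ₗ[ℂ] Pol T₀)
      ((resMap T₀ : Pol T →ₗ[ℂ] Pol T₀) ∘ₗ (π : H →ₗ[ℂ] Pol T))) ∘ₗ Coalgebra.comul

lemma diagCoact_tmul (hx : IsHomogeneous π a b x) (g : PontryaginDual T) :
    diagCoact π T₀ (MonoidAlgebra.single g 1 ⊗ₜ x) =
      (MonoidAlgebra.single g 1 ⊗ₜ x) ⊗ₜ MonoidAlgebra.single (dualRes T₀ (g * b)) 1 := by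
  simp only [diagCoact, LinearMap.comp_apply, TensorProduct.comul_tmul, MonoidAlgebra.comul_single]
  refine (isBigraded π).comul_eq_right (W := (Pol T ⊗[ℂ] H) ⊗[ℂ] Pol T₀) hx
    (F := TensorProduct.map .id (LinearMap.mul' ℂ (Pol T₀) ∘ₗ
    TensorProduct.map (resMap T₀ : Pol T →ₗ[ℂ] Pol T₀)
      ((resMap T₀ : Pol T →ₗ[ℂ] Pol T₀) ∘ₗ (π : H →ₗ[ℂ] Pol T))) ∘ₗ
      (TensorProduct.AlgebraTensorModule.tensorTensorTensorComm ℂ ℂ ℂ ℂ _ _ _ _).toLinearMap ∘ₗ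
      TensorProduct.mk ℂ _ _ _)
    (g := (TensorProduct.mk ℂ (Pol T ⊗[ℂ] H) (Pol T₀)).flip
      (MonoidAlgebra.single (dualRes T₀ (g * b)) (1 : ℂ)) ∘ₗ
      TensorProduct.mk ℂ _ _ (MonoidAlgebra.single g (1 : ℂ))) fun c y z hy hz => ?_
  simp [hz.apply_right, MonoidAlgebra.single_mul_single, ← TensorProduct.tmul_smul,
    MonoidAlgebra.smul_single]

variable [StarRing H] [StarModule ℂ H]

lemma counit₂_single (n m : PontryaginDual (T ⧸ T₀)) :
    (HopfStarOps.ofHopf (Pol (T ⧸ T₀))).counit₂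
      (MonoidAlgebra.single n 1 ⊗ₜ MonoidAlgebra.single m 1) = 1 := by
  simp [HopfStarOps.counit₂, HopfStarOps.ofHopf]

lemma untwisted_coact (hcoc : IsCocentral π T₀) (hx : IsHomogeneous π a b x)
    (hn : dualQuot T₀ n = a⁻¹ * b) :
    (untwisted π T₀).coact x = x ⊗ₜ MonoidAlgebra.single n 1 :=
  quotCoact_apply hcoc hx hn

lemma semidirect_mul (hcoc : IsCocentral π T₀) (hx : IsCoHomogeneous π T₀ a b x)
    (g h : PontryaginDual (T ⧸ T₀)) (y : H) :
    (semidirect π T₀).mul (MonoidAlgebra.single g 1 ⊗ₜ x) (MonoidAlgebra.single h 1 ⊗ₜ y) =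
      MonoidAlgebra.single (g * h) 1 ⊗ₜ (x * y) := by
  obtain ⟨hx, n, hn⟩ := hx
  rw [semidirect, bosonization_mul (untwisted_coact hcoc hx hn), counit₂_single, one_smul]
  rfl

lemma semidirect_star
    (hH : ∀ x : H, Coalgebra.comul (R := ℂ) (star x) = star (Coalgebra.comul (R := ℂ) x))
    (hπ : ∀ x : H, π (star x) = star (π x)) (hcoc : IsCocentral π T₀)
    (hx : IsCoHomogeneous π T₀ a b x) (h : PontryaginDual (T ⧸ T₀)) :
    (semidirect π T₀).star (MonoidAlgebra.single h 1 ⊗ₜ x) =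
      MonoidAlgebra.single h⁻¹ 1 ⊗ₜ star x := by
  obtain ⟨hx, n, hn⟩ := hx
  rw [semidirect, bosonization_star (n := n⁻¹) (untwisted_coact hcoc (hx.star hH hπ)
    (by rw [map_inv, hn, mul_inv])), counit₂_single, one_smul]
  rfl

lemma semidirect_antipode (hcoc : IsCocentral π T₀) (hx : IsHomogeneous π a b x)
    (hn : dualQuot T₀ n = a⁻¹ * b) (h : PontryaginDual (T ⧸ T₀)) :
    (semidirect π T₀).antipode (MonoidAlgebra.single h 1 ⊗ₜ x) =
      MonoidAlgebra.single (h * n)⁻¹ 1 ⊗ₜ HopfAlgebra.antipode ℂ x := by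
  rw [semidirect, bosonization_antipode (m := n) (untwisted_coact hcoc hx hn)
    (untwisted_coact hcoc hx.antipode (by rw [hn, inv_inv, mul_comm])) (fun x => mul_one x),
    counit₂_single, one_smul]
  rfl

lemma semidirect_comul (h : PontryaginDual (T ⧸ T₀)) (x : H) :
    (semidirect π T₀).comul (MonoidAlgebra.single h 1 ⊗ₜ x) =
      bosonizationSplit (untwisted π T₀) h (Coalgebra.comul x) :=
  bosonization_comul h x

lemma semidirect_counit (h : PontryaginDual (T ⧸ T₀)) (x : H) :
    (semidirect π T₀).counit (MonoidAlgebra.single h 1 ⊗ₜ x) = Coalgebra.counit (R := ℂ) x :=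
  bosonization_counit h x

/-- The embedding straightens out the coaction in the operations of `ℂ[T/T₀] ⋉ H`. For example, the
coproduct of `h ⊗ x` consists of the tensors `(h ⊗ y) ⊗ (h n ⊗ z)` with `y ∈ H_{a,c}`,
`n = a⁻¹ c` and `z ∈ H_{c,b}`, and the images of both `h ⊗ y` and `h n ⊗ z` in `ℂ[T] ⊗ H`
have the first leg `h a⁻¹`. -/
lemma isHopfStarHom_coinvEmbed
    (hH : ∀ x : H, Coalgebra.comul (R := ℂ) (star x) = star (Coalgebra.comul (R := ℂ) x))
    (hπ : ∀ x : H, π (star x) = star (π x)) (hcoc : IsCocentral π T₀) :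
    (semidirect π T₀).IsHopfStarHom (HopfStarOps.ofHopf (Pol T ⊗[ℂ] H)) (coinvEmbed π T₀) where
  map_mul := by
    refine ext₂_of_span_eq_top (span_isPure hcoc) (span_isPure hcoc)
      (B := (semidirect π T₀).mul.compr₂ (coinvEmbed π T₀))
      (B' := (LinearMap.mul ℂ _).compl₁₂ (coinvEmbed π T₀) (coinvEmbed π T₀)) ?_
    rintro _ ⟨g, a, b, x, hx, rfl⟩ _ ⟨h, c, d, y, hy, rfl⟩
    simp [semidirect_mul hcoc hx, coinvEmbed_tmul hx.1, coinvEmbed_tmul hy.1,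
      coinvEmbed_tmul (hx.1.mul hy.1), MonoidAlgebra.single_mul_single]
    congr 2
    simp only [mul_comm, mul_assoc, mul_left_comm]
  map_one := by
    refine (coinvEmbed_tmul (isHomogeneous_one (π := π)) (1 : PontryaginDual (T ⧸ T₀))).trans ?_
    simp [HopfStarOps.ofHopf, Algebra.TensorProduct.one_def, MonoidAlgebra.one_def]
  map_comul := by
    refine ext_of_span_eq_top (V := (Pol T ⊗[ℂ] H) ⊗[ℂ] (Pol T ⊗[ℂ] H)) (span_isPure hcoc)
      (f := TensorProduct.map (coinvEmbed π T₀) (coinvEmbed π T₀) ∘ₗ (semidirect π T₀).comul)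
      (g := (HopfStarOps.ofHopf (Pol T ⊗[ℂ] H)).comul ∘ₗ coinvEmbed π T₀) ?_
    rintro _ ⟨h, a, b, x, hx, rfl⟩
    simp only [LinearMap.comp_apply, coinvEmbed_tmul hx.1, semidirect_comul, HopfStarOps.ofHopf,
      TensorProduct.comul_tmul, MonoidAlgebra.comul_single]
    refine (isBigraded_coHomogeneous hcoc).comul_ext
      (W := (Pol T ⊗[ℂ] H) ⊗[ℂ] (Pol T ⊗[ℂ] H)) hx
      (F := TensorProduct.map (coinvEmbed π T₀) (coinvEmbed π T₀) ∘ₗ bosonizationSplit _ h)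
      (G := (TensorProduct.AlgebraTensorModule.tensorTensorTensorComm ℂ ℂ ℂ ℂ _ _ _ _).toLinearMap
        ∘ₗ TensorProduct.mk ℂ _ _ _) ?_
    rintro c y z ⟨hy, n, hn⟩ ⟨hz, m, hm⟩
    simp [bosonizationSplit_tmul (untwisted_coact hcoc hy hn), coinvEmbed_tmul hy,
      coinvEmbed_tmul hz, hn]
    congr 3
    group
  map_counit := by
    refine ext_of_span_eq_top (span_isPure hcoc)
      (f := Coalgebra.counit ∘ₗ coinvEmbed π T₀) (g := (semidirect π T₀).counit) ?_
    rintro _ ⟨h, a, b, x, hx, rfl⟩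
    simp [coinvEmbed_tmul hx.1, semidirect_counit]
  map_antipode := by
    refine ext_of_span_eq_top (span_isPure hcoc)
      (f := coinvEmbed π T₀ ∘ₗ (semidirect π T₀).antipode)
      (g := HopfAlgebra.antipode ℂ ∘ₗ coinvEmbed π T₀) ?_
    rintro _ ⟨h, a, b, x, ⟨hx, n, hn⟩, rfl⟩
    simp [coinvEmbed_tmul hx, coinvEmbed_tmul hx.antipode, semidirect_antipode hcoc hx hn, hn]
    congr 2
    rw [mul_comm]
    group
  map_star := by
    refine ext_of_span_eq_top (span_isPure hcoc)
      (f := (coinvEmbed π T₀).comp (semidirect π T₀).star)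
      (g := (starLinearEquiv ℂ : _ ≃ₗ⋆[ℂ] Pol T ⊗[ℂ] H).toLinearMap.comp (coinvEmbed π T₀)) ?_
    rintro _ ⟨h, a, b, x, hx, rfl⟩
    simp [coinvEmbed_tmul hx.1, coinvEmbed_tmul (hx.1.star hH hπ), semidirect_star hH hπ hcoc hx,
      star_single, mul_comm]

lemma isHopfStar_semidirect
    (hH : ∀ x : H, Coalgebra.comul (R := ℂ) (star x) = star (Coalgebra.comul (R := ℂ) x))
    (hπ : ∀ x : H, π (star x) = star (π x)) (hcoc : IsCocentral π T₀) :
    (semidirect π T₀).IsHopfStar :=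
  (isHopfStar_ofHopf (comul_star_tensor comul_star_groupAlgebra hH)).of_injective
    (coinvEmbed_injective hcoc) (isHopfStarHom_coinvEmbed hH hπ hcoc)

lemma mem_coinvariants {z : Pol T ⊗[ℂ] H} : z ∈ coinvariants π T₀ ↔ diagCoact π T₀ z = z ⊗ₜ 1 :=
  Iff.rfl

/-- The element `g ⊗ x`, for `x ∈ H_{a,b}`, is coinvariant if and only if `g b` is trivial on `T₀`;
by cocentrality this means that `g = h a⁻¹` with `h` trivial on `T₀`. -/
lemma range_coinvEmbed (hcoc : IsCocentral π T₀) :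
    LinearMap.range (coinvEmbed π T₀) = coinvariants π T₀ := by
  classical
  have hspan := span_single_tmul_eq_top (N := PontryaginDual T)
    (isBigraded_coHomogeneous hcoc).span_eq_top
  apply le_antisymm
  · rintro _ ⟨t, rfl⟩
    rw [mem_coinvariants]
    refine ext_of_span_eq_top (V := (Pol T ⊗[ℂ] H) ⊗[ℂ] Pol T₀) (span_isPure hcoc)
      (f := diagCoact π T₀ ∘ₗ coinvEmbed π T₀)
      (g := (TensorProduct.mk ℂ (Pol T ⊗[ℂ] H) (Pol T₀)).flip 1 ∘ₗ coinvEmbed π T₀) ?_ t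
    rintro _ ⟨h, a, b, x, ⟨hx, n, hn⟩, rfl⟩
    have e : dualRes T₀ (dualQuot T₀ h * a⁻¹ * b) = 1 :=
      (dualRes_eq_one_iff T₀ _).2 ⟨h * n, by rw [map_mul, hn, mul_assoc]⟩
    simp only [LinearMap.comp_apply, coinvEmbed_tmul hx, diagCoact_tmul hx, e]
    rfl
  · -- The projection onto the coinvariants maps the spanning elements into the range.
    intro z hz
    let P : Pol T ⊗[ℂ] H →ₗ[ℂ] Pol T ⊗[ℂ] H := (TensorProduct.rid ℂ _).toLinearMap ∘ₗ
      TensorProduct.map .id (coeffAt 1) ∘ₗ diagCoact π T₀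
    have hP : P z = z := by
      simp [P, mem_coinvariants.1 hz, MonoidAlgebra.one_def, coeffAt_single]
    rw [← hP]
    clear hP hz
    have hz : z ∈ Submodule.span ℂ _ := hspan ▸ Submodule.mem_top (x := z)
    induction hz using Submodule.span_induction with
    | zero => rw [map_zero]; exact Submodule.zero_mem _
    | add _ _ _ _ h₁ h₂ => rw [map_add]; exact Submodule.add_mem _ h₁ h₂
    | smul r _ _ h => rw [map_smul]; exact Submodule.smul_mem _ r h
    | mem z hz =>
      obtain ⟨g, x, ⟨a, b, hx, n, hn⟩, rfl⟩ := hz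
      simp only [P, LinearMap.comp_apply, diagCoact_tmul hx, TensorProduct.map_tmul,
        LinearEquiv.coe_coe, TensorProduct.rid_tmul]
      by_cases hg : dualRes T₀ (g * b) = 1
      · obtain ⟨m, hm⟩ := (dualRes_eq_one_iff T₀ _).1 hg
        refine Submodule.smul_mem _ _ (LinearMap.mem_range.2
          ⟨MonoidAlgebra.single (m * n⁻¹) 1 ⊗ₜ x, ?_⟩)
        rw [coinvEmbed_tmul hx, map_mul, map_inv, hm, hn]
        simp only [LinearMap.id_apply]
        congr 2
        group
      · simp [coeffAt_single, hg, -map_mul]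

end Semidirect

section Cocycles

variable {T : Type*} [CommGroup T] [TopologicalSpace T]
  {H : Type*} [Ring H] [HopfAlgebra ℂ H] [StarRing H] [StarModule ℂ H] {π : H →ₐc[ℂ] Pol T}
  {T₀ : Subgroup T}

/-! ### The bigrading of the semidirect product -/

variable (π T₀) in
/-- The bigrading of `ℂ[T/T₀] ⋉ H` by `T̂ × T̂` that is defined by the map
`i ⊗ π : ℂ[T/T₀] ⋉ H → ℂ[T] ⊗ ℂ[T]`: if `x ∈ H_{a,b}`, then `h ⊗ x` has the left degree `(h, a)`
and the right degree `(h a⁻¹ b, b)`. -/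
def SemidirectDegree (p q : PontryaginDual T × PontryaginDual T) (t : Pol (T ⧸ T₀) ⊗[ℂ] H) : Prop :=
  ∃ h n x, IsHomogeneous π p.2 q.2 x ∧ dualQuot T₀ n = p.2⁻¹ * q.2 ∧ p.1 = dualQuot T₀ h ∧
    q.1 = dualQuot T₀ (h * n) ∧ t = MonoidAlgebra.single h 1 ⊗ₜ x

lemma semidirectDegree_one : SemidirectDegree π T₀ 1 1 (semidirect π T₀).one :=
  ⟨1, 1, 1, isHomogeneous_one, by simp, by simp, by simp, rfl⟩

lemma isBigradedBy_semidirect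
    (hH : ∀ x : H, Coalgebra.comul (R := ℂ) (star x) = star (Coalgebra.comul (R := ℂ) x))
    (hπ : ∀ x : H, π (star x) = star (π x)) (hcoc : IsCocentral π T₀) :
    (semidirect π T₀).IsBigradedBy (SemidirectDegree π T₀) where
  span_eq_top := by
    rw [eq_top_iff, ← span_isPure hcoc]
    refine Submodule.span_mono ?_
    rintro _ ⟨h, a, b, x, ⟨hx, n, hn⟩, rfl⟩
    exact ⟨(dualQuot T₀ h, a), (dualQuot T₀ (h * n), b), h, n, x, hx, hn, rfl, rfl, rfl⟩
  comul_mem := by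
    rintro ⟨_, a⟩ ⟨_, b⟩ _ ⟨h, n, x, hx, hn, rfl, rfl, rfl⟩
    rw [semidirect_comul]
    have hx' : IsCoHomogeneous π T₀ a b x := ⟨hx, n, hn⟩
    refine (Submodule.map_span_le (bosonizationSplit _ h) _ _).2 ?_
      (Submodule.mem_map_of_mem ((isBigraded_coHomogeneous hcoc).comul_mem hx'))
    rintro _ ⟨c, y, z, ⟨hy, m, hm⟩, ⟨hz, l, hl⟩, rfl⟩
    have e : n = m * l := dualQuot_injective T₀ (by
      change _ = a⁻¹ * b at hn
      rw [map_mul, hm, hl, hn]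
      group)
    rw [bosonizationSplit_tmul (untwisted_coact hcoc hy hm)]
    exact Submodule.subset_span ⟨(dualQuot T₀ (h * m), c), _, _, ⟨h, m, y, hy, hm, rfl, rfl, rfl⟩,
      ⟨h * m, l, z, hz, hl, rfl, by rw [e, mul_assoc], rfl⟩, rfl⟩
  counit_eq_zero := by
    rintro ⟨p, a⟩ ⟨q, b⟩ _ ⟨h, n, x, hx, hn, hp, hq, rfl⟩ hpq
    rw [semidirect_counit]
    refine hx.counit_eq_zero fun hab => hpq ?_
    simp only at hab hn hp hq
    have e : n = 1 := dualQuot_injective T₀ (by rw [hn, hab, map_one, inv_mul_cancel])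
    rw [hp, hq, hab, e, mul_one]
  counit_left x := by
    rw [(isHopfStar_semidirect hH hπ hcoc).counit_comul, TensorProduct.lid_tmul, one_smul]
  counit_right x := by
    rw [(isHopfStar_semidirect hH hπ hcoc).comul_counit, TensorProduct.rid_tmul, one_smul]
  mul_mem := by
    rintro ⟨_, a⟩ ⟨_, b⟩ ⟨_, c⟩ ⟨_, d⟩ _ _ ⟨g, n, x, hx, hn, rfl, rfl, rfl⟩
      ⟨h, m, y, hy, hm, rfl, rfl, rfl⟩
    refine ⟨g * h, n * m, x * y, hx.mul hy, ?_, (map_mul _ _ _).symm, ?_,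
      semidirect_mul hcoc ⟨hx, n, hn⟩ g h y⟩
    · rw [map_mul, hn, hm, Prod.snd_mul, Prod.snd_mul, mul_inv, mul_mul_mul_comm]
    · rw [mul_mul_mul_comm, map_mul _ (g * n)]
      rfl
  antipode_mem := by
    rintro ⟨_, a⟩ ⟨_, b⟩ _ ⟨h, n, x, hx, hn, rfl, rfl, rfl⟩
    refine ⟨(h * n)⁻¹, n, _, hx.antipode, ?_, (map_inv _ _).symm, ?_,
      semidirect_antipode hcoc hx hn h⟩
    · rw [hn, Prod.snd_inv, Prod.snd_inv, inv_inv, mul_comm]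
    · rw [mul_inv, inv_mul_cancel_right, map_inv]
      rfl
  star_mem := by
    rintro ⟨_, a⟩ ⟨_, b⟩ _ ⟨h, n, x, hx, hn, rfl, rfl, rfl⟩
    refine ⟨h⁻¹, n⁻¹, _, hx.star hH hπ, ?_, (map_inv _ _).symm, ?_,
      semidirect_star hH hπ hcoc ⟨hx, n, hn⟩ h⟩
    · rw [map_inv, hn, mul_inv]
      rfl
    · rw [← mul_inv, map_inv]
      rfl

/-! ### The cocycles as bicharacters -/

variable (β : PontryaginDual T →* PontryaginDual T →* Circle)

/-- The bicharacter `((a, b), (c, d)) ↦ β(b, c d⁻¹)⁻¹` of `T̂ × T̂`. -/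
def twistChar :
    PontryaginDual T × PontryaginDual T →* PontryaginDual T × PontryaginDual T →* Circle :=
  ((β.comp (MonoidHom.snd _ _)).compl₂ (MonoidHom.fst _ _ / MonoidHom.snd _ _))⁻¹

lemma twistChar_apply (p p' : PontryaginDual T × PontryaginDual T) :
    twistChar β p p' = (β p.2 (p'.1 / p'.2))⁻¹ := rfl

lemma linExt₄_single {G : Type*} [CommGroup G] (J : G × G → G × G → ℂ) (a b c d : G) (r s : ℂ) :
    linExt₄ J ((MonoidAlgebra.single a 1 ⊗ₜ MonoidAlgebra.single b r) ⊗ₜ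
      (MonoidAlgebra.single c 1 ⊗ₜ MonoidAlgebra.single d s)) = r * s * J (a, b) (c, d) := by
  simp [linExt₄, linExt₂_single, mul_assoc]

lemma isBicharacter_cocycle₂ :
    (semidirect π T₀).IsBicharacter (SemidirectDegree π T₀) (twistChar β) (cocycle₂ π β T₀) := by
  rintro ⟨_, a⟩ ⟨_, b⟩ ⟨_, c⟩ ⟨_, d⟩ _ _ ⟨g, n, x, hx, hn, rfl, rfl, rfl⟩
    ⟨h, m, y, hy, hm, rfl, rfl, rfl⟩
  have hx' := hx.apply_left
  have hy' := hy.apply_left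
  simp [cocycle₂, hx', hy', MonoidAlgebra.smul_single, linExt₄_single, J₂, twistChar_apply,
    semidirect_counit, ← Circle.coe_inv_eq_conj, mul_comm, div_eq_mul_inv]

/-- The isomorphism of the coinvariants with `ℂ[T/T₀] ⊗ H`, `a ⊗ x ↦ a π(x₍₁₎) ⊗ x₍₂₎`. -/
def coinvEquiv (hcoc : IsCocentral π T₀) : coinvariants π T₀ ≃ₗ[ℂ] Pol (T ⧸ T₀) ⊗[ℂ] H :=
  ((LinearEquiv.ofInjective _ (coinvEmbed_injective hcoc)).trans
    (LinearEquiv.ofEq _ _ (range_coinvEmbed hcoc))).symm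

lemma coinvEmbed_coinvEquiv (hcoc : IsCocentral π T₀) (z : coinvariants π T₀) :
    coinvEmbed π T₀ (coinvEquiv hcoc z) = z :=
  congrArg Subtype.val ((coinvEquiv hcoc).symm_apply_apply z)

lemma isHopfStarHom_subtype
    (hH : ∀ x : H, Coalgebra.comul (R := ℂ) (star x) = star (Coalgebra.comul (R := ℂ) x))
    (hπ : ∀ x : H, π (star x) = star (π x)) (hcoc : IsCocentral π T₀) :
    (coinvariantOps π T₀).IsHopfStarHom (HopfStarOps.ofHopf _)
    (coinvariants π T₀).subtype :=
  HopfStarOps.isHopfStarHom_restrict (isHopfStarHom_coinvEmbed hH hπ hcoc) (range_coinvEmbed hcoc)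

lemma isHopfStar_coinvariantOps
    (hH : ∀ x : H, Coalgebra.comul (R := ℂ) (star x) = star (Coalgebra.comul (R := ℂ) x))
    (hπ : ∀ x : H, π (star x) = star (π x)) (hcoc : IsCocentral π T₀) :
    (coinvariantOps π T₀).IsHopfStar :=
  (isHopfStar_ofHopf (comul_star_tensor comul_star_groupAlgebra hH)).of_injective
    (Submodule.injective_subtype _) (isHopfStarHom_subtype hH hπ hcoc)

lemma isHopfStarHom_coinvEquiv
    (hH : ∀ x : H, Coalgebra.comul (R := ℂ) (star x) = star (Coalgebra.comul (R := ℂ) x))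
    (hπ : ∀ x : H, π (star x) = star (π x)) (hcoc : IsCocentral π T₀) :
    (coinvariantOps π T₀).IsHopfStarHom (semidirect π T₀) (coinvEquiv hcoc).toLinearMap := by
  refine .of_comp (isHopfStarHom_coinvEmbed hH hπ hcoc) ?_ (coinvEmbed_injective hcoc)
  convert isHopfStarHom_subtype hH hπ hcoc
  exact LinearMap.ext (coinvEmbed_coinvEquiv hcoc)

/-- If `z` corresponds to `h ⊗ x` with `x ∈ H_{a,b}`, then `z = h a⁻¹ ⊗ x`, so that the definition
of `J₁` leads to the same values `β(a, h' a'⁻¹)⁻¹` as that of `J₂`. -/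
lemma isBicharacter_cocycle₁
    (hH : ∀ x : H, Coalgebra.comul (R := ℂ) (star x) = star (Coalgebra.comul (R := ℂ) x))
    (hπ : ∀ x : H, π (star x) = star (π x)) (hcoc : IsCocentral π T₀) :
    (coinvariantOps π T₀).IsBicharacter
      (fun p q z => SemidirectDegree π T₀ p q (coinvEquiv hcoc z))
      (twistChar β) (cocycle₁ π β T₀) := by
  rintro ⟨_, a⟩ ⟨_, b⟩ ⟨_, c⟩ ⟨_, d⟩ z w ⟨g, n, x, hx, hn, rfl, rfl, hz⟩
    ⟨h, m, y, hy, hm, rfl, rfl, hw⟩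
  have hx' := hx.apply_left
  have hy' := hy.apply_left
  have hΦ := (isHopfStarHom_coinvEquiv hH hπ hcoc).map_counit
  have ez := coinvEmbed_coinvEquiv hcoc z
  rw [hz, coinvEmbed_tmul hx] at ez
  have ew := coinvEmbed_coinvEquiv hcoc w
  rw [hw, coinvEmbed_tmul hy] at ew
  rw [← hΦ z, ← hΦ w, LinearEquiv.coe_coe, hz, hw, semidirect_counit, semidirect_counit]
  simp [cocycle₁, ← ez, ← ew, hx', hy', MonoidAlgebra.smul_single, linExt₄_single, J₁,
    twistChar_apply, ← Circle.coe_inv_eq_conj, mul_comm, div_eq_mul_inv]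

/-- The twist of `ℂ[T/T₀] ⋉ H` is the bosonization of the transmutation: on homogeneous elements
the operations of both are multiples of those of `ℂ[T/T₀] ⋉ H`, with the same factors. -/
lemma isHopfStarHom_twist_semidirect
    (hH : ∀ x : H, Coalgebra.comul (R := ℂ) (star x) = star (Coalgebra.comul (R := ℂ) x))
    (hπ : ∀ x : H, π (star x) = star (π x)) (hcoc : IsCocentral π T₀) :
    ((semidirect π T₀).twist (cocycle₂ π β T₀)).IsHopfStarHom (bosonizedTransmutation π β T₀)
      (LinearEquiv.refl ℂ (Pol (T ⧸ T₀) ⊗[ℂ] H)).toLinearMap := by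
  have hO := isHopfStar_semidirect hH hπ hcoc
  have hb := isBigradedBy_semidirect hH hπ hcoc
  have hB := isBraidedHopfStar_transmutation (β := β) hH hπ hcoc
  have hJ := isBicharacter_cocycle₂ (π := π) (T₀ := T₀) β
  refine ⟨?_, rfl, fun x => ?_, fun x => rfl, ?_, ?_⟩
  · refine hb.ext₂ (B := ((semidirect π T₀).twist (cocycle₂ π β T₀)).mul)
      (B' := (bosonizedTransmutation π β T₀).mul) ?_
    rintro ⟨_, a⟩ ⟨_, b⟩ ⟨_, c⟩ ⟨_, d⟩ _ _ hp hq
    obtain ⟨g, n, x, hx, hn, rfl, rfl, rfl⟩ := id hp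
    obtain ⟨h, m, y, hy, hm, rfl, rfl, rfl⟩ := id hq
    rw [hJ.twist_mul hO hb hp hq, semidirect_mul hcoc ⟨hx, n, hn⟩, bosonizedTransmutation,
      bosonization_mul (quotCoact_apply hcoc hx hn), quotForm_single]
    -- The product of the transmutation is `transMul` up to unfolding, hence `erw`.
    erw [hx.transMul hy]
    simp [twistChar_apply, hn, hm, Circle.smul_def, TensorProduct.tmul_smul, smul_smul]
    congr 1
    field_simp
  · exact LinearMap.congr_fun TensorProduct.map_id _
  · refine hb.ext (f := ((semidirect π T₀).twist (cocycle₂ π β T₀)).antipode)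
      (g := (bosonizedTransmutation π β T₀).antipode) ?_
    rintro ⟨_, a⟩ ⟨_, b⟩ _ hp
    obtain ⟨h, n, x, hx, hn, rfl, rfl, rfl⟩ := id hp
    have e : (transmutation π β T₀).coact ((transmutation π β T₀).antipode x) =
        (transmutation π β T₀).antipode x ⊗ₜ MonoidAlgebra.single n 1 := by
      rw [hB.coact_antipode, show (transmutation π β T₀).coact x = _ from
        quotCoact_apply hcoc hx hn, TensorProduct.map_tmul]
      rfl
    rw [hJ.twist_antipode hO hb hp, semidirect_antipode hcoc hx hn, bosonizedTransmutation,
      bosonization_antipode (quotCoact_apply hcoc hx hn) e hB.mul_one, quotForm_single]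
    erw [hx.transAntipode]
    simp [twistChar_apply, hn, Circle.smul_def, TensorProduct.tmul_smul, smul_smul]
    congr 1
    field_simp
  · refine hb.ext (f := ((semidirect π T₀).twist (cocycle₂ π β T₀)).star)
      (g := (bosonizedTransmutation π β T₀).star) ?_
    rintro ⟨_, a⟩ ⟨_, b⟩ _ hp
    obtain ⟨h, n, x, hx, hn, rfl, rfl, rfl⟩ := id hp
    have e : (transmutation π β T₀).coact ((transmutation π β T₀).star x) =
        (transmutation π β T₀).star x ⊗ₜ MonoidAlgebra.single n⁻¹ 1 := by
      rw [hB.coact_star, show (transmutation π β T₀).coact x = _ from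
        quotCoact_apply hcoc hx hn, TensorProduct.map_tmul]
      simp [HopfStarOps.ofHopf, star_single]
    rw [hJ.twist_star hO hb hp, semidirect_star hH hπ hcoc ⟨hx, n, hn⟩, bosonizedTransmutation,
      bosonization_star e, quotForm_single]
    erw [hx.transStar]
    simp [twistChar_apply, hn, Circle.smul_def, TensorProduct.tmul_smul, smul_smul]
    congr 1
    field_simp

end Cocycles

end CocycleTwist

end

theorem mainTheorem1
    {T : Type*} [CommGroup T] [TopologicalSpace T] [IsTopologicalGroup T] [CompactSpace T]
    [T2Space T]
    {H : Type*} [Ring H] [HopfAlgebra ℂ H] [StarRing H] [StarModule ℂ H]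
    -- `H` is a Hopf `*`-algebra
    (hH : ∀ x : H, Coalgebra.comul (R := ℂ) (star x) = star (Coalgebra.comul (R := ℂ) x))
    -- `π : H → ℂ[T]` is a map of Hopf `*`-algebras
    (π : H →ₐc[ℂ] Pol T) (hπ : ∀ x : H, π (star x) = star (π x))
    -- a bicharacter on the dual group
    (β : PontryaginDual T →* PontryaginDual T →* Circle)
    (T₀ : Subgroup T) (hT₀ : IsClosed (T₀ : Set T)) (hcoc : IsCocentral π T₀) :
    -- `(ℂ[T] ⊗ H)^{Δ(T₀)}` is a Hopf `*`-subalgebra of `ℂ[T] ⊗ H`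
    (coinvariantOps π T₀).IsHopfStar ∧
    (coinvariantOps π T₀).IsHopfStarHom (HopfStarOps.ofHopf (Pol T ⊗[ℂ] H))
      (coinvariants π T₀).subtype ∧
    -- `ad_π` is a coaction by `ℂ[T/T₀]`
    TensorProduct.map .id (quotMap T₀ : Pol (T ⧸ T₀) →ₗ[ℂ] Pol T) ∘ₗ quotCoact π T₀ =
      adMap (π : H →ₗ[ℂ] Pol T) ∧
    -- `ℂ[T/T₀] ⋉ H` is a Hopf `*`-algebra
    (semidirect π T₀).IsHopfStar ∧
    -- `H_β` is a braided Hopf `*`-algebra over `(ℂ[T/T₀], i^*β)`, with bosonization `ℂ[T/T₀] # H_β`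
    (transmutation π β T₀).IsBraidedHopfStar (HopfStarOps.ofHopf (Pol (T ⧸ T₀)))
      (quotForm β T₀) ∧
    (bosonizedTransmutation π β T₀).IsHopfStar ∧
    -- `J₁` and `J₂` define unitary Hopf 2-cocycles, and the twists are Hopf `*`-algebras
    (coinvariantOps π T₀).IsUnitaryCocycle (cocycle₁ π β T₀) ∧
    (semidirect π T₀).IsUnitaryCocycle (cocycle₂ π β T₀) ∧
    ((coinvariantOps π T₀).twist (cocycle₁ π β T₀)).IsHopfStar ∧
    ((semidirect π T₀).twist (cocycle₂ π β T₀)).IsHopfStar ∧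
    -- the first isomorphism, `a ⊗ x ↦ a π(x₍₁₎) # x₍₂₎`
    (∃ Φ : coinvariants π T₀ ≃ₗ[ℂ] Pol (T ⧸ T₀) ⊗[ℂ] H,
      (∀ z, TensorProduct.map (quotMap T₀ : Pol (T ⧸ T₀) →ₗ[ℂ] Pol T) .id (Φ z) =
        thetaMap π (z : Pol T ⊗[ℂ] H)) ∧
      ((coinvariantOps π T₀).twist (cocycle₁ π β T₀)).IsHopfStarHom
        (bosonizedTransmutation π β T₀) Φ.toLinearMap) ∧
    -- the second isomorphism, `a ⊗ x ↦ a # x`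
    ((semidirect π T₀).twist (cocycle₂ π β T₀)).IsHopfStarHom
      (bosonizedTransmutation π β T₀)
      (LinearEquiv.refl ℂ (Pol (T ⧸ T₀) ⊗[ℂ] H)).toLinearMap := by
  have hN := isHopfStar_semidirect hH hπ hcoc
  have hC := isHopfStar_coinvariantOps hH hπ hcoc
  have hΦ := isHopfStarHom_coinvEquiv hH hπ hcoc
  have hb := isBigradedBy_semidirect hH hπ hcoc
  have hb' := hb.comap hC (coinvEquiv hcoc) hΦ
  have hJ₂ := isBicharacter_cocycle₂ (π := π) (T₀ := T₀) β
  have hJ₁ := isBicharacter_cocycle₁ β hH hπ hcoc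
  have h1 : SemidirectDegree π T₀ 1 1 (coinvEquiv hcoc (coinvariantOps π T₀).one) :=
    (hΦ.map_one.symm ▸ semidirectDegree_one :
      SemidirectDegree π T₀ 1 1 ((coinvEquiv hcoc).toLinearMap (coinvariantOps π T₀).one))
  have ht₂ := hJ₂.isHopfStar_twist hN hb semidirectDegree_one
  have hid := isHopfStarHom_twist_semidirect β hH hπ hcoc
  refine ⟨hC, isHopfStarHom_subtype hH hπ hcoc, LinearMap.ext (map_quotCoact hcoc), hN,
    isBraidedHopfStar_transmutation hH hπ hcoc,
    ht₂.of_injective (LinearEquiv.injective _) hid.symm, hJ₁.isUnitaryCocycle hC hb',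
    hJ₂.isUnitaryCocycle hN hb, hJ₁.isHopfStar_twist hC hb' h1, ht₂,
    ⟨coinvEquiv hcoc, fun z => ?_, ?_⟩, hid⟩
  · rw [← thetaMap_coinvEmbed hcoc, coinvEmbed_coinvEquiv]
  · exact hid.comp (hJ₁.isHopfStarHom_twist hC hb' hJ₂ hN hb hΦ fun _ _ _ h => h)
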